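/- Let $\mathfrak m,\mathfrak n\ge 0$ be integers, $N=\mathfrak m+\mathfrak n$, and put $[a]=0$ for $1\le a\le \mathfrak m$, $[a]=1$ for $\mathfrak m<a\le N$. Let $V=\mathbb C^{\mathfrak m|\mathfrak n}$ with basis $e_1,\dots,e_N$ of degrees $[1],\dots,[N]$ and matrix units $E_{ij}$ of degree $[i]+[j]$; all tensor products are $\mathbb Z_2$-graded. We consider two cases. (Y) Super-Yangian case, with parameter $\hbar\in\mathbb C$; put $q=1$, $\iota(u)=-u$, $u^{(a)}=u+\tfrac{\hbar}{2}(-1)^{[a]}$, and $$\mathfrak b(u,v)=u-v,\quad \mathfrak a_a(u,v)=u-v-(-1)^{[a]}\hbar,\quad \mathfrak c_{ab}(u,v)=-(-1)^{[b]}\hbar\ (a\ne b).$$ (Q) Quantum affine case, with parameter $q\in\mathbb C^\times$ and a fixed square root $q^{1/2}$; put $\iota(u)=1/u$, $u^{(a)}=u\,q^{-\frac12+[a]}$, and $$\mathfrak b(u,v)=\tfrac uv-\tfrac vu,\quad \mathfrak a_a(u,v)=\tfrac uv q^{1-2[a]}-\tfrac vu q^{2[a]-1},\quad \mathfrak c_{ab}(u,v)=(-1)^{[b]}(q-q^{-1})\left(\tfrac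 uv\right)^{\mathrm{sign}(b-a)}\ (a\neq b).$$ Put $\mathfrak w_{aa}=\mathfrak a_a-\mathfrak b$, $\mathfrak w_{ab}=\mathfrak c_{ab}$ for $a\ne b$, $\psi_a(u)=\mathfrak c_{a+1,a}(u,\iota(u))/\mathfrak a_a(u,\iota(u))$, and $u^{(1\dots l)}=(\dots(u^{(1)})^{(2)}\dots)^{(l)}$ (equal to $u$ for $l=0$). For $1\le k\le N$ let $\mathbb I^{(k)}=\sum_{i=k}^{N}E_{ii}$ and $$R^{(k)}_{12}(u,v)=\mathfrak b(u,v)\,\mathbb I^{(k)}\otimes\mathbb I^{(k)}+\sum_{i,j=k}^{N}\mathfrak w_{ij}(u,v)\,E_{ij}\otimes E_{ji},\qquad \bar R^{(k)}_{12}(u,v)=R^{(k)}_{12}(u,\iota(v)),$$ let $R^{(k)}_{21}$, $\bar R^{(k)}_{21}$ be obtained from these by the graded flip of the two matrix factors, and write $R=R^{(1)}$, $\bar R=\bar R^{(1)}$. The reflection algebra $\mathfrak D_{\mathfrak m|\mathfrak n}$ is the unital associative (super)algebra over $\mathbb C$ with generators $d_{ij}^{(r)}$ ($1\le i,j\le N$,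 $r\ge 0$) of degree $[i]+[j]$, collected in the series $d_{ij}(u)=\sum_{r\ge0}d_{ij}^{(r)}u^{-r}$ and the matrix $D(u)=\sum_{i,j}E_{ij}\otimes d_{ij}(u)$, with the defining relations $$R_{12}(u_1,u_2)D_1(u_1)\bar R_{21}(u_1,u_2)D_2(u_2)=D_2(u_2)\bar R_{12}(u_1,u_2)D_1(u_1)R_{21}(u_1,u_2).$$ Let $1\le k\le N-1$. Let $\mathcal I_k$ be the left ideal of $\mathfrak D_{\mathfrak m|\mathfrak n}$ generated by (the coefficients of) all $d_{ij}(u)$ with $i>j$ and $j<k$. A congruence of series modulo $\mathcal I_k$ means congruence of all coefficients, and functions of $u$ are expanded in powers of $u^{-1}$. (1) Let $F^{(k)}$ be any linear combination of products $d_{i_1j_1}(u_1)\cdots d_{i_lj_l}(u_l)$ all of whose indices $i_p,j_p$ are $\ge k$. Then $$d_{ij}(u)\,F^{(k)}\equiv 0\ \bmod \mathcal I_k\ \text{ for } i>j,\ j<k,\qquad [d_{ii}(u),F^{(k)}]\equiv 0\ \bmod\mathcal I_k\ \text{ for } i<k.$$ (2) For $k\le i,j\le N$ put $$d^{(k)}_{ij}(u)=d_{ij}(u^{(1\dots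 k-1)})-\delta_{ij}\sum_{a=1}^{k-1}q^{2(k-1-a)-4\sum_{l=a+1}^{k-1}[l]}\,\psi_a(u^{(a)})\,d_{aa}(u^{(1\dots k-1)}),\qquad \widehat D^{(k)}(u)=\sum_{i,j=k}^{N}E_{ij}\otimes d^{(k)}_{ij}(u).$$ Then, modulo $\mathcal I_k$, $\widehat D^{(k)}$ satisfies the reflection equation of $\mathfrak D_{\mathfrak m-k+1|\mathfrak n}$ (read $\mathfrak D_{0|N-k+1}$ if $k>\mathfrak m$): $$R^{(k)}_{12}(u_1,u_2)\widehat D^{(k)}_1(u_1)\bar R^{(k)}_{21}(u_1,u_2)\widehat D^{(k)}_2(u_2)\equiv\widehat D^{(k)}_2(u_2)\bar R^{(k)}_{12}(u_1,u_2)\widehat D^{(k)}_1(u_1)R^{(k)}_{21}(u_1,u_2)\ \bmod\mathcal I_k.$$ -/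

import Mathlib

namespace OpenChain

/-- The two families of models: the (super-)Yangian with deformation parameter `hbar`, and the
quantum affine (super)algebra with `q = s ^ 2` (so `s` is the chosen square root of `q`). -/
inductive Model : Type
  | yangian (hbar : ℂ) : Model
  | quantumAffine (s : ℂˣ) : Model

/-- The distinguished grading `[a]` of the index `a ∈ {1, …, m + n}`. -/
def grade (m a : ℕ) : ℕ := if a ≤ m then 0 else 1

namespace Model

/-- The parameter `q` (with `q = 1` for the Yangian). -/
noncomputable def q : Model → ℂ
  | yangian _ => 1
  | quantumAffine s => (s : ℂ) ^ 2

section SpectralFunctions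

/- The spectral parameters `u`, `v` are elements of a field `K` containing `ℂ` through the embedding
`emb`; below `K` is a field of Laurent series, and `u`, `v` are built from its formal variables. -/
variable {K : Type} [Field K] (emb : ℂ →+* K)

/-- The spectral parameter inversion `ι(u)`. -/
noncomputable def iota : Model → K → K
  | yangian _, u => -u
  | quantumAffine _, u => u⁻¹

/-- The shifted spectral parameter `u^{(a)}`: `u + (-1)^[a] ħ / 2`, respectively
`u q^{-1/2 + [a]}`. -/
noncomputable def shift (m a : ℕ) : Model → K → K
  | yangian hbar, u => u + emb (hbar / 2 * (-1) ^ grade m a)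
  | quantumAffine s, u => u * emb ((s : ℂ) ^ (-1 + 2 * (grade m a : ℤ)))

/-- The iterated shift `u^{(1…l)} = (…(u^{(1)})^{(2)}…)^{(l)}`; it is `u` for `l = 0`. -/
noncomputable def iterShift (M : Model) (m : ℕ) : ℕ → K → K
  | 0, u => u
  | l + 1, u => M.shift emb m (l + 1) (iterShift M m l u)

/-- The function `𝔟(u, v)`. -/
noncomputable def fb : Model → K → K → K
  | yangian _, u, v => u - v
  | quantumAffine _, u, v => u / v - v / u

/-- The function `𝔞_a(u, v)`, with `q = s ^ 2` in the quantum affine case. -/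
noncomputable def fa (m a : ℕ) : Model → K → K → K
  | yangian hbar, u, v => u - v - emb ((-1) ^ grade m a * hbar)
  | quantumAffine s, u, v =>
      u / v * emb (((s : ℂ) ^ 2) ^ (1 - 2 * (grade m a : ℤ)))
        - v / u * emb (((s : ℂ) ^ 2) ^ (2 * (grade m a : ℤ) - 1))

/-- The functions `𝔠_{ab}(u, v)`, for `a ≠ b`. -/
noncomputable def fc (m a b : ℕ) : Model → K → K → K
  | yangian hbar, _, _ => emb (-((-1) ^ grade m b * hbar))
  | quantumAffine s, u, v =>
      emb ((-1) ^ grade m b * ((s : ℂ) ^ 2 - ((s : ℂ) ^ 2)⁻¹)) * (if a < b then u / v else v / u)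

/-- The functions `𝔴_{ab}(u, v)`. -/
noncomputable def fw (M : Model) (m a b : ℕ) (u v : K) : K :=
  if a = b then M.fa emb m a u v - M.fb u v else M.fc emb m a b u v

/-- The functions `ψ_a(u) = 𝔠_{a+1,a}(u, ι(u)) / 𝔞_a(u, ι(u))`. -/
noncomputable def psi (M : Model) (m a : ℕ) (u : K) : K :=
  M.fc emb m (a + 1) a u (M.iota u) / M.fa emb m a u (M.iota u)

end SpectralFunctions

end Model

/-- The index set `{k, …, N}`. -/
abbrev Idx (k N : ℕ) : Type := ↥(Finset.Icc k N)

/-- Elements `∑ E_{ij} ⊗ E_{pr} ⊗ x_{ijpr}` of `End V ⊗ End V ⊗ B` with `V` spanned by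
`e_k, …, e_N`, given by their coefficients `x i j p r`. Only globally even elements occur: the
coefficient `x i j p r` has degree `[i] + [j] + [p] + [r]`. -/
abbrev Tensor2 (k N : ℕ) (B : Type) : Type := Idx k N → Idx k N → Idx k N → Idx k N → B

section TensorOperations

variable {k N : ℕ} {B : Type} [Ring B]

/-- The product of the graded tensor product `End V ⊗ End V ⊗ B` on globally even elements:
`(E_{ia} ⊗ E_{pc} ⊗ x) (E_{aj} ⊗ E_{cr} ⊗ y)` is `E_{ij} ⊗ E_{pr} ⊗ x y` up to the Koszul sign for
moving `E_{aj}` past `E_{pc}` and `x`, and `E_{cr}` past `x`. -/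
def gmul (m : ℕ) (X Y : Tensor2 k N B) : Tensor2 k N B := fun i j p r =>
  ∑ a : Idx k N, ∑ c : Idx k N,
    (-1) ^ ((grade m a + grade m j) * (grade m p + grade m c)
        + (grade m a + grade m j) * (grade m i + grade m a + grade m p + grade m c)
        + (grade m c + grade m r) * (grade m i + grade m a + grade m p + grade m c))
      * (X i a p c * Y a j c r)

/-- `X_{21}`: the graded flip of the two matrix factors. -/
def flip21 (m : ℕ) (X : Tensor2 k N B) : Tensor2 k N B := fun i j p r =>
  (-1) ^ ((grade m i + grade m j) * (grade m p + grade m r)) * X p r i j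

/-- `D_1 = ∑ E_{ij} ⊗ 1 ⊗ d_{ij}`. -/
def inFirst (D : Idx k N → Idx k N → B) : Tensor2 k N B := fun i j p r =>
  if p = r then D i j else 0

/-- `D_2 = ∑ 1 ⊗ E_{pr} ⊗ d_{pr}`. -/
def inSecond (D : Idx k N → Idx k N → B) : Tensor2 k N B := fun i j p r =>
  if i = j then D p r else 0

end TensorOperations

/-- The reduced `R`-matrix
`R^{(k)}_{12}(u, v) = 𝔟(u, v) 1 ⊗ 1 + ∑_{i, j ≥ k} 𝔴_{ij}(u, v) E_{ij} ⊗ E_{ji}`;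
for `k = 1` it is the full `R`-matrix. -/
noncomputable def Rmatrix {K : Type} [Field K] (emb : ℂ →+* K) (M : Model) (m k N : ℕ) (u v : K) :
    Tensor2 k N K := fun i j p r =>
  (if i = j ∧ p = r then M.fb u v else 0) + (if p = j ∧ r = i then M.fw emb m i j u v else 0)

/-- Laurent series in `u⁻¹` and `v⁻¹`: series in `u⁻¹` with coefficients series in `v⁻¹`. -/
abbrev Laurent2 (A : Type) [Zero A] : Type := LaurentSeries (LaurentSeries A)

/-- Complex numbers as constant series. -/
noncomputable def const : ℂ →+* LaurentSeries ℂ := HahnSeries.C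

/-- Complex numbers as constant series in two variables. -/
noncomputable def const2 : ℂ →+* Laurent2 ℂ :=
  (HahnSeries.C : LaurentSeries ℂ →+* Laurent2 ℂ).comp HahnSeries.C

/-- The variable `u` of Laurent series in `u⁻¹`. -/
noncomputable def varX : LaurentSeries ℂ := HahnSeries.single (-1) 1

/-- The variable `u` of `Laurent2 ℂ`. -/
noncomputable def varU : Laurent2 ℂ := HahnSeries.single (-1) 1

/-- The variable `v` of `Laurent2 ℂ`. -/
noncomputable def varV : Laurent2 ℂ := HahnSeries.C (HahnSeries.single (-1) 1)

section Reflection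

variable {A : Type} [Ring A]

/-- A series `f(u)` as a series in the two variables `u`, `v`. -/
noncomputable def atU (f : LaurentSeries A) : Laurent2 A :=
  HahnSeries.map f (HahnSeries.C : A →+* LaurentSeries A)

/-- The series `f(v)` as a series in the two variables `u`, `v`. -/
noncomputable def atV (f : LaurentSeries A) : Laurent2 A := HahnSeries.C f

variable [Algebra ℂ A]

/-- Scalar series as series with coefficients in `A`. -/
noncomputable def scal (f : LaurentSeries ℂ) : LaurentSeries A :=
  HahnSeries.map f (algebraMap ℂ A)

/-- Scalar series in two variables as series with coefficients in `A`. -/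
noncomputable def scal2 (f : Laurent2 ℂ) : Laurent2 A :=
  HahnSeries.map f
    (⟨scal, by ext; simp [scal]⟩ : ZeroHom (LaurentSeries ℂ) (LaurentSeries A))

/-- Scalar matrices, regarded as matrices over series with coefficients in `A`. -/
noncomputable def scalT {k N : ℕ} (X : Tensor2 k N (Laurent2 ℂ)) : Tensor2 k N (Laurent2 A) :=
  fun i j p r => scal2 (X i j p r)

/-- `R_{12}(u, v) D_1(u) R_{21}(u, ι(v)) D_2(v)`, with the reduced `R`-matrices `R^{(k)}`. -/
noncomputable def reflectionLHS (M : Model) (m k N : ℕ)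
    (D : Idx k N → Idx k N → LaurentSeries A) : Tensor2 k N (Laurent2 A) :=
  gmul m (gmul m (gmul m
    (scalT (Rmatrix const2 M m k N varU varV))
    (inFirst fun i j => atU (D i j)))
    (scalT (flip21 m (Rmatrix const2 M m k N varU (M.iota varV)))))
    (inSecond fun i j => atV (D i j))

/-- `D_2(v) R_{12}(u, ι(v)) D_1(u) R_{21}(u, v)`, with the reduced `R`-matrices `R^{(k)}`. -/
noncomputable def reflectionRHS (M : Model) (m k N : ℕ)
    (D : Idx k N → Idx k N → LaurentSeries A) : Tensor2 k N (Laurent2 A) :=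
  gmul m (gmul m (gmul m
    (inSecond fun i j => atV (D i j))
    (scalT (Rmatrix const2 M m k N varU (M.iota varV))))
    (inFirst fun i j => atU (D i j)))
    (scalT (flip21 m (Rmatrix const2 M m k N varU varV)))

/-- The series `∑_{r ≥ 0} c_r g(u)^{-r}` in `u⁻¹`, for a Laurent series `g(u)` in `u⁻¹` whose
leading term is a nonzero multiple of `u`. Then `g(u)^{-r}` is divisible by `u^{-r}`, so the
coefficient of `u^{-l}` is the finite sum below. -/
noncomputable def evalSeries (c : ℕ → A) (g : LaurentSeries ℂ) : LaurentSeries A :=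
  HahnSeries.ofPowerSeries ℤ A (PowerSeries.mk fun l =>
    ∑ r ∈ Finset.range (l + 1), (g⁻¹ ^ r).coeff (l : ℤ) • c r)

end Reflection

section ReflectionAlgebra

variable (M : Model) (m n : ℕ)

/-- Generators `d_{ij}^{(r)}`, with `1 ≤ i, j ≤ m + n` and `r ≥ 0`. -/
abbrev Gen : Type := Idx 1 (m + n) × Idx 1 (m + n) × ℕ

/-- `D(u) = (d_{ij}(u))` with `d_{ij}(u) = ∑_{r ≥ 0} d_{ij}^{(r)} u^{-r}`, over the free algebra. -/
noncomputable def freeD (i j : Idx 1 (m + n)) : LaurentSeries (FreeAlgebra ℂ (Gen m n)) :=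
  HahnSeries.ofPowerSeries ℤ _ (PowerSeries.mk fun r => FreeAlgebra.ι ℂ (i, j, r))

/-- The defining relations: all coefficients of all entries of the reflection equation
`R_{12}(u, v) D_1(u) R_{21}(u, ι(v)) D_2(v) = D_2(v) R_{12}(u, ι(v)) D_1(u) R_{21}(u, v)`. -/
inductive ReflRel : FreeAlgebra ℂ (Gen m n) → FreeAlgebra ℂ (Gen m n) → Prop
  | mk (i j p r : Idx 1 (m + n)) (a b : ℤ) : ReflRel
      (((reflectionLHS M m 1 (m + n) (freeD m n) i j p r).coeff a).coeff b)
      (((reflectionRHS M m 1 (m + n) (freeD m n) i j p r).coeff a).coeff b)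

/-- The reflection algebra `𝔇_{m|n}`. -/
def ReflectionAlgebra : Type := RingQuot (ReflRel M m n)

noncomputable instance : Ring (ReflectionAlgebra M m n) :=
  inferInstanceAs (Ring (RingQuot (ReflRel M m n)))

noncomputable instance : Algebra ℂ (ReflectionAlgebra M m n) :=
  inferInstanceAs (Algebra ℂ (RingQuot (ReflRel M m n)))

/-- The generators `d_{ij}^{(r)}` of the reflection algebra, the coefficients of
`d_{ij}(u) = ∑_{r ≥ 0} d_{ij}^{(r)} u^{-r}`. -/
noncomputable def gen (i j : Idx 1 (m + n)) (r : ℕ) : ReflectionAlgebra M m n :=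
  RingQuot.mkAlgHom ℂ (ReflRel M m n) (FreeAlgebra.ι ℂ (i, j, r))

/-- The left ideal `I_k` generated by (the coefficients of) the `d_{ij}(u)` with `i > j` and
`j < k`. -/
noncomputable def lowerIdeal (k : ℕ) : Ideal (ReflectionAlgebra M m n) :=
  Ideal.span {x | ∃ (i j : Idx 1 (m + n)) (r : ℕ), j < i ∧ (j : ℕ) < k ∧ x = gen M m n i j r}

/-- The linear combinations of products of (coefficients of) series `d_{ij}(u)` with all indices
`≥ k`. -/
noncomputable def upperSubalgebra (k : ℕ) : Subalgebra ℂ (ReflectionAlgebra M m n) :=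
  Algebra.adjoin ℂ
    {x | ∃ (i j : Idx 1 (m + n)) (r : ℕ), k ≤ (i : ℕ) ∧ k ≤ (j : ℕ) ∧ x = gen M m n i j r}

/-- Shifted and corrected generators
`d^{(k)}_{ij}(u) = d_{ij}(u^{(1…k-1)}) -
  δ_{ij} ∑_{a=1}^{k-1} q^{2(k-1-a) - 4 ∑_{l=a+1}^{k-1} [l]} ψ_a(u^{(a)}) d_{aa}(u^{(1…k-1)})`. -/
noncomputable def nestedD (k : ℕ) (i j : Idx 1 (m + n)) :
    LaurentSeries (ReflectionAlgebra M m n) :=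
  evalSeries (gen M m n i j) (M.iterShift const m (k - 1) varX) -
    if i = j then
      ∑ a : Idx 1 (m + n), if (a : ℕ) < k then
        scal (const
              (M.q ^ (2 * ((k : ℤ) - 1 - (a : ℕ)) -
                4 * ∑ l ∈ Finset.Ioo (a : ℕ) k, (grade m l : ℤ)))
            * M.psi const m a (M.shift const m a varX))
          * evalSeries (gen M m n a a) (M.iterShift const m (k - 1) varX)
      else 0
    else 0

end ReflectionAlgebra

/-- The inclusion `{k, …, N} ⊆ {1, …, N}` for `k ≥ 1`. -/
def liftIdx {k N : ℕ} (hk : 1 ≤ k) (i : Idx k N) : Idx 1 N :=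
  ⟨i, Finset.mem_Icc.mpr ⟨hk.trans (Finset.mem_Icc.mp i.2).1, (Finset.mem_Icc.mp i.2).2⟩⟩

/-- `D̂^{(k)}(u) = ∑_{i, j ≥ k} E_{ij} ⊗ d^{(k)}_{ij}(u)`. -/
noncomputable def hatD (M : Model) (m n : ℕ) {k : ℕ} (hk : 1 ≤ k) (i j : Idx k (m + n)) :
    LaurentSeries (ReflectionAlgebra M m n) :=
  nestedD M m n k (liftIdx hk i) (liftIdx hk j)

/-- Congruence of series modulo a left ideal: all coefficients are congruent. -/
def SeriesCongr {A : Type} [Ring A] (I : Ideal A) (X Y : Laurent2 A) : Prop :=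
  ∀ a b : ℤ, (X.coeff a).coeff b - (Y.coeff a).coeff b ∈ I

end OpenChain

/-! Congruences modulo a left ideal cannot be computed in a quotient ring. They are tested instead
on ℂ-linear functionals φ that vanish on the ideal, which separate it from its complement
(`mem_of_forall_functional`). Applied coefficientwise to the entries of the reflection equation, φ
produces the scalar system `ReflEq` over the field of Laurent series in two variables. Its unknowns
are A = ±φ(d_ij(u) d_pr(v)) and B = ±φ(d_ij(v) d_pr(u)), and over a field one may divide by the
structure functions. The left ideal enters only through the vanishing of A and B whenever the
right-hand factor is d_pl with p > l and l < k.

The core is the removal of the smallest index l, the pivot. Entries of the system with some indices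
equal to l show that lower entries d_il annihilate upper ones, that d_ll commutes with itself and
with all upper entries, and that A i l l r is a combination of the sums ∑ A i x x r over x > l and
of pivot terms. Substituting this back eliminates l as in a Schur complement. What remains is a
reflection equation on the indices above l for the generators corrected by -δ_ij ψ_l d_ll
(`PivotData.reflEq_reduce`). The shift u ↦ u^(l) makes 𝔞_l(u^(l), ι(v^(l))) equal to 𝔟(u, ι(v)),
while R itself is unaffected by a common shift. The scalar identities needed are collected in
`PivotData` and hold in both models (`trig_pivotData`, `rational_pivotData`).

Iterating from the generators at the fully shifted parameter gives the recursively corrected series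
`chainD`, which satisfy the reflection equation at every level (`valEq_chainD`). The recursion for ψ
(`Model.psi_recursion`) sums the corrections to the closed formula for d^(k), which gives statement
(2).

For statement (1) the same chain starts from the unshifted generators. Each level gives commutation
and annihilation for corrected series, and induction on the level removes the corrections, since
these only involve d_aa with smaller a (`comm_diagonal`, `lower_mul_upper`). Products and linear
combinations follow because right multiplication by upper elements preserves the left ideal. -/

namespace OpenChain

/-! ### Removing the smallest index from the scalar reflection equation -/

section Components

section Equations

variable {K : Type} [CommRing K]

/-- The left-hand side of the reflection equation in components. -/
def reflL (S : Finset ℕ) (η θ θb : ℕ → ℕ → K) (b bb : K) (A : ℕ → ℕ → ℕ → ℕ → K)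
    (i j p r : ℕ) : K :=
  b * bb * η i p * η j p * A i j p r
    + (if j = p then b * η i p * ∑ x ∈ S, θb p x * A i x x r else 0)
    + θ i p * bb * η i j * A p j i r
    + (if j = i then θ i p * ∑ x ∈ S, θb i x * A p x x r else 0)

/-- The right-hand side of the reflection equation in components. -/
def reflR (S : Finset ℕ) (η θ θb : ℕ → ℕ → K) (b bb : K) (B : ℕ → ℕ → ℕ → ℕ → K)
    (i j p r : ℕ) : K :=
  b * bb * η i r * η j r * B p r i j
    + (if r = i then b * η i j * ∑ x ∈ S, θb i x * B p x x j else 0)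
    + θ j r * bb * η i j * B p j i r
    + (if j = i then θ j r * ∑ x ∈ S, θb i x * B p x x r else 0)

/-- The reflection equation in components, for indices in `S`. -/
def ReflEq (S : Finset ℕ) (η θ θb : ℕ → ℕ → K) (b bb : K) (A B : ℕ → ℕ → ℕ → ℕ → K) : Prop :=
  ∀ i ∈ S, ∀ j ∈ S, ∀ p ∈ S, ∀ r ∈ S,
    reflL S η θ θb b bb A i j p r = reflR S η θ θb b bb B i j p r

end Equations

variable {K : Type} [Field K]

/-- The identities between the structure functions that are used to remove the index `l` from the
reflection equation. -/
structure PivotData (S : Finset ℕ) (l : ℕ) (η θ θb θb' : ℕ → ℕ → K)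
    (b bb bb' α β αb βb ψu ψv : K) : Prop where
  notMem : l ∉ S
  eta_comm : ∀ i p, η i p = η p i
  eta_sq : ∀ i p, η i p * η i p = 1
  -- In the models l lies below S, and off the diagonal θ depends only on the order of its two
  -- indices, so these values do not depend on x.
  alpha : ∀ x ∈ S, θ l x = α
  beta : ∀ x ∈ S, θ x l = β
  alphab : ∀ x ∈ S, θb l x = αb
  betab : ∀ x ∈ S, θb x l = βb
  -- In the models this reads 𝔞_l(u^(l), ι(v^(l))) = 𝔟(u, ι(v)), the property that dictates the
  -- shift.
  bb'_eq : bb' = bb + η l l * θb l l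
  b_ne : b ≠ 0
  bb_ne : bb ≠ 0
  bb'_ne : bb' ≠ 0
  diag_ne : ∀ i ∈ insert l S, b + η i i * θ i i ≠ 0
  det_ne : ∀ i ∈ insert l S, ∀ p ∈ insert l S, i ≠ p → b * b - θ i p * θ p i ≠ 0
  -- The Schur complement identity: eliminating the term through l turns θb into a multiple of θb'.
  thetab : ∀ p ∈ S, ∀ x ∈ S, bb' * θb p x = bb * θb' p x + η l l * βb * αb
  -- The remaining identities cancel the pivot terms: `psiU` and `psiV` in entries with i ≠ j and j
  -- = p or r = i, the `cross` and `diag` ones in entries with i = j and p ≠ r.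
  psiU : ∀ i ∈ S, ∀ p ∈ S, i ≠ p → ψu * (b * θb' p i + θ i p * bb') = η l l * βb * β
  psiV : ∀ p ∈ S, ∀ r ∈ S, ψv * (θ p r * bb' - b * θb' p r) = η l l * βb * α
  crossU : ∀ i ∈ S, ∀ p ∈ S, ∀ r ∈ S, i ≠ p → i ≠ r →
    θ i p * (η l l * βb * β - b * ψu * θb' i p) = θ i r * (η l l * βb * β - b * ψu * θb' i r)
  crossV : ∀ i ∈ S, ∀ p ∈ S, ∀ r ∈ S, i ≠ p → i ≠ r →
    θ i p * (η l l * βb * α + b * ψv * θb' i r) = θ i r * (η l l * βb * α + b * ψv * θb' i p)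
  diagU : ∀ i ∈ S, ∀ r ∈ S, i ≠ r →
    (η i i * b + θ i i) * (η l l * βb * β - b * ψu * θb' i i) - b * η i i * θ i i * bb' * ψu
      = θ i r * (η l l * βb * β - b * ψu * θb' i r)
  diagV : ∀ i ∈ S, ∀ r ∈ S, i ≠ r →
    (η i i * b + θ i i) * (η l l * βb * α + b * ψv * θb' i r) - b * η i i * θ i r * bb' * ψv
      = θ i r * (η l l * βb * α + b * ψv * θb' i i)

namespace PivotData

variable {S : Finset ℕ} {l : ℕ} {η θ θb θb' : ℕ → ℕ → K} {b bb bb' α β αb βb ψu ψv : K}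
  {A B : ℕ → ℕ → ℕ → ℕ → K}

/-- When the last index is the pivot, the left ideal kills every summand except x = l. -/
lemma sum_last (P : PivotData S l η θ θb θb' b bb bb' α β αb βb ψu ψv)
    {X : ℕ → ℕ → ℕ → ℕ → K}
    (hX : ∀ x ∈ insert l S, ∀ y ∈ insert l S, ∀ p ∈ S, X x y p l = 0) (f : ℕ → K)
    {i : ℕ} (hi : i ∈ insert l S) :
    ∑ x ∈ insert l S, f x * X i x x l = f l * X i l l l := by
  rw [Finset.sum_insert P.notMem, Finset.sum_eq_zero, add_zero]
  intro x hx
  rw [hX i hi x (Finset.mem_insert_of_mem hx) x hx, mul_zero]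

lemma eta_mul (P : PivotData S l η θ θb θb' b bb bb' α β αb βb ψu ψv) (i : ℕ) :
    η i l * η l l * (η i l * η l l) = 1 := by
  linear_combination (η l l * η l l) * P.eta_sq i l + P.eta_sq l l

section

variable (P : PivotData S l η θ θb θb' b bb bb' α β αb βb ψu ψv)
  (hRE : ReflEq (insert l S) η θ θb b bb A B)
  (hA : ∀ x ∈ insert l S, ∀ y ∈ insert l S, ∀ p ∈ S, A x y p l = 0)
  (hB : ∀ x ∈ insert l S, ∀ y ∈ insert l S, ∀ p ∈ S, B x y p l = 0)

include P hRE hA hB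

/-- The entry (l, l, l, l) factors as (b + η θ_ll) bb' times the difference, and neither factor
vanishes. -/
lemma pivot_pivot : A l l l l = B l l l l := by
  have hl := Finset.mem_insert_self l S
  have h := hRE l hl l hl l hl l hl
  simp only [reflL, reflR, if_true, P.sum_last hA _ hl, P.sum_last hB _ hl] at h
  have e := P.eta_sq l l
  have h2 : (b + η l l * θ l l) * bb' * (A l l l l - B l l l l) = 0 := by
    rw [P.bb'_eq]
    linear_combination h - (A l l l l - B l l l l) * (b * bb - θ l l * θb l l) * e
  have h3 := P.diag_ne l hl
  have h4 := P.bb'_ne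
  have : A l l l l - B l l l l = 0 := by
    simpa [h3, h4] using h2
  linear_combination this

/-- In the entry (i, l, l, l) only this unknown survives, once with bb and once with θb l l;
together the coefficients make bb'. -/
lemma lower_pivot_left {i : ℕ} (hi : i ∈ S) : A i l l l = 0 := by
  have hl := Finset.mem_insert_self l S
  have hi' := Finset.mem_insert_of_mem (b := l) hi
  have hne : l ≠ i := fun h => P.notMem (h ▸ hi)
  have h := hRE i hi' l hl l hl l hl
  simp only [reflL, reflR, if_true, if_neg hne, P.sum_last hA _ hi',
    hA l hl l hl i hi, hB l hl l hl i hi] at h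
  have h2 : b * η i l * η l l * bb' * A i l l l = 0 := by
    rw [P.bb'_eq]
    linear_combination h + b * η i l * θb l l * A i l l l * P.eta_sq l l
  have h3 := P.eta_mul i
  have h4 : η i l * η l l ≠ 0 := fun h => by rw [h] at h3; simp at h3
  have h5 : (b * bb') * (η i l * η l l) * A i l l l = 0 := by linear_combination h2
  simpa [P.b_ne, P.bb'_ne, h4] using h5

lemma lower_pivot_right {i : ℕ} (hi : i ∈ S) : B i l l l = 0 := by
  have hl := Finset.mem_insert_self l S
  have hi' := Finset.mem_insert_of_mem (b := l) hi
  have hne : l ≠ i := fun h => P.notMem (h ▸ hi)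
  have h := hRE l hl l hl i hi' l hl
  simp only [reflL, reflR, if_true, if_neg hne, P.sum_last hA _ hi', P.sum_last hB _ hi',
    hA l hl l hl i hi, P.lower_pivot_left hRE hA hB hi] at h
  have h2 : (b + η l l * θ l l) * bb' * B i l l l = 0 := by
    rw [P.bb'_eq]
    linear_combination - h - (B i l l l) * (b * bb - θ l l * θb l l) * P.eta_sq l l
  simpa [P.diag_ne l hl, P.bb'_ne] using h2

/-- The entry (i, r, p, l) has this as its only surviving term, all others having right-hand factor
in column l. -/
lemma lower_upper_right {i p r : ℕ} (hi : i ∈ S) (hp : p ∈ S) (hr : r ∈ S) : B p l i r = 0 := by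
  have hl := Finset.mem_insert_self l S
  have hi' := Finset.mem_insert_of_mem (b := l) hi
  have hp' := Finset.mem_insert_of_mem (b := l) hp
  have hr' := Finset.mem_insert_of_mem (b := l) hr
  have hne : l ≠ i := fun h => P.notMem (h ▸ hi)
  have h := hRE i hi' r hr' p hp' l hl
  simp only [reflL, reflR, if_neg hne, P.sum_last hA _ hi',
    P.sum_last hA _ hp', P.sum_last hB _ hp', hA i hi' r hr' p hp, hA p hp' r hr' i hi,
    hB p hp' r hr' i hi, P.lower_pivot_left hRE hA hB hi, P.lower_pivot_left hRE hA hB hp,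
    P.lower_pivot_right hRE hA hB hp, mul_zero, ite_self, add_zero] at h
  have e1 := P.eta_sq i l
  have e2 := P.eta_sq r l
  have h4 : η i l ≠ 0 := fun h => by simp [h] at e1
  have h5 : η r l ≠ 0 := fun h => by simp [h] at e2
  simpa [P.b_ne, P.bb_ne, h4, h5] using h.symm

/-- The entries (i, l, p, r) and (p, l, i, r) form a homogeneous 2 × 2 system in A i l p r and A p l
i r with determinant b² - θ_ip θ_pi up to sign. For i = p it degenerates to one equation with
coefficient 𝔞_i. -/
lemma lower_upper_left {i p r : ℕ} (hi : i ∈ S) (hp : p ∈ S) (hr : r ∈ S) : A i l p r = 0 := by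
  have hl := Finset.mem_insert_self l S
  have key : ∀ i ∈ S, ∀ p ∈ S,
      b * η i p * η l p * A i l p r + θ i p * η i l * A p l i r = 0 := by
    intro i hi p hp
    have hi' := Finset.mem_insert_of_mem (b := l) hi
    have hp' := Finset.mem_insert_of_mem (b := l) hp
    have hr' := Finset.mem_insert_of_mem (b := l) hr
    have hne : l ≠ i := fun h => P.notMem (h ▸ hi)
    have hne' : l ≠ p := fun h => P.notMem (h ▸ hp)
    have h := hRE i hi' l hl p hp' r hr'
    simp only [reflL, reflR, if_neg hne, if_neg hne',
      P.sum_last hB _ hp', hB p hp' r hr' i hi,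
      P.lower_pivot_right hRE hA hB hp, P.lower_upper_right hRE hA hB hi hp hr,
      mul_zero, ite_self, add_zero] at h
    have : bb * (b * η i p * η l p * A i l p r + θ i p * η i l * A p l i r) = 0 := by
      linear_combination h
    simpa [P.bb_ne] using this
  have h1 := key i hi p hp
  have ei := P.eta_sq i l
  have ep := P.eta_sq l p
  have eip := P.eta_sq i p
  have hi0 : η i l ≠ 0 := fun h => by simp [h] at ei
  have hi'' := Finset.mem_insert_of_mem (b := l) hi
  have hp'' := Finset.mem_insert_of_mem (b := l) hp
  by_cases hip : i = p
  · subst hip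
    have : (b + η i i * θ i i) * A i l i r = 0 := by
      rw [P.eta_comm l i] at h1
      linear_combination η i i * η i l * h1 - b * A i l i r * (η i l * η i l * eip + ei)
        - η i i * θ i i * A i l i r * ei
    simpa [P.diag_ne i hi''] using this
  · have h2 := key p hp i hi
    have hd := P.det_ne i hi'' p hp'' hip
    rw [P.eta_comm p i, P.eta_comm l i, P.eta_comm p l] at h2
    have : (b * b - θ i p * θ p i) * A i l p r = 0 := by
      linear_combination b * η i p * η l p * h1 - θ i p * η l p * h2
        - b * b * A i l p r * (η l p * η l p * eip + ep) + θ i p * θ p i * A i l p r * ep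
    simpa [hd] using this

/-- In the entry (p, r, l, l) the contact terms on both sides are multiples of the pivot square and
cancel by `pivot_pivot`. -/
lemma pivot_comm_right {p r : ℕ} (hp : p ∈ S) (hr : r ∈ S) : A p r l l = B l l p r := by
  have hl := Finset.mem_insert_self l S
  have hp' := Finset.mem_insert_of_mem (b := l) hp
  have hr' := Finset.mem_insert_of_mem (b := l) hr
  have hne : l ≠ p := fun h => P.notMem (h ▸ hp)
  have hne' : r ≠ l := fun h => P.notMem (h ▸ hr)
  have h := hRE p hp' r hr' l hl l hl
  simp only [reflL, reflR, if_neg hne, if_neg hne', P.sum_last hA _ hl, P.sum_last hB _ hl,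
    hA l hl r hr' p hp, hB l hl r hr' p hp, P.beta p hp, P.beta r hr,
    P.pivot_pivot hRE hA hB, mul_zero, add_zero, add_left_inj] at h
  have e1 := P.eta_sq p l
  have e2 := P.eta_sq r l
  have h4 : η p l ≠ 0 := fun h => by simp [h] at e1
  have h5 : η r l ≠ 0 := fun h => by simp [h] at e2
  exact mul_left_cancel₀ (mul_ne_zero (mul_ne_zero (mul_ne_zero P.b_ne P.bb_ne) h4) h5) h

/-- The entry (i, l, l, r), solved for the product that passes through the pivot; this is the
elimination formula. -/
lemma through_pivot_left {i r : ℕ} (hi : i ∈ S) (hr : r ∈ S) :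
    η l l * b * bb' * A i l l r = - b * αb * ∑ x ∈ S, A i x x r - β * bb * A l l i r
      + α * bb * B l l i r + if r = i then b * βb * A l l l l else 0 := by
  have hl := Finset.mem_insert_self l S
  have hi' := Finset.mem_insert_of_mem (b := l) hi
  have hr' := Finset.mem_insert_of_mem (b := l) hr
  have hne : l ≠ i := fun h => P.notMem (h ▸ hi)
  have h := hRE i hi' l hl l hl r hr'
  have hs : ∑ x ∈ S, θb l x * A i x x r = αb * ∑ x ∈ S, A i x x r := by
    rw [Finset.mul_sum]
    exact Finset.sum_congr rfl fun x hx => by rw [P.alphab x hx]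
  simp only [reflL, reflR, if_neg hne, if_true, P.sum_last hB _ hl, hB l hl r hr' i hi,
    Finset.sum_insert P.notMem, hs, P.beta i hi, P.alpha r hr, P.betab i hi,
    ← P.pivot_pivot hRE hA hB] at h
  have e1 := P.eta_sq i l
  have e2 := P.eta_sq l l
  rw [P.bb'_eq]
  split_ifs with hri
  · rw [if_pos hri] at h
    linear_combination η i l * h - (b * bb * η l l * A i l l r
      + b * αb * (∑ x ∈ S, A i x x r) + b * θb l l * A i l l r + β * bb * A l l i r
      - α * bb * B l l i r - b * βb * A l l l l) * e1 + b * θb l l * A i l l r * e2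
  · rw [if_neg hri] at h
    linear_combination η i l * h - (b * bb * η l l * A i l l r
      + b * αb * (∑ x ∈ S, A i x x r) + b * θb l l * A i l l r + β * bb * A l l i r
      - α * bb * B l l i r) * e1 + b * θb l l * A i l l r * e2

lemma through_pivot_right {p r : ℕ} (hp : p ∈ S) (hr : r ∈ S) :
    η l l * b * bb' * B p l l r = - b * αb * ∑ x ∈ S, B p x x r - β * bb * B p r l l
      + α * bb * A p r l l + if r = p then b * βb * A l l l l else 0 := by
  have hl := Finset.mem_insert_self l S
  have hp' := Finset.mem_insert_of_mem (b := l) hp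
  have hr' := Finset.mem_insert_of_mem (b := l) hr
  have hne : r ≠ l := fun h => P.notMem (h ▸ hr)
  have h := hRE l hl r hr' p hp' l hl
  have hs : ∑ x ∈ S, θb l x * B p x x r = αb * ∑ x ∈ S, B p x x r := by
    rw [Finset.mul_sum]
    exact Finset.sum_congr rfl fun x hx => by rw [P.alphab x hx]
  simp only [reflL, reflR, if_neg hne, if_true, P.sum_last hA _ hl, hA l hl r hr' p hp,
    Finset.sum_insert P.notMem, hs, P.beta r hr, P.alpha p hp, P.betab p hp] at h
  have e1 := P.eta_sq l r
  have e2 := P.eta_sq l l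
  rw [P.bb'_eq]
  rw [P.eta_comm r l] at h
  split_ifs with hri
  · subst hri
    rw [if_pos rfl] at h
    linear_combination - η l r * h - (b * bb * η l l * B r l l r
      + b * αb * (∑ x ∈ S, B r x x r) + b * θb l l * B r l l r + β * bb * B r r l l
      - α * bb * A r r l l - b * βb * A l l l l) * e1 + b * θb l l * B r l l r * e2
  · rw [if_neg hri] at h
    linear_combination - η l r * h - (b * bb * η l l * B p l l r
      + b * αb * (∑ x ∈ S, B p x x r) + b * θb l l * B p l l r + β * bb * B p r l l
      - α * bb * A p r l l) * e1 + b * θb l l * B p l l r * e2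

/-- The entry (l, l, p, r) still contains products through the pivot. Eliminating them leaves the
difference with coefficient b² - αβ, the nonzero determinant. -/
lemma pivot_comm_left {p r : ℕ} (hp : p ∈ S) (hr : r ∈ S) : A l l p r = B p r l l := by
  have hl := Finset.mem_insert_self l S
  have hp' := Finset.mem_insert_of_mem (b := l) hp
  have hr' := Finset.mem_insert_of_mem (b := l) hr
  have hne : l ≠ p := fun h => P.notMem (h ▸ hp)
  have hne' : r ≠ l := fun h => P.notMem (h ▸ hr)
  have h := hRE l hl l hl p hp' r hr'
  have hs : ∑ x ∈ S, θb l x * A p x x r = αb * ∑ x ∈ S, A p x x r := by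
    rw [Finset.mul_sum]
    exact Finset.sum_congr rfl fun x hx => by rw [P.alphab x hx]
  have hs' : ∑ x ∈ S, θb l x * B p x x r = αb * ∑ x ∈ S, B p x x r := by
    rw [Finset.mul_sum]
    exact Finset.sum_congr rfl fun x hx => by rw [P.alphab x hx]
  have tl := P.through_pivot_left hRE hA hB hp hr
  have tr := P.through_pivot_right hRE hA hB hp hr
  have cr := P.pivot_comm_right hRE hA hB hp hr
  simp only [reflL, reflR, if_neg hne, if_neg hne', if_true, Finset.sum_insert P.notMem, hs, hs',
    P.alpha p hp, P.alpha r hr] at h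
  have e1 := P.eta_sq l p
  have e2 := P.eta_sq l r
  have e3 := P.eta_sq l l
  have hd := P.det_ne l hl p hp' hne
  rw [P.alpha p hp, P.beta p hp] at hd
  rw [P.bb'_eq] at tl tr
  have h2 : bb * ((b * b - α * β) * (A l l p r - B p r l l)) = 0 := by
    linear_combination b * h - α * (tl - tr) - b * b * bb * (A l l p r * e1 - B p r l l * e2)
      + α * b * θb l l * (A p l l r - B p l l r) * e3 + α * α * bb * cr
  have h3 : A l l p r - B p r l l = 0 := by
    simpa [P.bb_ne, hd] using h2
  linear_combination h3

end

end PivotData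

/-! ### The reflection equation for the corrected values -/

/-- The values after the diagonal entries have been corrected by multiples of the pivot. -/
def reduce (l : ℕ) (ψ φ : K) (X : ℕ → ℕ → ℕ → ℕ → K) (i j p r : ℕ) : K :=
  X i j p r - (if i = j then ψ * X l l p r else 0) - (if p = r then φ * X i j l l else 0)
    + if i = j then if p = r then ψ * φ * X l l l l else 0 else 0

lemma sum_reduce {S : Finset ℕ} (l : ℕ) (ψ φ : K) (X : ℕ → ℕ → ℕ → ℕ → K) (f : ℕ → K)
    {i r : ℕ} (hi : i ∈ S) (hr : r ∈ S) :
    ∑ x ∈ S, f x * reduce l ψ φ X i x x r = ∑ x ∈ S, f x * X i x x r - f i * ψ * X l l i r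
      - f r * φ * X i r l l + if i = r then ψ * φ * f i * X l l l l else 0 := by
  have h1 : ∀ x, f x * reduce l ψ φ X i x x r = f x * X i x x r
      - (if i = x then f x * ψ * X l l x r else 0) - (if x = r then f x * φ * X i x l l else 0)
      + if i = x then if x = r then f x * ψ * φ * X l l l l else 0 else 0 := by
    intro x
    unfold reduce
    split_ifs <;> ring
  simp only [h1, Finset.sum_add_distrib, Finset.sum_sub_distrib, Finset.sum_ite_eq,
    Finset.sum_ite_eq', hi, hr, if_true]
  split_ifs <;> ring

namespace PivotData

variable {S : Finset ℕ} {l : ℕ} {η θ θb θb' : ℕ → ℕ → K} {b bb bb' α β αb βb ψu ψv : K}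
  {A B : ℕ → ℕ → ℕ → ℕ → K}

section

variable (P : PivotData S l η θ θb θb' b bb bb' α β αb βb ψu ψv)
  (hRE : ReflEq (insert l S) η θ θb b bb A B)
  (hA : ∀ x ∈ insert l S, ∀ y ∈ insert l S, ∀ p ∈ S, A x y p l = 0)
  (hB : ∀ x ∈ insert l S, ∀ y ∈ insert l S, ∀ p ∈ S, B x y p l = 0)

include P hRE hA hB

/-- Trades the contraction over S with θb' for the contraction over all indices with θb: `thetab`
changes the coefficients, `through_pivot_left` absorbs the summand x = l, and the rest are explicit
pivot terms. -/
lemma sum_reduce_left {i p r : ℕ} (hi : i ∈ S) (hp : p ∈ S) (hr : r ∈ S) :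
    b * bb * ∑ x ∈ S, θb' p x * reduce l ψu ψv A i x x r
      = b * bb' * ∑ x ∈ insert l S, θb p x * A i x x r
        + (η l l * βb * β - b * ψu * θb' p i) * bb * A l l i r
        - (η l l * βb * α + b * ψv * θb' p r) * bb * A i r l l
        + if i = r then b * (bb * ψu * ψv * θb' p i - η l l * βb * βb) * A l l l l else 0 := by
  have tl := P.through_pivot_left hRE hA hB hi hr
  have cr := P.pivot_comm_right hRE hA hB hi hr
  have hs : bb' * ∑ x ∈ S, θb p x * A i x x r
      = bb * ∑ x ∈ S, θb' p x * A i x x r + η l l * βb * αb * ∑ x ∈ S, A i x x r := by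
    simp only [Finset.mul_sum, ← Finset.sum_add_distrib]
    refine Finset.sum_congr rfl fun x hx => ?_
    linear_combination A i x x r * P.thetab p hp x hx
  rw [sum_reduce l ψu ψv A _ hi hr, Finset.sum_insert P.notMem, P.betab p hp]
  have e3 := P.eta_sq l l
  by_cases h : i = r
  · subst h
    simp only [if_true] at tl ⊢
    linear_combination - b * hs - η l l * βb * tl + b * bb' * βb * A i l l i * e3
      + η l l * βb * α * bb * cr
  · rw [if_neg (Ne.symm h)] at tl
    simp only [if_neg h]
    linear_combination - b * hs - η l l * βb * tl + b * bb' * βb * A i l l r * e3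
      + η l l * βb * α * bb * cr

lemma sum_reduce_right {i p r : ℕ} (hi : i ∈ S) (hp : p ∈ S) (hr : r ∈ S) :
    b * bb * ∑ x ∈ S, θb' i x * reduce l ψv ψu B p x x r
      = b * bb' * ∑ x ∈ insert l S, θb i x * B p x x r
        - (η l l * βb * α + b * ψv * θb' i p) * bb * A p r l l
        + (η l l * βb * β - b * ψu * θb' i r) * bb * A l l p r
        + if p = r then b * (bb * ψu * ψv * θb' i p - η l l * βb * βb) * A l l l l else 0 := by
  have tr := P.through_pivot_right hRE hA hB hp hr
  have cr := P.pivot_comm_right hRE hA hB hp hr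
  have cl := P.pivot_comm_left hRE hA hB hp hr
  have cc := P.pivot_pivot hRE hA hB
  have hs : bb' * ∑ x ∈ S, θb i x * B p x x r
      = bb * ∑ x ∈ S, θb' i x * B p x x r + η l l * βb * αb * ∑ x ∈ S, B p x x r := by
    simp only [Finset.mul_sum, ← Finset.sum_add_distrib]
    refine Finset.sum_congr rfl fun x hx => ?_
    linear_combination B p x x r * P.thetab i hi x hx
  rw [sum_reduce l ψv ψu B _ hp hr, Finset.sum_insert P.notMem, P.betab i hi, ← cr, ← cl, ← cc]
  rw [← cl] at tr
  have e3 := P.eta_sq l l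
  by_cases h : p = r
  · subst h
    simp only [if_true] at tr ⊢
    linear_combination - b * hs - η l l * βb * tr + b * bb' * βb * B p l l p * e3
  · rw [if_neg (Ne.symm h)] at tr
    simp only [if_neg h]
    linear_combination - b * hs - η l l * βb * tr + b * bb' * βb * B p l l r * e3

/-- Removing the pivot from the reflection equation. -/
lemma reflEq_reduce :
    ReflEq S η θ θb' b bb' (reduce l ψu ψv A) (reduce l ψv ψu B) := by
  intro i hi j hj p hp r hr
  have h := hRE i (Finset.mem_insert_of_mem hi) j (Finset.mem_insert_of_mem hj)
    p (Finset.mem_insert_of_mem hp) r (Finset.mem_insert_of_mem hr)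
  -- The factor b * bb is the one with which the contractions are expressed in `sum_reduce_left` and
  -- `sum_reduce_right`; the new equation then becomes b * bb' times the old one plus pivot terms.
  refine mul_left_cancel₀ (mul_ne_zero P.b_ne P.bb_ne) ?_
  have a1 := P.sum_reduce_left hRE hA hB hi hp hr
  have a2 := P.sum_reduce_left hRE hA hB hp hi hr
  have b1 := P.sum_reduce_right hRE hA hB hi hp hj
  have b2 := P.sum_reduce_right hRE hA hB hi hp hr
  have cr := P.pivot_comm_right hRE hA hB hp hr
  have cl := P.pivot_comm_left hRE hA hB hp hr
  have cr' := P.pivot_comm_right hRE hA hB hi hj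
  have cl' := P.pivot_comm_left hRE hA hB hi hj
  have dr := P.pivot_comm_right hRE hA hB hp hj
  have dl := P.pivot_comm_left hRE hA hB hp hj
  have dr' := P.pivot_comm_right hRE hA hB hi hr
  have dl' := P.pivot_comm_left hRE hA hB hi hr
  have cc := P.pivot_pivot hRE hA hB
  simp only [reflL, reflR] at h ⊢
  generalize (∑ x ∈ S, θb' p x * reduce l ψu ψv A i x x r) = s1 at *
  generalize (∑ x ∈ S, θb' i x * reduce l ψu ψv A p x x r) = s2 at *
  generalize (∑ x ∈ S, θb' i x * reduce l ψv ψu B p x x j) = s3 at *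
  generalize (∑ x ∈ S, θb' i x * reduce l ψv ψu B p x x r) = s4 at *
  generalize (∑ x ∈ insert l S, θb p x * A i x x r) = t1 at *
  generalize (∑ x ∈ insert l S, θb i x * A p x x r) = t2 at *
  generalize (∑ x ∈ insert l S, θb i x * B p x x j) = t3 at *
  generalize (∑ x ∈ insert l S, θb i x * B p x x r) = t4 at *
  -- Commutation with the pivot rewrites all pivot values of B through A, so cancellation can be
  -- checked coefficient by coefficient, according to which indices coincide.
  simp only [reduce, ← cl, ← cr', ← dl, ← dr', ← cc]
  by_cases hij : i = j
  · subst hij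
    by_cases hip : i = p
    · subst hip
      by_cases hir : i = r
      · subst hir
        simp only [if_true] at *
        linear_combination b * bb' * h + b * η i i * a1 + θ i i * a2 - b * η i i * b1 - θ i i * b2
      · have j6 := P.diagU i hi r hr hir
        have j7 := P.diagV i hi r hr hir
        simp only [if_true, if_neg hir, if_neg (Ne.symm hir)] at *
        linear_combination b * bb' * h + b * η i i * a1 + θ i i * a2 - θ i r * b2
          + bb * A l l i r * j6 - bb * A i r l l * j7
          - b * b * bb * bb' * ψu * A l l i r * (P.eta_sq i i - P.eta_sq i r)
    · by_cases hir : r = i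
      · subst hir
        have j6 := P.diagU r hi p hp hip
        have j7 := P.diagV r hi p hp hip
        simp only [if_true, if_neg hip, if_neg (Ne.symm hip)] at *
        linear_combination b * bb' * h + θ r p * a2 - b * η r r * b1 - θ r r * b2
          - bb * A l l p r * j6 + bb * A p r l l * j7
          - b * b * bb * bb' * ψu * A l l p r * (P.eta_sq r p - P.eta_sq r r)
      · by_cases hpr : p = r
        · subst hpr
          simp only [if_true, if_neg hip, if_neg (Ne.symm hip)] at *
          linear_combination b * bb' * h + θ i p * a2 - θ i p * b2
        · have j3 := P.crossU i hi p hp r hr hip (Ne.symm hir)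
          have j4 := P.crossV i hi p hp r hr hip (Ne.symm hir)
          simp only [if_true, if_neg hip, if_neg hir, if_neg hpr, if_neg (Ne.symm hip),
            if_neg (Ne.symm hir)] at *
          linear_combination b * bb' * h + θ i p * a2 - θ i r * b2
            + bb * A l l p r * j3 - bb * A p r l l * j4
          - b * b * bb * bb' * ψu * A l l p r * (P.eta_sq i p - P.eta_sq i r)
  · by_cases hjp : j = p
    · subst hjp
      have j1 := P.psiU i hi j hj hij
      by_cases hir : r = i
      · subst hir
        have j2 := P.psiV j hj r hr
        have j1' := P.psiU j hj r hr (Ne.symm hij)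
        have j2' := P.psiV r hr j hj
        simp only [if_true, if_neg hij, if_neg (Ne.symm hij)] at *
        linear_combination b * bb' * h + b * η r j * a1 - b * η r j * b1
          - b * bb * η r j * A l l r r * j1 + b * bb * η r j * A r r l l * j2
          + b * bb * η r j * A l l j j * j1' - b * bb * η r j * A j j l l * j2'
          + b * bb * η r j * ψv * A l l l l * (j1 - j1')
      · have j2 := P.psiV j hj r hr
        simp only [if_true, if_neg hij, if_neg hir, if_neg (Ne.symm hij),
            if_neg (Ne.symm hir)] at *
        by_cases hjr : j = r
        · subst hjr
          simp only [if_true] at *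
          linear_combination b * bb' * h + b * η i j * a1
            - b * bb * η i j * A l l i j * j1 + b * bb * η i j * A i j l l * j2
        · simp only [if_neg hjr] at *
          linear_combination b * bb' * h + b * η i j * a1
            - b * bb * η i j * A l l i r * j1 + b * bb * η i j * A i r l l * j2
    · by_cases hir : r = i
      · subst hir
        have j1 := P.psiU j hj r hr (Ne.symm hij)
        have j2 := P.psiV r hr p hp
        simp only [if_true, if_neg hij, if_neg hjp, if_neg (Ne.symm hij),
            if_neg (Ne.symm hjp)] at *
        by_cases hpr : p = r
        · subst hpr
          simp only [if_true] at *
          linear_combination b * bb' * h - b * η p j * b1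
            + b * bb * η p j * A l l p j * j1 - b * bb * η p j * A p j l l * j2
        · simp only [if_neg hpr] at *
          linear_combination b * bb' * h - b * η r j * b1
            + b * bb * η r j * A l l p j * j1 - b * bb * η r j * A p j l l * j2
      · simp only [if_neg hij, if_neg hjp, if_neg hir, if_neg (Ne.symm hij),
            if_neg (Ne.symm hjp), if_neg (Ne.symm hir)] at *
        by_cases hpr : p = r
        · subst hpr
          simp only [if_true] at *
          linear_combination b * bb' * h
        · simp only [if_neg hpr] at *
          linear_combination b * bb' * h

end
end PivotData

end Components
-- The pivot identities for trigonometric and rational structure functions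
section Trig
variable {K : Type} [Field K]

/-- Off-diagonal and diagonal entries of the trigonometric `R`-matrix in the ratio `X`. -/
def trigTheta (q : K) (m i p : ℕ) (X : K) : K :=
  if i = p then
    (if p ≤ m then X * (q - 1) + X⁻¹ * (1 - q⁻¹) else X * (1 - q⁻¹) + X⁻¹ * (q - 1))
  else (q - q⁻¹) * (if i < p then X else X⁻¹)

/-- The sign `(-1) ^ ([i] * [p])`. -/
def eta (K : Type) [CommRing K] (m i p : ℕ) : K := (-1) ^ (grade m i * grade m p)

lemma eta_self (m i : ℕ) : eta K m i i = if i ≤ m then 1 else -1 := by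
  unfold eta grade; split_ifs <;> simp

/-- The parameters stand for X = u/v, Y = uv and Z = u^(l) v^(l). Then Δu = u⁴ - 1 and Δv = (v⁴ - 1)
X², so all identities become rational in q, X, Z. -/
lemma trig_pivotData {S : Finset ℕ} {l m : ℕ} (hS : ∀ x ∈ S, l < x) {q X Z Y ψu ψv Δu Δv : K}
    (hq : q ≠ 0) (hX : X ≠ 0) (hZ : Z ≠ 0)
    (hY : Y = Z * (if l ≤ m then q else q⁻¹))
    (hX1 : X - X⁻¹ ≠ 0) (hZ1 : Z - Z⁻¹ ≠ 0) (hY1 : Y - Y⁻¹ ≠ 0)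
    (hdet : (X - X⁻¹) * (X - X⁻¹) - (q - q⁻¹) * (q - q⁻¹) ≠ 0)
    (hΔu : Δu = X ^ 2 * Y ^ 2 - 1) (hΔv : Δv = Y ^ 2 - X ^ 2)
    (hu : Δu ≠ 0) (hv : Δv ≠ 0)
    (hψu : ψu = (if l ≤ m then 1 else -1) * (q - q⁻¹) * Y / (Z * Δu))
    (hψv : ψv = (if l ≤ m then 1 else -1) * (q - q⁻¹) * X ^ 2 * Y / (Z * Δv)) :
    PivotData S l (eta K m) (fun i p => trigTheta q m i p X) (fun i p => trigTheta q m i p Z)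
      (fun i p => trigTheta q m i p Y) (X - X⁻¹) (Z - Z⁻¹) (Y - Y⁻¹)
      ((q - q⁻¹) * X) ((q - q⁻¹) * X⁻¹) ((q - q⁻¹) * Z) ((q - q⁻¹) * Z⁻¹) ψu ψv where
  notMem h := lt_irrefl l (hS l h)
  eta_comm i p := by simp [eta, mul_comm]
  eta_sq i p := by rw [eta, ← mul_pow]; simp
  alpha x hx := by simp [trigTheta, (hS x hx), (hS x hx).ne]
  beta x hx := by simp [trigTheta, (hS x hx).le, (hS x hx).ne']
  alphab x hx := by simp [trigTheta, (hS x hx), (hS x hx).ne]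
  betab x hx := by simp [trigTheta, (hS x hx).le, (hS x hx).ne']
  bb'_eq := by
    rw [hY]; simp only [trigTheta, eta_self, if_true]
    split_ifs <;> field_simp <;> ring
  b_ne := hX1
  bb_ne := hZ1
  bb'_ne := hY1
  diag_ne i _ h := hdet <| by
    -- The determinant is the product of the even and the odd 𝔞, so one nonvanishing condition
    -- serves both parities.
    have : (X - X⁻¹) * (X - X⁻¹) - (q - q⁻¹) * (q - q⁻¹)
      = (X - X⁻¹ + eta K m i i * trigTheta q m i i X) *
        (if i ≤ m then X * q⁻¹ - X⁻¹ * q else X * q - X⁻¹ * q⁻¹) := by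
      simp only [trigTheta, eta_self, if_true]
      split_ifs <;> field_simp <;> ring
    rw [this, h, zero_mul]
  det_ne i _ p _ hip := by
    convert hdet using 2
    simp only [trigTheta, if_neg hip, if_neg (Ne.symm hip)]
    rcases lt_or_gt_of_ne hip with h | h <;> simp only [h, h.not_gt, if_true, if_false] <;>
    field_simp
  thetab p _ x _ := by
    rw [hY]; simp only [trigTheta, eta_self]
    split_ifs <;> field_simp <;> ring
  psiU i _ p _ hip := by
    rw [hψu]
    simp only [trigTheta, eta_self, if_neg hip, if_neg (Ne.symm hip)]
    have hY0 : Y ≠ 0 := fun h => by simp [h] at hY1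
    rcases lt_or_gt_of_ne hip with h | h <;> simp only [h, h.not_gt, if_true, if_false] <;>
    split_ifs <;> field_simp <;> (try rw [hΔu]) <;> ring
  psiV p _ r _ := by
    rw [hψv]
    simp only [trigTheta, eta_self]
    have hY0 : Y ≠ 0 := fun h => by simp [h] at hY1
    split_ifs <;> field_simp <;> (try rw [hΔv]) <;> ring
  crossU i _ p _ r _ hip hir := by
    have hY0 : Y ≠ 0 := fun h => by simp [h] at hY1
    have key : ∀ p, i ≠ p → trigTheta q m i p X * (eta K m l l * ((q - q⁻¹) * Z⁻¹) *
        ((q - q⁻¹) * X⁻¹) - (X - X⁻¹) * ψu * trigTheta q m i p Y) =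
        (q - q⁻¹) * X * (eta K m l l * ((q - q⁻¹) * Z⁻¹) *
        ((q - q⁻¹) * X⁻¹) - (X - X⁻¹) * ψu * ((q - q⁻¹) * Y)) := by
      intro p hip
      rw [hψu]
      simp only [trigTheta, eta_self, if_neg hip]
      split_ifs <;> field_simp <;> (try rw [hΔu]) <;> ring
    simp only [key p hip, key r hir]
  crossV i _ p _ r _ hip hir := by
    have hY0 : Y ≠ 0 := fun h => by simp [h] at hY1
    rw [hψv]
    simp only [trigTheta, eta_self, if_neg hip, if_neg hir]
    by_cases h1 : i < p <;> by_cases h2 : i < r <;> simp only [h1, h2, if_true, if_false] <;>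
    split_ifs <;> field_simp <;> (try rw [hΔv]) <;> ring
  diagU i _ r _ hir := by
    have hY0 : Y ≠ 0 := fun h => by simp [h] at hY1
    rw [hψu]
    simp only [trigTheta, eta_self, if_neg hir, if_true]
    split_ifs <;> field_simp <;> (try rw [hΔu]) <;> ring
  diagV i _ r _ hir := by
    have hY0 : Y ≠ 0 := fun h => by simp [h] at hY1
    rw [hψv]
    simp only [trigTheta, eta_self, if_neg hir, if_true]
    split_ifs <;> field_simp <;> (try rw [hΔv]) <;> ring

/-- With the sign (-1)^[p] absorbed into θ, all coefficients equal -ħ, which trivialises the `cross`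
identities. -/
lemma rational_pivotData {S : Finset ℕ} {l m : ℕ} (hS : ∀ x ∈ S, l < x) {h u v ψu ψv : K}
    (e : K) (he : e = if l ≤ m then 1 else -1)
    (hb1 : u - v ≠ 0) (hdet : (u - v) * (u - v) - h * h ≠ 0)
    (hZ1 : u + v + e * h ≠ 0) (hY1 : u + v ≠ 0)
    (hψu : ψu * (2 * u) = - e * h) (hψv : ψv * (2 * v) = - e * h) :
    PivotData S l (eta K m) (fun _ _ => -h) (fun _ _ => -h) (fun _ _ => -h)
      (u - v) (u + v + e * h) (u + v) (-h) (-h) (-h) (-h) ψu ψv where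
  notMem h := lt_irrefl l (hS l h)
  eta_comm i p := by simp [eta, mul_comm]
  eta_sq i p := by rw [eta, ← mul_pow]; simp
  alpha x hx := rfl
  beta x hx := rfl
  alphab x hx := rfl
  betab x hx := rfl
  bb'_eq := by rw [eta_self, ← he]; ring
  b_ne := hb1
  bb_ne := hZ1
  bb'_ne := hY1
  diag_ne i _ h0 := hdet <| by
    rw [eta_self] at h0
    split_ifs at h0
    · linear_combination (u - v + h) * h0
    · linear_combination (u - v - h) * h0
  det_ne i _ p _ hip := by convert hdet using 1; ring
  thetab p _ x _ := by rw [eta_self, ← he]; ring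
  psiU i _ p _ hip := by rw [eta_self, ← he]; linear_combination -h * hψu
  psiV p _ r _ := by rw [eta_self, ← he]; linear_combination -h * hψv
  crossU i _ p _ r _ hip hir := rfl
  crossV i _ p _ r _ hip hir := rfl
  diagU i _ r _ hir := by
    have := eta_self (K := K) m i
    have h2 : eta K m i i * eta K m i i = 1 := by rw [this]; split_ifs <;> ring
    rw [eta_self m l, ← he]; linear_combination eta K m i i * (u-v) * h * hψu
  diagV i _ r _ hir := by
    rw [eta_self m l, ← he]; linear_combination eta K m i i * (u-v) * h * hψv

end Trig
-- The two models: shifts, genericity and the recursion for ψ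
section Models
variable {K : Type} [Field K] (emb : ℂ →+* K)

/-- The sign `(-1) ^ [a]` as an integer. -/
def parity (m a : ℕ) : ℤ := (-1) ^ grade m a

lemma parity_eq (m a : ℕ) : parity m a = if a ≤ m then 1 else -1 := by
  unfold parity grade; split_ifs <;> simp

/-- The shift of the spectral parameter by `e` elementary steps. -/
noncomputable def Model.move : Model → ℤ → K → K
  | .yangian h, e, u => u + emb (h / 2 * e)
  | .quantumAffine s, e, u => u * emb ((s : ℂ) ^ (-e))

lemma Model.move_add (M : Model) (e f : ℤ) (u : K) :
    M.move emb (e + f) u = M.move emb e (M.move emb f u) := by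
  cases M with
  | yangian h => simp only [move]; rw [add_assoc, ← map_add]; push_cast; congr 2; ring
  | quantumAffine s =>
    simp only [move]; rw [mul_assoc, ← map_mul, ← zpow_add₀ s.ne_zero]; congr 3; ring

lemma Model.move_zero (M : Model) (u : K) : M.move emb 0 u = u := by
  cases M <;> simp [move]

lemma Model.shift_eq_move (M : Model) (m a : ℕ) (u : K) :
    M.shift emb m a u = M.move emb (parity m a) u := by
  cases M with
  | yangian h => simp [move, shift, parity]
  | quantumAffine s =>
    simp only [move, shift, parity_eq, grade]
    split_ifs <;> simp

lemma Model.iterShift_eq_move (M : Model) (m l : ℕ) (u : K) :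
    M.iterShift emb m l u = M.move emb (∑ a ∈ Finset.range l, parity m (a + 1)) u := by
  induction l with
  | zero => simp [iterShift, move_zero]
  | succ l ih =>
    rw [iterShift, ih, shift_eq_move, ← move_add, Finset.sum_range_succ, add_comm]

/-- The coefficients of the `R`-matrix up to the sign `(-1) ^ [p]`. -/
noncomputable def theta (M : Model) (m : ℕ) (u v : K) (i p : ℕ) : K :=
  (-1) ^ grade m p * M.fw emb m i p u v

/-- Spectral parameters away from the zeros of the denominators which occur. -/
def Model.Generic : Model → K → K → Prop
  | .yangian h, u, v =>
    u - v ≠ 0 ∧ (u - v) * (u - v) - emb h * emb h ≠ 0 ∧ u + v ≠ 0 ∧ u ≠ 0 ∧ v ≠ 0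
  | .quantumAffine s, u, v => u ≠ 0 ∧ v ≠ 0 ∧ u / v - (u / v)⁻¹ ≠ 0 ∧
    (u / v - (u / v)⁻¹) * (u / v - (u / v)⁻¹)
      - (emb s ^ 2 - (emb s ^ 2)⁻¹) * (emb s ^ 2 - (emb s ^ 2)⁻¹) ≠ 0 ∧
    u * v - (u * v)⁻¹ ≠ 0 ∧ u ^ 4 - 1 ≠ 0 ∧ v ^ 4 - 1 ≠ 0

variable (m : ℕ)

lemma theta_yangian (h : ℂ) (u v : K) :
    theta emb (.yangian h) m u v = fun _ _ => - emb h := by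
  funext i p
  simp only [theta, Model.fw, Model.fa, Model.fb, Model.fc, grade]
  by_cases h2 : i = p
  · subst h2
    split_ifs <;> simp
  · split_ifs <;> simp

lemma theta_quantumAffine (s : ℂˣ) (u v : K) :
    theta emb (.quantumAffine s) m u v = fun i p => trigTheta (emb s ^ 2) m i p (u / v) := by
  funext i p
  have hs : emb s ≠ 0 := by simp
  have huv : v / u = (u / v)⁻¹ := by simp
  simp only [theta, Model.fw, Model.fa, Model.fb, Model.fc, grade, trigTheta, huv]
  by_cases h1 : i = p
  · subst h1
    by_cases h2 : i ≤ m
    · simp [h2]; ring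
    · simp [h2]
      ring
  · simp only [if_neg h1]
    by_cases h2 : p ≤ m
    · simp [h2]
    · simp [h2]
      split_ifs <;> ring

lemma psi_yangian (h : ℂ) (a : ℕ) (y : K) :
    (Model.yangian h).psi emb m a ((Model.yangian h).shift emb m a y)
      = - (parity m a : K) * emb h / (2 * y) := by
  have h2 : emb (h / 2) = emb h / 2 := by rw [map_div₀, map_ofNat]
  have : (2 : K) ≠ 0 := by
    rw [← map_ofNat emb 2]; simp
  simp only [Model.psi, Model.fc, Model.fa, Model.iota, Model.shift, parity, map_mul, map_neg,
    map_pow, map_one, h2]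
  push_cast
  congr 1
  · ring
  · field_simp; ring

/-- The index a enters only through a constant factor. Hence the recursion below needs the same
scalar factor for every a. -/
lemma psi_quantumAffine (s : ℂˣ) (a : ℕ) {y : K} (hy : y ≠ 0) (hy4 : y ^ 4 - 1 ≠ 0) :
    (Model.quantumAffine s).psi emb m a ((Model.quantumAffine s).shift emb m a y)
      = (if a ≤ m then 1 else -1) * (emb s ^ 2 - (emb s ^ 2)⁻¹)
        * (if a ≤ m then emb s ^ 2 else (emb s ^ 2)⁻¹) / (y ^ 4 - 1) := by
  have hs : emb s ≠ 0 := by simp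
  simp only [Model.psi, Model.fc, Model.fa, Model.iota, Model.shift, grade]
  by_cases h2 : a ≤ m
  · simp [h2]
    field_simp
  · simp [h2]
    field_simp

/-- R depends only on u - v or u/v; a common shift is felt by the matrix with inverted second
argument alone. -/
lemma fb_shift (M : Model) (a : ℕ) (u v : K) :
    M.fb (M.shift emb m a u) (M.shift emb m a v) = M.fb u v := by
  cases M with
  | yangian h => simp [Model.fb, Model.shift]
  | quantumAffine s =>
    have : emb ((s : ℂ) ^ (-1 + 2 * (grade m a : ℤ))) ≠ 0 := by
      rw [map_zpow₀]; exact zpow_ne_zero _ (by simp)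
    simp only [Model.fb, Model.shift, mul_div_mul_right _ _ this]

lemma theta_shift (M : Model) (a : ℕ) (u v : K) :
    theta emb M m (M.shift emb m a u) (M.shift emb m a v) = theta emb M m u v := by
  cases M with
  | yangian h => simp only [theta_yangian]
  | quantumAffine s =>
    have : emb ((s : ℂ) ^ (-1 + 2 * (grade m a : ℤ))) ≠ 0 := by
      rw [map_zpow₀]; exact zpow_ne_zero _ (by simp)
    simp only [theta_quantumAffine, Model.shift, mul_div_mul_right _ _ this]

/-- Shifting by the first index turns it into a pivot. -/
theorem Model.exists_pivotData (M : Model) {S : Finset ℕ} {l : ℕ} (hS : ∀ x ∈ S, l < x) {u v : K}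
    (G : M.Generic emb u v) (G0 : M.Generic emb (M.shift emb m l u) (M.shift emb m l v)) :
    ∃ α β αb βb, PivotData S l (eta K m) (theta emb M m u v)
      (theta emb M m (M.shift emb m l u) (M.iota (M.shift emb m l v)))
      (theta emb M m u (M.iota v)) (M.fb u v)
      (M.fb (M.shift emb m l u) (M.iota (M.shift emb m l v))) (M.fb u (M.iota v)) α β αb βb
      (M.psi emb m l (M.shift emb m l u)) (M.psi emb m l (M.shift emb m l v)) := by
  cases M with
  | yangian h =>
    obtain ⟨g1, g2, g3, g4, g5⟩ := G
    obtain ⟨-, -, g3', -, -⟩ := G0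
    have h2 : emb (h / 2) = emb h / 2 := by rw [map_div₀, map_ofNat]
    have h20 : (2 : K) ≠ 0 := by
      rw [← map_ofNat emb 2]; simp
    have hs : ∀ w : K, (Model.yangian h).shift emb m l w
        = w + (if l ≤ m then 1 else -1) * emb h / 2 := by
      intro w
      simp only [shift, map_mul, map_pow, map_neg, map_one, h2, grade]
      split_ifs <;> simp; ring
    rw [psi_yangian, psi_yangian]
    simp only [theta_yangian, hs, Model.fb, Model.iota, sub_neg_eq_add] at g3' ⊢
    have e1 : u + (if l ≤ m then 1 else -1) * emb h / 2
      + (v + (if l ≤ m then 1 else -1) * emb h / 2)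
        = u + v + (if l ≤ m then 1 else -1) * emb h := by
      field_simp; ring
    rw [e1] at g3' ⊢
    have hp : (parity m l : K) = if l ≤ m then 1 else -1 := by
      rw [parity_eq]; split_ifs <;> simp
    refine ⟨_, _, _, _, rational_pivotData hS _ rfl g1 g2 g3' g3 ?_ ?_⟩
    · rw [hp]; field_simp
    · rw [hp]; field_simp
  | quantumAffine s =>
    obtain ⟨u0, v0, g1, g2, g3, g4, g5⟩ := G
    obtain ⟨u0', v0', -, -, g3', -, -⟩ := G0
    have hs0 : emb s ≠ 0 := by simp
    have hsh : ∀ w : K, (Model.quantumAffine s).shift emb m l w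
        = w * (if l ≤ m then (emb s)⁻¹ else emb s) := by
      intro w
      simp only [shift, grade]
      split_ifs <;> simp
    rw [psi_quantumAffine emb m s l u0 g4, psi_quantumAffine emb m s l v0 g5]
    simp only [theta_quantumAffine, Model.fb, Model.iota]
    rw [hsh, hsh] at *
    have e : ∀ a b : K, a / b⁻¹ = a * b := fun a b => by simp
    have e' : ∀ a b : K, b⁻¹ / a = (a * b)⁻¹ := fun a b => by
      rw [mul_inv, div_eq_mul_inv, mul_comm]
    have e'' : v / u = (u / v)⁻¹ := by simp
    simp only [e, e', e''] at *
    -- These are X²Y² - 1 and Y² - X² for X = u/v and Y = uv.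
    refine ⟨_, _, _, _, trig_pivotData (Δu := u ^ 4 - 1) (Δv := (v ^ 4 - 1) * (u / v) ^ 2) hS
      (pow_ne_zero 2 hs0) (div_ne_zero u0 v0) (mul_ne_zero u0' v0') ?_ g1 g3' g3 g2 ?_ ?_ g4 ?_
      ?_ ?_⟩
    · split_ifs <;> field_simp
    · field_simp
    · field_simp
    · exact mul_ne_zero g5 (pow_ne_zero 2 (div_ne_zero u0 v0))
    · split_ifs <;> field_simp
    · split_ifs <;> field_simp

/-- Spectral parameters at which the coefficients of the nested generators are defined. -/
def Model.Regular : Model → K → Prop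
  | .yangian _, y => y ≠ 0
  | .quantumAffine _, y => y ≠ 0 ∧ y ^ 4 - 1 ≠ 0

/-- The recursion for the coefficients of the nested generators. -/
theorem Model.psi_recursion (M : Model) (a l : ℕ) {y : K} (G : M.Regular y)
    (G0 : M.Regular (M.shift emb m l y)) :
    emb (M.q ^ (2 - 4 * (grade m l : ℤ))) * M.psi emb m a (M.shift emb m a y)
      = M.psi emb m a (M.shift emb m a (M.shift emb m l y))
        * (1 - M.psi emb m l (M.shift emb m l y)) := by
  cases M with
  | yangian h =>
    have g4 : y ≠ 0 := G
    have g4' : (yangian h).shift emb m l y ≠ 0 := G0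
    have h2 : emb (h / 2) = emb h / 2 := by rw [map_div₀, map_ofNat]
    have h20 : (2 : K) ≠ 0 := by
      rw [← map_ofNat emb 2]; simp
    have hs : ∀ w : K, (Model.yangian h).shift emb m l w = w + parity m l * emb h / 2 := by
      intro w
      simp only [shift, parity, map_mul, map_pow, map_neg, map_one, h2]
      push_cast; ring
    rw [psi_yangian, psi_yangian, psi_yangian]
    rw [hs] at *
    generalize ((parity m l : ℤ) : K) = e at *
    simp only [q, one_zpow, map_one]
    have : 2 * y + e * emb h ≠ 0 := fun h0 => g4' (by field_simp; linear_combination h0)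
    have e3 : 2 * (y + e * emb h / 2) = 2 * y + e * emb h := by field_simp
    rw [e3]
    -- Naming the denominator keeps it an atom while fractions are cleared.
    obtain ⟨D, hD⟩ : ∃ D, D = 2 * y + e * emb h := ⟨_, rfl⟩
    rw [← hD] at this ⊢
    field_simp
    rw [hD]
    ring
  | quantumAffine s =>
    obtain ⟨y0, g4⟩ := G
    obtain ⟨y0', g4'⟩ := G0
    have hs0 : emb s ≠ 0 := by simp
    have hsh : ∀ w : K, (Model.quantumAffine s).shift emb m l w
        = w * (if l ≤ m then (emb s)⁻¹ else emb s) := by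
      intro w
      simp only [shift, grade]
      split_ifs <;> simp
    rw [psi_quantumAffine emb m s a y0 g4, psi_quantumAffine emb m s a y0' g4',
      psi_quantumAffine emb m s l y0 g4]
    rw [hsh] at *
    generalize (if a ≤ m then (1 : K) else -1) * (emb s ^ 2 - (emb s ^ 2)⁻¹)
      * (if a ≤ m then emb s ^ 2 else (emb s ^ 2)⁻¹) = C
    by_cases h : l ≤ m
    · simp only [if_pos h, grade, q] at *
      simp only [CharP.cast_eq_zero, mul_zero, sub_zero, map_zpow₀, map_pow, one_mul]
      norm_cast
      have : (y * (emb s)⁻¹) ^ 4 - 1 = (y ^ 4 - emb s ^ 4) * (emb s ^ 4)⁻¹ := by field_simp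
      rw [this] at g4' ⊢
      obtain ⟨D, hD⟩ : ∃ D, D = y ^ 4 - 1 := ⟨_, rfl⟩
      obtain ⟨D', hD'⟩ : ∃ D', D' = y ^ 4 - emb s ^ 4 := ⟨_, rfl⟩
      rw [← hD] at g4 ⊢
      rw [← hD'] at g4' ⊢
      have : D' ≠ 0 := left_ne_zero_of_mul g4'
      field_simp
      rw [hD, hD']
      ring
    · simp only [if_neg h, grade, q] at *
      rw [show (2 : ℤ) - 4 * ((1 : ℕ) : ℤ) = -2 by norm_num]
      simp only [map_zpow₀, map_pow]
      have : (y * emb s) ^ 4 - 1 = (y ^ 4 - (emb s ^ 4)⁻¹) * (emb s ^ 4) := by field_simp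
      rw [this] at g4' ⊢
      obtain ⟨D, hD⟩ : ∃ D, D = y ^ 4 - 1 := ⟨_, rfl⟩
      obtain ⟨D', hD'⟩ : ∃ D', D' = y ^ 4 - (emb s ^ 4)⁻¹ := ⟨_, rfl⟩
      rw [← hD] at g4 ⊢
      rw [← hD'] at g4' ⊢
      have : D' ≠ 0 := left_ne_zero_of_mul g4'
      simp only [zpow_neg, zpow_ofNat]
      field_simp
      rw [hD, hD']
      field_simp
      ring

end Models

/-! ### Graded tensor products in components -/

section Bridge

/-- Koszul signs depend only on parities, so every sign identity below becomes a finite check over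
`ZMod 2`. -/
lemma neg_one_pow_congr {R : Type} [Ring R] {a b : ℕ} (h : (a : ZMod 2) = b) :
    (-1 : R) ^ a = (-1) ^ b := by
  have h' := (ZMod.natCast_eq_natCast_iff' a b 2).mp h
  rw [neg_one_pow_eq_pow_mod_two, h', ← neg_one_pow_eq_pow_mod_two]

variable {K L : Type} [Field K] [Ring L] [Algebra K L] {k N : ℕ}

/-- A scalar matrix over `K` as a matrix over a `K`-algebra. -/
def liftT (X : Tensor2 k N K) : Tensor2 k N L := fun i j p r => algebraMap K L (X i j p r)

variable (emb : ℂ →+* K) (M : Model) (m : ℕ)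

/-- R is a multiple of the identity plus a weighted permutation, so each double sum collapses to two
terms; the four products of such terms are the four summands of `reflL`. -/
lemma gmul_Rmatrix (u v : K) (Y : Tensor2 k N L) (i j p r : Idx k N) :
    gmul m (liftT (Rmatrix emb M m k N u v)) Y i j p r = M.fb u v • Y i j p r
      + ((-1) ^ ((grade m p + grade m j) * (grade m p + grade m i)) * M.fw emb m i p u v)
        • Y p j i r := by
  have h : ∀ a c : Idx k N, algebraMap K L (Rmatrix emb M m k N u v i a p c) =
      (if i = a then if p = c then algebraMap K L (M.fb u v) else 0 else 0)
      + (if p = a then if i = c then algebraMap K L (M.fw emb m i a u v) else 0 else 0) := by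
    intro a c
    simp only [Rmatrix, map_add, apply_ite (algebraMap K L), map_zero, eq_comm (a := c), ite_and]
  simp only [gmul, liftT, h, add_mul, mul_add, Finset.sum_add_distrib, ite_mul, zero_mul, mul_ite,
    mul_zero]
  simp only [Finset.sum_ite_irrel, Finset.sum_const_zero, Finset.sum_ite_eq,
    Finset.mem_univ, if_true]
  congr 1
  · rw [Algebra.smul_def, neg_one_pow_congr (b := 0), pow_zero, one_mul]
    push_cast
    generalize (grade m i : ZMod 2) = i', (grade m j : ZMod 2) = j', (grade m p : ZMod 2) = p',
      (grade m r : ZMod 2) = r'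
    revert i' j' p' r'; decide
  · rw [Algebra.smul_def, map_mul, map_pow, map_neg, map_one, ← mul_assoc]
    congr 2
    apply neg_one_pow_congr
    push_cast
    generalize (grade m i : ZMod 2) = i', (grade m j : ZMod 2) = j', (grade m p : ZMod 2) = p',
      (grade m r : ZMod 2) = r'
    revert i' j' p' r'; decide

lemma gmul_flip_Rmatrix (u v : K) (X : Tensor2 k N L) (i j p r : Idx k N) :
    gmul m X (liftT (flip21 m (Rmatrix emb M m k N u v))) i j p r = M.fb u v • X i j p r
      + ((-1) ^ ((grade m r + grade m j) * (1 + grade m p + grade m j)) * M.fw emb m j r u v)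
        • X i r p j := by
  have h : ∀ a c : Idx k N, algebraMap K L (flip21 m (Rmatrix emb M m k N u v) a j c r) =
      (if j = a then if r = c then
        (-1) ^ ((grade m a + grade m j) * (grade m c + grade m r)) * algebraMap K L (M.fb u v)
        else 0 else 0)
      + (if r = a then if j = c then
        (-1) ^ ((grade m a + grade m j) * (grade m c + grade m r))
          * algebraMap K L (M.fw emb m c r u v) else 0 else 0) := by
    intro a c
    simp only [flip21, Rmatrix, map_add, map_mul, map_pow, map_neg, map_one,
      apply_ite (algebraMap K L), map_zero, eq_comm (a := a), eq_comm (a := c), ite_and, mul_add,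
      mul_ite, mul_zero]
    congr 1
    split_ifs <;> rfl
  simp only [gmul, liftT, h, mul_add, Finset.sum_add_distrib, mul_ite, mul_zero]
  simp only [Finset.sum_ite_irrel, Finset.sum_const_zero, Finset.sum_ite_eq,
    Finset.mem_univ, if_true]
  have comm : ∀ (n : ℕ) (x : L), x * (-1) ^ n = (-1) ^ n * x :=
    fun n x => ((Commute.neg_one_left x).pow_left n).eq.symm
  congr 1
  · rw [Algebra.smul_def, ← mul_assoc (X i j p r), comm, ← mul_assoc, ← mul_assoc, ← pow_add,
      neg_one_pow_congr (b := 0), pow_zero, one_mul, Algebra.commutes]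
    push_cast
    generalize (grade m i : ZMod 2) = i', (grade m j : ZMod 2) = j', (grade m p : ZMod 2) = p',
      (grade m r : ZMod 2) = r'
    revert i' j' p' r'; decide
  · rw [Algebra.smul_def, map_mul, map_pow, map_neg, map_one, ← mul_assoc (X i r p j), comm,
      mul_assoc, ← Algebra.commutes, ← mul_assoc, ← mul_assoc, ← pow_add]
    congr 2
    apply neg_one_pow_congr
    push_cast
    generalize (grade m i : ZMod 2) = i', (grade m j : ZMod 2) = j', (grade m p : ZMod 2) = p',
      (grade m r : ZMod 2) = r'
    revert i' j' p' r'; decide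

lemma gmul_inSecond (X : Tensor2 k N L) (D : Idx k N → Idx k N → L) (i j p r : Idx k N) :
    gmul m X (inSecond D) i j p r = ∑ c : Idx k N,
      (-1) ^ ((grade m c + grade m r) * (grade m i + grade m j + grade m p + grade m c))
        * (X i j p c * D c r) := by
  simp only [gmul, inSecond, mul_ite, mul_zero]
  rw [Finset.sum_comm]
  refine Finset.sum_congr rfl fun c _ => ?_
  simp only [Finset.sum_ite_eq', Finset.mem_univ, if_true]
  congr 1
  apply neg_one_pow_congr
  push_cast
  generalize (grade m i : ZMod 2) = i', (grade m j : ZMod 2) = j', (grade m p : ZMod 2) = p',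
      (grade m r : ZMod 2) = r', (grade m c : ZMod 2) = c'
  revert i' j' p' r' c'; decide

lemma gmul_inFirst (X : Tensor2 k N L) (D : Idx k N → Idx k N → L) (i j p r : Idx k N) :
    gmul m X (inFirst D) i j p r = ∑ a : Idx k N,
      (-1) ^ ((grade m a + grade m j) * (grade m i + grade m a)) * (X i a p r * D a j) := by
  simp only [gmul, inFirst, mul_ite, mul_zero]
  refine Finset.sum_congr rfl fun a _ => ?_
  simp only [Finset.sum_ite_eq', Finset.mem_univ, if_true]
  congr 1
  apply neg_one_pow_congr
  push_cast
  generalize (grade m i : ZMod 2) = i', (grade m j : ZMod 2) = j', (grade m p : ZMod 2) = p',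
      (grade m r : ZMod 2) = r', (grade m a : ZMod 2) = c'
  revert i' j' p' r' c'; decide

lemma inSecond_gmul_Rmatrix (u v : K) (D : Idx k N → Idx k N → L) (i j p r : Idx k N) :
    gmul m (inSecond D) (liftT (Rmatrix emb M m k N u v)) i j p r
      = (if i = j then M.fb u v • D p r else 0)
      + if r = i then ((-1) ^ ((grade m j + grade m i) * (grade m p + grade m j))
        * M.fw emb m i j u v) • D p j else 0 := by
  have h : ∀ c : Idx k N, algebraMap K L (Rmatrix emb M m k N u v i j c r) =
      (if r = c then if i = j then algebraMap K L (M.fb u v) else 0 else 0)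
      + (if j = c then if r = i then algebraMap K L (M.fw emb m i j u v) else 0 else 0) := by
    intro c
    simp only [Rmatrix, map_add, apply_ite (algebraMap K L), map_zero, eq_comm (b := c), ite_and]
    congr 1
    split_ifs <;> rfl
  simp only [gmul, inSecond, liftT, ite_mul, zero_mul, mul_ite, mul_zero, Finset.sum_ite_irrel,
    Finset.sum_const_zero, Finset.sum_ite_eq, Finset.mem_univ, if_true, h, mul_add,
    Finset.sum_add_distrib]
  congr 1
  · split_ifs
    · rw [Algebra.smul_def, neg_one_pow_congr (b := 0), pow_zero, one_mul, Algebra.commutes]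
      push_cast
      generalize (grade m i : ZMod 2) = i', (grade m j : ZMod 2) = j', (grade m p : ZMod 2) = p',
        (grade m r : ZMod 2) = r'
      revert i' j' p' r'; decide
    · rfl
  · split_ifs with hri
    · subst hri
      rw [Algebra.smul_def, map_mul, map_pow, map_neg, map_one, ← Algebra.commutes, ← mul_assoc]
      congr 2
      apply neg_one_pow_congr
      push_cast
      generalize (grade m j : ZMod 2) = j', (grade m p : ZMod 2) = p',
        (grade m r : ZMod 2) = r'
      revert j' p' r'; decide
    · rfl

end Bridge

/-! ### Applying a functional to both sides of the reflection equation -/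

section Bridge

/-- The sign relating graded to ordinary matrix multiplication. -/
def gaugeExp (m i j p r : ℕ) : ℕ :=
  (grade m p + grade m r) * grade m j
    + (grade m i + grade m j + grade m p + grade m r) * (grade m j + grade m r)

/-- The sign absorbed into the generator `d_{ij}`. -/
def genExp (m i j : ℕ) : ℕ := (grade m i + grade m j) * grade m j

variable {K L : Type} [Field K] [Ring L] [Algebra K L] {k N : ℕ}
variable (emb : ℂ →+* K) (M : Model) (m : ℕ)

/-- Linear functionals on a `K`-algebra. -/
abbrev Functional (K L : Type) [Field K] [Ring L] [Algebra K L] : Type := L →ₗ[K] K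

/-- The values of a functional on products of two generators, with signs. -/
def pairing (Φ : Functional K L) (D E : ℕ → ℕ → L) (i j p r : ℕ) : K :=
  (-1) ^ (genExp m i j + genExp m p r) * Φ (D i j * E p r)

lemma neg_one_pow_mul_apply (Φ : Functional K L) (n : ℕ) (x : L) :
    Φ ((-1) ^ n * x) = (-1) ^ n * Φ x := by
  have h : ((-1 : L) ^ n) = algebraMap K L ((-1) ^ n) := by simp
  rw [h, ← Algebra.smul_def, map_smul, smul_eq_mul]

theorem apply_reflectionLHS (Φ : Functional K L) (u v w : K) (D E : ℕ → ℕ → L) (i j p r : Idx k N) :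
    (-1) ^ gaugeExp m i j p r * Φ (gmul m (gmul m (gmul m (liftT (Rmatrix emb M m k N u v))
      (inFirst fun i j => D i j)) (liftT (flip21 m (Rmatrix emb M m k N u w))))
      (inSecond fun i j => E i j) i j p r)
    = reflL (Finset.Icc k N) (eta K m) (theta emb M m u v) (theta emb M m u w) (M.fb u v)
      (M.fb u w) (pairing m Φ D E) i j p r := by
  have e1 : ∀ a b : Idx k N, ((a : ℕ) = b) ↔ (a = b) := fun a b => Subtype.ext_iff.symm
  rw [gmul_inSecond]
  simp only [gmul_flip_Rmatrix, gmul_Rmatrix, inFirst, reflL, e1, pairing,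
    ← Finset.sum_coe_sort (Finset.Icc k N)]
  simp only [map_sum, neg_one_pow_mul_apply]
  simp only [smul_ite, smul_zero, add_mul _ _ (E _ _), smul_mul_assoc, smul_add, ite_mul,
    zero_mul, map_add, map_smul, smul_eq_mul,
    apply_ite Φ, map_zero]
  simp only [mul_add ((-1 : K) ^ _), mul_ite, mul_zero, Finset.sum_add_distrib, Finset.sum_ite_eq,
    Finset.mem_univ, if_true, Finset.sum_ite_irrel, Finset.sum_const_zero]
  simp only [eq_comm (a := p) (b := j), eq_comm (a := i) (b := j), eta, theta]
  -- One sign identity per summand of `reflL`: the common sign `gaugeExp` and the signs `genExp` of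
  -- the generators reduce the Koszul signs to those in η and θ.
  have t1 : (-1 : K) ^ (gaugeExp m i j p r + (grade m p + grade m r)
      * (grade m i + grade m j + grade m p + grade m p))
      = (-1) ^ (grade m i * grade m p + grade m j * grade m p
        + (genExp m i j + genExp m p r)) := by
    apply neg_one_pow_congr
    simp only [gaugeExp, genExp]
    push_cast
    generalize (grade m i : ZMod 2) = i', (grade m j : ZMod 2) = j', (grade m p : ZMod 2) = p',
      (grade m r : ZMod 2) = r'
    revert i' j' p' r'; decide
  have t2 : (-1 : K) ^ (gaugeExp m i j p r + (grade m i + grade m r)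
      * (grade m i + grade m j + grade m p + grade m i)
      + (grade m p + grade m j) * (grade m p + grade m i))
      = (-1) ^ (grade m p + grade m i * grade m j + (genExp m p j + genExp m i r)) := by
    apply neg_one_pow_congr
    simp only [gaugeExp, genExp]
    push_cast
    generalize (grade m i : ZMod 2) = i', (grade m j : ZMod 2) = j', (grade m p : ZMod 2) = p',
      (grade m r : ZMod 2) = r'
    revert i' j' p' r'; decide
  have t3 : ∀ x : Idx k N, (-1 : K) ^ (gaugeExp m i p p r + (grade m x + grade m r)
      * (grade m i + grade m p + grade m p + grade m x)
      + (grade m x + grade m p) * (1 + grade m p + grade m p))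
      = (-1) ^ (grade m i * grade m p + grade m x + (genExp m i x + genExp m x r)) := by
    intro x
    apply neg_one_pow_congr
    simp only [gaugeExp, genExp]
    push_cast
    generalize (grade m i : ZMod 2) = i', (grade m x : ZMod 2) = j', (grade m p : ZMod 2) = p',
      (grade m r : ZMod 2) = r'
    revert i' j' p' r'; decide
  have t4 : ∀ x : Idx k N, (-1 : K) ^ (gaugeExp m i i p r + (grade m x + grade m r)
      * (grade m i + grade m i + grade m p + grade m x)
      + (grade m x + grade m i) * (1 + grade m p + grade m i)
      + (grade m p + grade m x) * (grade m p + grade m i))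
      = (-1) ^ (grade m p + grade m x + (genExp m p x + genExp m x r)) := by
    intro x
    apply neg_one_pow_congr
    simp only [gaugeExp, genExp]
    push_cast
    generalize (grade m i : ZMod 2) = i', (grade m x : ZMod 2) = j', (grade m p : ZMod 2) = p',
      (grade m r : ZMod 2) = r'
    revert i' j' p' r'; decide
  simp only [pow_add] at t1 t2 t3 t4 ⊢
  have h3 : (if j = p then (-1 : K) ^ gaugeExp m i j p r * ∑ x : Idx k N,
      (-1) ^ ((grade m x + grade m r) * (grade m i + grade m j + grade m p + grade m x)) *
      ((-1) ^ ((grade m x + grade m j) * (1 + grade m p + grade m j)) * M.fw emb m j x u w *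
      (M.fb u v * Φ (D i x * E x r))) else 0)
      = if j = p then M.fb u v * (-1) ^ (grade m i * grade m p) * ∑ x : Idx k N,
        (-1) ^ grade m x * M.fw emb m p x u w
          * ((-1) ^ genExp m i x * (-1) ^ genExp m x r * Φ (D i x * E x r)) else 0 := by
    split_ifs with h
    · subst h
      rw [Finset.mul_sum, Finset.mul_sum]
      refine Finset.sum_congr rfl fun x _ => ?_
      linear_combination (M.fw emb m j x u w * M.fb u v * Φ (D i x * E x r)) * t3 x
    · rfl
  have h4 : (if j = i then (-1 : K) ^ gaugeExp m i j p r * ∑ x : Idx k N,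
      (-1) ^ ((grade m x + grade m r) * (grade m i + grade m j + grade m p + grade m x)) *
      ((-1) ^ ((grade m x + grade m j) * (1 + grade m p + grade m j)) * M.fw emb m j x u w *
      ((-1) ^ ((grade m p + grade m x) * (grade m p + grade m i)) * M.fw emb m i p u v
        * Φ (D p x * E x r))) else 0)
      = if j = i then (-1) ^ grade m p * M.fw emb m i p u v * ∑ x : Idx k N,
        (-1) ^ grade m x * M.fw emb m i x u w
          * ((-1) ^ genExp m p x * (-1) ^ genExp m x r * Φ (D p x * E x r)) else 0 := by
    split_ifs with h
    · subst h
      rw [Finset.mul_sum, Finset.mul_sum]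
      refine Finset.sum_congr rfl fun x _ => ?_
      linear_combination (M.fw emb m j x u w * M.fw emb m j p u v * Φ (D p x * E x r)) * t4 x
    · rfl
  rw [h3, h4]
  linear_combination (M.fb u v * M.fb u w * Φ (D i j * E p r)) * t1
    + (M.fw emb m i p u v * M.fb u w * Φ (D p j * E i r)) * t2

theorem apply_reflectionRHS (Φ : Functional K L) (u v w : K) (D E : ℕ → ℕ → L) (i j p r : Idx k N) :
    (-1) ^ gaugeExp m i j p r * Φ (gmul m (gmul m (gmul m (inSecond fun i j => E i j)
      (liftT (Rmatrix emb M m k N u w))) (inFirst fun i j => D i j))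
      (liftT (flip21 m (Rmatrix emb M m k N u v))) i j p r)
    = reflR (Finset.Icc k N) (eta K m) (theta emb M m u v) (theta emb M m u w) (M.fb u v)
      (M.fb u w) (pairing m Φ E D) i j p r := by
  have e1 : ∀ a b : Idx k N, ((a : ℕ) = b) ↔ (a = b) := fun a b => Subtype.ext_iff.symm
  rw [gmul_flip_Rmatrix]
  simp only [gmul_inFirst, inSecond_gmul_Rmatrix, reflR, e1, pairing,
    ← Finset.sum_coe_sort (Finset.Icc k N)]
  simp only [add_mul _ _ (D _ _), mul_add ((-1 : L) ^ _), Finset.sum_add_distrib, map_add,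
    map_smul, map_sum, neg_one_pow_mul_apply, smul_eq_mul]
  simp only [ite_mul, zero_mul, smul_mul_assoc, apply_ite Φ, map_smul, smul_eq_mul, map_zero,
    mul_ite, mul_zero, Finset.sum_ite_eq, Finset.mem_univ, if_true, Finset.sum_ite_irrel,
    Finset.sum_const_zero]
  simp only [eta, theta]
  have t1 : (-1 : K) ^ (gaugeExp m i j p r + (grade m i + grade m j) * (grade m i + grade m i))
      = (-1) ^ (grade m i * grade m r + grade m j * grade m r
        + (genExp m p r + genExp m i j)) := by
    apply neg_one_pow_congr
    simp only [gaugeExp, genExp]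
    push_cast
    generalize (grade m i : ZMod 2) = i', (grade m j : ZMod 2) = j', (grade m p : ZMod 2) = p',
      (grade m r : ZMod 2) = r'
    revert i' j' p' r'; decide
  have t2 : (-1 : K) ^ (gaugeExp m i j p r
      + (grade m r + grade m j) * (1 + grade m p + grade m j)
      + (grade m i + grade m r) * (grade m i + grade m i))
      = (-1) ^ (grade m r + grade m i * grade m j + (genExp m p j + genExp m i r)) := by
    apply neg_one_pow_congr
    simp only [gaugeExp, genExp]
    push_cast
    generalize (grade m i : ZMod 2) = i', (grade m j : ZMod 2) = j', (grade m p : ZMod 2) = p',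
      (grade m r : ZMod 2) = r'
    revert i' j' p' r'; decide
  have t3 : ∀ x : Idx k N, (-1 : K) ^ (gaugeExp m i j p i
      + (grade m x + grade m j) * (grade m i + grade m x)
      + (grade m x + grade m i) * (grade m p + grade m x))
      = (-1) ^ (grade m i * grade m j + grade m x + (genExp m p x + genExp m x j)) := by
    intro x
    apply neg_one_pow_congr
    simp only [gaugeExp, genExp]
    push_cast
    generalize (grade m i : ZMod 2) = i', (grade m x : ZMod 2) = x', (grade m p : ZMod 2) = p',
      (grade m j : ZMod 2) = r'
    revert i' x' p' r'; decide
  have t4 : ∀ x : Idx k N, (-1 : K) ^ (gaugeExp m i i p r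
      + (grade m r + grade m i) * (1 + grade m p + grade m i)
      + (grade m x + grade m r) * (grade m i + grade m x)
      + (grade m x + grade m i) * (grade m p + grade m x))
      = (-1) ^ (grade m r + grade m x + (genExp m p x + genExp m x r)) := by
    intro x
    apply neg_one_pow_congr
    simp only [gaugeExp, genExp]
    push_cast
    generalize (grade m i : ZMod 2) = i', (grade m x : ZMod 2) = x', (grade m p : ZMod 2) = p',
      (grade m r : ZMod 2) = r'
    revert i' x' p' r'; decide
  simp only [pow_add] at t1 t2 t3 t4 ⊢
  have h3 : (-1 : K) ^ gaugeExp m i j p r * (M.fb u v * (if r = i then ∑ x : Idx k N,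
      (-1) ^ ((grade m x + grade m j) * (grade m i + grade m x)) *
      ((-1) ^ ((grade m x + grade m i) * (grade m p + grade m x)) * M.fw emb m i x u w *
      Φ (E p x * D x j)) else 0))
      = if r = i then M.fb u v * (-1) ^ (grade m i * grade m j) * ∑ x : Idx k N,
        (-1) ^ grade m x * M.fw emb m i x u w
          * ((-1) ^ genExp m p x * (-1) ^ genExp m x j * Φ (E p x * D x j)) else 0 := by
    split_ifs with h
    · subst h
      simp only [Finset.mul_sum]
      refine Finset.sum_congr rfl fun x _ => ?_
      linear_combination (M.fw emb m r x u w * M.fb u v * Φ (E p x * D x j)) * t3 x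
    · simp
  have h4 : (-1 : K) ^ gaugeExp m i j p r *
      ((-1) ^ ((grade m r + grade m j) * (1 + grade m p + grade m j)) * M.fw emb m j r u v *
      (if j = i then ∑ x : Idx k N,
      (-1) ^ ((grade m x + grade m r) * (grade m i + grade m x)) *
      ((-1) ^ ((grade m x + grade m i) * (grade m p + grade m x)) * M.fw emb m i x u w *
      Φ (E p x * D x r)) else 0))
      = if j = i then (-1) ^ grade m r * M.fw emb m j r u v * ∑ x : Idx k N,
        (-1) ^ grade m x * M.fw emb m i x u w
          * ((-1) ^ genExp m p x * (-1) ^ genExp m x r * Φ (E p x * D x r)) else 0 := by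
    split_ifs with h
    · subst h
      simp only [Finset.mul_sum]
      refine Finset.sum_congr rfl fun x _ => ?_
      linear_combination (M.fw emb m j x u w * M.fw emb m j r u v * Φ (E p x * D x r)) * t4 x
    · simp
  linear_combination h3 + h4 + (M.fb u v * M.fb u w * Φ (E p r * D i j)) * t1
    + (M.fw emb m j r u v * M.fb u w * Φ (E p j * D i r)) * t2

end Bridge

/-! ### Laurent series over a noncommutative algebra -/

section SeriesAlgebra

variable {R S : Type} [CommRing R] [Ring S] [Algebra R S]

/-- Scalar series are central because their coefficients are; transposing the antidiagonal matches
the two convolutions. -/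
lemma algebraMap_series_comm (c : LaurentSeries R) (x : LaurentSeries S) :
    HahnSeries.map c (algebraMap R S) * x = x * HahnSeries.map c (algebraMap R S) := by
  have hs : (HahnSeries.map c (algebraMap R S)).support ⊆ c.support :=
    Function.support_comp_subset (map_zero _) _
  ext a
  rw [HahnSeries.coeff_mul_left' c.isPWO_support hs, HahnSeries.coeff_mul_right' c.isPWO_support hs]
  refine Finset.sum_nbij' Prod.swap Prod.swap ?_ ?_ (fun _ _ => rfl) (fun _ _ => rfl) ?_
  · simp only [Finset.mem_antidiagonal]
    rintro ⟨i, j⟩ ⟨h1, h2, h3⟩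
    exact ⟨h2, h1, by simpa [add_comm] using h3⟩
  · simp only [Finset.mem_antidiagonal]
    rintro ⟨i, j⟩ ⟨h1, h2, h3⟩
    exact ⟨h2, h1, by simpa [add_comm] using h3⟩
  · rintro ⟨i, j⟩ _
    exact Algebra.commutes _ _

/-- The ring homomorphism of Laurent series induced by a ring homomorphism of coefficients. -/
noncomputable def mapSeries {S T : Type} [Ring S] [Ring T] (f : S →+* T) :
    LaurentSeries S →+* LaurentSeries T where
  toFun c := HahnSeries.map c f
  map_zero' := by ext; simp
  map_one' := by ext a; simp [HahnSeries.coeff_one]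
  map_add' x y := by ext; simp
  map_mul' x y := HahnSeries.map_mul f.toNonUnitalRingHom

variable (R S) in
/-- Laurent series over an `R`-algebra form an algebra over Laurent series over `R`. -/
@[reducible] noncomputable def seriesAlgebra : Algebra (LaurentSeries R) (LaurentSeries S) :=
  RingHom.toAlgebra' (mapSeries (algebraMap R S)) algebraMap_series_comm

/-- The coefficientwise extension of a linear functional to Laurent series. -/
noncomputable def mapFunctional (φ : S →ₗ[R] R) :
    letI := seriesAlgebra R S
    LaurentSeries S →ₗ[LaurentSeries R] LaurentSeries R :=
  letI := seriesAlgebra R S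
  { toFun := fun x => HahnSeries.map x φ
    map_add' := fun x y => by ext; simp
    map_smul' := fun c x => by
      have hs : (HahnSeries.map c (algebraMap R S)).support ⊆ c.support :=
        Function.support_comp_subset (map_zero _) _
      have hx : (HahnSeries.map x φ).support ⊆ x.support :=
        Function.support_comp_subset (map_zero _) _
      ext a
      rw [Algebra.smul_def]
      change φ ((HahnSeries.map c (algebraMap R S) * x).coeff a) = (c * HahnSeries.map x φ).coeff a
      -- Both convolutions are summed over the supports of c and x, a finite set of pairs, so φ
      -- passes through term by term.
      rw [HahnSeries.coeff_mul_left' c.isPWO_support hs,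
        HahnSeries.coeff_mul_right' x.isPWO_support hx, map_sum]
      refine Finset.sum_congr rfl fun i _ => ?_
      change φ (algebraMap R S _ * _) = _ * φ _
      rw [← Algebra.smul_def, map_smul, smul_eq_mul] }

end SeriesAlgebra

/-! ### Functionals on products of series in u and v -/

section Pairing

variable {A : Type} [Ring A] [Algebra ℂ A]

noncomputable instance laurent2Algebra : Algebra (Laurent2 ℂ) (Laurent2 A) :=
  letI := seriesAlgebra ℂ A
  seriesAlgebra (LaurentSeries ℂ) (LaurentSeries A)

/-- The coefficientwise extension of a linear functional to series in two variables. -/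
noncomputable def functional2 (φ : A →ₗ[ℂ] ℂ) : Functional (Laurent2 ℂ) (Laurent2 A) :=
  letI := seriesAlgebra ℂ A
  mapFunctional (mapFunctional φ)

@[simp] lemma functional2_coeff (φ : A →ₗ[ℂ] ℂ) (X : Laurent2 A) (a b : ℤ) :
    ((functional2 φ X).coeff a).coeff b = φ ((X.coeff a).coeff b) := rfl

/-- Series in `u` as series in `u`, `v`. -/
noncomputable def embU : LaurentSeries ℂ →+* Laurent2 ℂ := mapSeries HahnSeries.C

/-- Series in `v` as series in `u`, `v`. -/
noncomputable def embV : LaurentSeries ℂ →+* Laurent2 ℂ := HahnSeries.C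

lemma atU_eq_mapSeries (f : LaurentSeries A) : atU f = mapSeries HahnSeries.C f := rfl

lemma atU_scal_mul (c : LaurentSeries ℂ) (f : LaurentSeries A) :
    atU (scal c * f) = embU c • atU f := by
  rw [Algebra.smul_def, atU_eq_mapSeries, map_mul]
  congr 1
  ext a b
  change ((HahnSeries.C (algebraMap ℂ A (c.coeff a)) : LaurentSeries A)).coeff b
    = algebraMap ℂ A ((HahnSeries.C (c.coeff a) : LaurentSeries ℂ).coeff b)
  by_cases h : b = 0 <;> simp [HahnSeries.coeff_single_of_ne, h]

lemma atV_scal_mul (c : LaurentSeries ℂ) (f : LaurentSeries A) :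
    atV (scal c * f) = embV c • atV f := by
  rw [Algebra.smul_def, atV, map_mul]
  congr 1
  ext a b
  change _ = algebraMap ℂ A (((HahnSeries.C c : Laurent2 ℂ).coeff a).coeff b)
  by_cases h : a = 0
  · subst h
    simp [scal]
  · simp [HahnSeries.coeff_single_of_ne, h]

/-- The functional applied to `f(u) g(v)`. -/
noncomputable def pairUV (φ : A →ₗ[ℂ] ℂ) (f g : LaurentSeries A) : Laurent2 ℂ :=
  functional2 φ (atU f * atV g)

/-- The functional applied to `f(v) g(u)`. -/
noncomputable def pairVU (φ : A →ₗ[ℂ] ℂ) (f g : LaurentSeries A) : Laurent2 ℂ :=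
  functional2 φ (atV f * atU g)

@[simp] lemma pairUV_coeff (φ : A →ₗ[ℂ] ℂ) (f g : LaurentSeries A) (a b : ℤ) :
    ((pairUV φ f g).coeff a).coeff b = φ (f.coeff a * g.coeff b) := by
  simp only [pairUV, functional2_coeff, atV, atU]
  rw [HahnSeries.C_apply, HahnSeries.coeff_mul_single_zero]
  change φ ((HahnSeries.C (f.coeff a) * g).coeff b) = _
  rw [HahnSeries.C_apply, HahnSeries.coeff_single_zero_mul]

@[simp] lemma pairVU_coeff (φ : A →ₗ[ℂ] ℂ) (f g : LaurentSeries A) (a b : ℤ) :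
    ((pairVU φ f g).coeff a).coeff b = φ (f.coeff b * g.coeff a) := by
  simp only [pairVU, functional2_coeff, atV, atU]
  rw [HahnSeries.C_apply, HahnSeries.coeff_single_zero_mul]
  change φ ((f * HahnSeries.C (g.coeff a)).coeff b) = _
  rw [HahnSeries.C_apply, HahnSeries.coeff_mul_single_zero]

lemma atU_sub (f g : LaurentSeries A) : atU (f - g) = atU f - atU g := by
  simp only [atU_eq_mapSeries, map_sub]

lemma atV_sub (f g : LaurentSeries A) : (atV (f - g) : Laurent2 A) = atV f - atV g := by
  simp only [atV, map_sub]

lemma atU_zero : atU (0 : LaurentSeries A) = 0 := by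
  simp only [atU_eq_mapSeries, map_zero]

lemma atV_zero : (atV (0 : LaurentSeries A) : Laurent2 A) = 0 := by
  simp only [atV, map_zero]

end Pairing

/-! ### Compatibility with field embeddings -/

section Naturality

variable {K K' : Type} [Field K] [Field K'] (emb : ℂ →+* K) (f : K →+* K') (M : Model) (m : ℕ)

lemma map_iota (u : K) : f (M.iota u) = M.iota (f u) := by
  cases M <;> simp [Model.iota]

lemma map_psi (a : ℕ) (u : K) : f (M.psi emb m a u) = M.psi (f.comp emb) m a (f u) := by
  cases M with
  | yangian h => simp only [Model.psi, Model.fa, Model.fc, Model.iota, map_div₀, map_sub, map_neg,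
      map_mul, RingHom.comp_apply]
  | quantumAffine s => simp only [Model.psi, Model.fa, Model.fc, Model.iota, map_div₀, map_sub,
      map_inv₀, map_mul, RingHom.comp_apply, apply_ite f]

lemma map_move (e : ℤ) (u : K) : f (M.move emb e u) = M.move (f.comp emb) e (f u) := by
  cases M <;> simp [Model.move]

end Naturality

lemma embU_comp_const : embU.comp const = const2 := by
  ext z : 1
  exact HahnSeries.map_C z (HahnSeries.C : ℂ →+* LaurentSeries ℂ)

lemma embV_comp_const : embV.comp const = const2 := rfl

lemma embV_varX : embV varX = varV := rfl

lemma embU_varX : embU varX = varU := by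
  change HahnSeries.map (HahnSeries.single (-1) 1) (HahnSeries.C : ℂ →+* LaurentSeries ℂ) = _
  ext a : 2
  simp only [HahnSeries.map_coeff, varU]
  by_cases h : a = -1
  · subst h; simp
  · simp [HahnSeries.coeff_single_of_ne h]


/-! ### Successive removal of indices -/

section Chain

/-- Diagonal generators are even and carry no sign, so diagonal corrections commute with the sign
normalisation. -/
lemma genExp_self_even {R : Type} [Ring R] (m i : ℕ) (x : ℕ) :
    (-1 : R) ^ (genExp m i i + x) = (-1) ^ x := by
  apply neg_one_pow_congr
  simp only [genExp]
  push_cast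
  generalize (grade m i : ZMod 2) = i', (x : ZMod 2) = x'
  revert i' x'; decide

lemma pairing_correct {K L : Type} [Field K] [Ring L] [Algebra K L] (m : ℕ) (Φ : Functional K L)
    (X Y : ℕ → ℕ → L) (a b : K) (l : ℕ) :
    pairing m Φ (fun i j => X i j - if i = j then a • X l l else 0)
      (fun i j => Y i j - if i = j then b • Y l l else 0) = reduce l a b (pairing m Φ X Y) := by
  funext i j p r
  simp only [pairing, reduce]
  by_cases h : i = j <;> by_cases h' : p = r
  · subst h; subst h'
    simp only [if_true, sub_mul, mul_sub, smul_mul_assoc, mul_smul_comm, map_sub, map_smul,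
      smul_eq_mul, genExp_self_even]
    have h1 : ∀ x, (-1 : K) ^ genExp m x x = 1 := fun x => by
      rw [← add_zero (genExp m x x), genExp_self_even, pow_zero]
    simp only [h1]
    ring
  · subst h
    simp only [if_true, if_neg h', sub_mul, sub_zero, smul_mul_assoc, map_sub, map_smul,
      smul_eq_mul, genExp_self_even]
    ring
  · subst h'
    simp only [if_true, if_neg h, sub_zero, mul_sub, mul_smul_comm, map_sub, map_smul,
      smul_eq_mul, add_comm (genExp m i j), genExp_self_even]
    ring
  · simp [h, h']

variable {A : Type} [Ring A] [Algebra ℂ A]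

/-- The values of a functional on `d_{ij}(u) d_{pr}(v)`, with signs. -/
noncomputable def valUV (m : ℕ) (φ : A →ₗ[ℂ] ℂ) (D : ℕ → ℕ → LaurentSeries A) :
    ℕ → ℕ → ℕ → ℕ → Laurent2 ℂ :=
  pairing m (functional2 φ) (fun i j => atU (D i j)) (fun i j => atV (D i j))

/-- The values of a functional on `d_{ij}(v) d_{pr}(u)`, with signs. -/
noncomputable def valVU (m : ℕ) (φ : A →ₗ[ℂ] ℂ) (D : ℕ → ℕ → LaurentSeries A) :
    ℕ → ℕ → ℕ → ℕ → Laurent2 ℂ :=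
  pairing m (functional2 φ) (fun i j => atV (D i j)) (fun i j => atU (D i j))

lemma valUV_eq (m : ℕ) (φ : A →ₗ[ℂ] ℂ) (D : ℕ → ℕ → LaurentSeries A) (i j p r : ℕ) :
    valUV m φ D i j p r = (-1) ^ (genExp m i j + genExp m p r) * pairUV φ (D i j) (D p r) := rfl

lemma valVU_eq (m : ℕ) (φ : A →ₗ[ℂ] ℂ) (D : ℕ → ℕ → LaurentSeries A) (i j p r : ℕ) :
    valVU m φ D i j p r = (-1) ^ (genExp m i j + genExp m p r) * pairVU φ (D i j) (D p r) := rfl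

/-- The series obtained from `e` by successively removing the indices `1, …, t`. -/
noncomputable def chainD (c : ℕ → LaurentSeries ℂ) (e : ℕ → ℕ → LaurentSeries A) :
    ℕ → ℕ → ℕ → LaurentSeries A
  | 0, i, j => e i j
  | t + 1, i, j => chainD c e t i j -
      if i = j then scal (c t) * chainD c e t (t + 1) (t + 1) else 0

/-- Corrections are diagonal, so the lower entries that generate the ideal are the same at every
level. -/
lemma chainD_of_ne (c : ℕ → LaurentSeries ℂ) (e : ℕ → ℕ → LaurentSeries A) (t : ℕ) {i j : ℕ}
    (h : i ≠ j) : chainD c e t i j = e i j := by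
  induction t with
  | zero => rfl
  | succ t ih => rw [chainD, ih, if_neg h, sub_zero]

lemma valUV_chainD (m : ℕ) (φ : A →ₗ[ℂ] ℂ) (c : ℕ → LaurentSeries ℂ)
    (e : ℕ → ℕ → LaurentSeries A) (t : ℕ) :
    valUV m φ (chainD c e (t + 1))
      = reduce (t + 1) (embU (c t)) (embV (c t)) (valUV m φ (chainD c e t)) := by
  rw [valUV, valUV, ← pairing_correct]
  congr 1 <;> funext i j
  · rw [chainD, atU_sub, apply_ite atU, atU_scal_mul, atU_zero]
  · rw [chainD, atV_sub, apply_ite atV, atV_scal_mul, atV_zero]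

lemma valVU_chainD (m : ℕ) (φ : A →ₗ[ℂ] ℂ) (c : ℕ → LaurentSeries ℂ)
    (e : ℕ → ℕ → LaurentSeries A) (t : ℕ) :
    valVU m φ (chainD c e (t + 1))
      = reduce (t + 1) (embV (c t)) (embU (c t)) (valVU m φ (chainD c e t)) := by
  rw [valVU, valVU, ← pairing_correct]
  congr 1 <;> funext i j
  · rw [chainD, atV_sub, apply_ite atV, atV_scal_mul, atV_zero]
  · rw [chainD, atU_sub, apply_ite atU, atU_scal_mul, atU_zero]

/-- The reflection equation for the values of a functional. -/
def ValEq (M : Model) (m l N : ℕ) (φ : A →ₗ[ℂ] ℂ) (w : LaurentSeries ℂ)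
    (D : ℕ → ℕ → LaurentSeries A) : Prop :=
  ReflEq (Finset.Icc l N) (eta (Laurent2 ℂ) m) (theta const2 M m (embU w) (embV w))
    (theta const2 M m (embU w) (M.iota (embV w))) (M.fb (embU w) (embV w))
    (M.fb (embU w) (M.iota (embV w))) (valUV m φ D) (valVU m φ D)

/-- A sequence of generic spectral parameters in which each is the shift of the next one. -/
structure ShiftChain (M : Model) (m : ℕ) (w : ℕ → LaurentSeries ℂ) : Prop where
  shift : ∀ t, w t = M.shift const m (t + 1) (w (t + 1))
  generic : ∀ t, M.Generic const2 (embU (w t)) (embV (w t))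

/-- The correction factors along a chain of spectral parameters. -/
noncomputable def factor (M : Model) (m : ℕ) (w : ℕ → LaurentSeries ℂ) (t : ℕ) :
    LaurentSeries ℂ := M.psi const m (t + 1) (w t)

variable {M : Model} {m N k : ℕ} {w : ℕ → LaurentSeries ℂ} {φ : A →ₗ[ℂ] ℂ}
  {e : ℕ → ℕ → LaurentSeries A}

lemma embU_shift (a : ℕ) (x : LaurentSeries ℂ) :
    embU (M.shift const m a x) = M.shift const2 m a (embU x) := by
  rw [Model.shift_eq_move, Model.shift_eq_move, ← embU_comp_const]
  exact map_move (K' := Laurent2 ℂ) const embU M _ x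

lemma embV_shift (a : ℕ) (x : LaurentSeries ℂ) :
    embV (M.shift const m a x) = M.shift const2 m a (embV x) := by
  rw [Model.shift_eq_move, Model.shift_eq_move, ← embV_comp_const]
  exact map_move (K' := Laurent2 ℂ) const embV M _ x

/-- The pivot t + 1 is removed between the parameters w t = (w (t + 1))^(t+1) and w (t + 1). -/
lemma ShiftChain.exists_pivotData (hw : ShiftChain M m w) (N t : ℕ) :
    ∃ α β αb βb, PivotData (Finset.Icc (t + 2) N) (t + 1) (eta (Laurent2 ℂ) m)
      (theta const2 M m (embU (w t)) (embV (w t)))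
      (theta const2 M m (embU (w t)) (M.iota (embV (w t))))
      (theta const2 M m (embU (w (t + 1))) (M.iota (embV (w (t + 1)))))
      (M.fb (embU (w t)) (embV (w t))) (M.fb (embU (w t)) (M.iota (embV (w t))))
      (M.fb (embU (w (t + 1))) (M.iota (embV (w (t + 1))))) α β αb βb
      (embU (factor M m w t)) (embV (factor M m w t)) := by
  have G0 : M.Generic const2 (M.shift const2 m (t + 1) (embU (w (t + 1))))
      (M.shift const2 m (t + 1) (embV (w (t + 1)))) := by
    rw [← embU_shift, ← embV_shift, ← hw.shift]
    exact hw.generic t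
  have h := M.exists_pivotData (K := Laurent2 ℂ) const2 m (S := Finset.Icc (t + 2) N)
    (l := t + 1) (u := embU (w (t + 1))) (v := embV (w (t + 1)))
    (fun x hx => by simp only [Finset.mem_Icc] at hx; omega) (hw.generic (t + 1)) G0
  have eU : embU (factor M m w t) = M.psi const2 m (t + 1) (embU (w t)) :=
    (map_psi (K' := Laurent2 ℂ) const embU M m (t + 1) (w t)).trans (by rw [embU_comp_const])
  have eV : embV (factor M m w t) = M.psi const2 m (t + 1) (embV (w t)) :=
    (map_psi (K' := Laurent2 ℂ) const embV M m (t + 1) (w t)).trans (by rw [embV_comp_const])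
  have e1 := theta_shift const2 m M (t + 1) (embU (w (t + 1))) (embV (w (t + 1)))
  have e2 := fb_shift const2 m M (t + 1) (embU (w (t + 1))) (embV (w (t + 1)))
  have f1 : M.shift const2 m (t + 1) (embU (w (t + 1))) = embU (w t) := by
    rw [← embU_shift, ← hw.shift]
  have f2 : M.shift const2 m (t + 1) (embV (w (t + 1))) = embV (w t) := by
    rw [← embV_shift, ← hw.shift]
  rw [f1, f2] at h e1 e2
  rw [← e1, ← e2] at h
  rw [eU, eV]
  exact h

lemma valUV_lower (hφ : ∀ i l : ℕ, l < i → l < k → ∀ (x : A) (r : ℤ), φ (x * (e i l).coeff r) = 0)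
    (c : ℕ → LaurentSeries ℂ) {t p : ℕ} (ht : t + 1 < k) (hp : t + 1 < p) (x y : ℕ) :
    valUV m φ (chainD c e t) x y p (t + 1) = 0 := by
  rw [valUV_eq, chainD_of_ne c e t hp.ne']
  have : pairUV φ (chainD c e t x y) (e p (t + 1)) = 0 := by
    ext a b
    rw [pairUV_coeff, hφ p (t + 1) hp ht]
    rfl
  rw [this]
  exact mul_zero (_ : Laurent2 ℂ)

lemma valVU_lower (hφ : ∀ i l : ℕ, l < i → l < k → ∀ (x : A) (r : ℤ), φ (x * (e i l).coeff r) = 0)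
    (c : ℕ → LaurentSeries ℂ) {t p : ℕ} (ht : t + 1 < k) (hp : t + 1 < p) (x y : ℕ) :
    valVU m φ (chainD c e t) x y p (t + 1) = 0 := by
  rw [valVU_eq, chainD_of_ne c e t hp.ne']
  have : pairVU φ (chainD c e t x y) (e p (t + 1)) = 0 := by
    ext a b
    rw [pairVU_coeff, hφ p (t + 1) hp ht]
    rfl
  rw [this]
  exact mul_zero (_ : Laurent2 ℂ)

lemma Icc_eq_insert {t N : ℕ} (h : t + 1 ≤ N) :
    Finset.Icc (t + 1) N = insert (t + 1) (Finset.Icc (t + 2) N) := by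
  ext x; simp only [Finset.mem_Icc, Finset.mem_insert]; omega

/-- The reflection equation is preserved along the chain. -/
theorem valEq_chainD (hw : ShiftChain M m w) (hkN : k ≤ N)
    (hφ : ∀ i l : ℕ, l < i → l < k → ∀ (x : A) (r : ℤ), φ (x * (e i l).coeff r) = 0)
    (h1 : ValEq M m 1 N φ (w 0) e) (t : ℕ) (ht : t + 1 ≤ k) :
    ValEq M m (t + 1) N φ (w t) (chainD (factor M m w) e t) := by
  induction t with
  | zero => exact h1
  | succ t ih =>
    have h := ih (by omega)
    obtain ⟨α, β, αb, βb, P⟩ := hw.exists_pivotData N t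
    rw [ValEq, Icc_eq_insert (by omega)] at h
    have h2 := P.reflEq_reduce h
      (fun x _ y _ p hp => valUV_lower hφ _ (by omega)
        (by simp only [Finset.mem_Icc] at hp; omega) x y)
      (fun x _ y _ p hp => valVU_lower hφ _ (by omega)
        (by simp only [Finset.mem_Icc] at hp; omega) x y)
    rw [ValEq, valUV_chainD, valVU_chainD]
    -- The coefficients of R still refer to the old parameter, but they are shift invariant.
    have e1 : theta const2 M m (embU (w t)) (embV (w t))
        = theta const2 M m (embU (w (t + 1))) (embV (w (t + 1))) := by
      rw [hw.shift t, embU_shift, embV_shift, theta_shift]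
    have e2 : M.fb (embU (w t)) (embV (w t))
        = M.fb (embU (w (t + 1))) (embV (w (t + 1))) := by
      rw [hw.shift t, embU_shift, embV_shift, fb_shift]
    rw [e1, e2] at h2
    exact h2

end Chain

/-! ### Genericity of the spectral variables -/

section Variables

variable {R : Type} [Field R]

/-- The weak form of transcendence needed below, seen on the coefficient in degree -(n + 1). Each
denominator factors so that its vanishing would give a relation U^(n+1) a = y over the smaller
field. -/
lemma single_pow_mul_C_ne (n : ℕ) {a : R} (ha : a ≠ 0) (y : R) :
    (HahnSeries.single (-1 : ℤ) (1 : R)) ^ (n + 1) * HahnSeries.C a ≠ HahnSeries.C y := by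
  intro h
  have h1 := congrArg (fun f => HahnSeries.coeff f (-(n + 1 : ℤ))) h
  rw [HahnSeries.single_pow, HahnSeries.C_apply, HahnSeries.C_apply,
    HahnSeries.single_mul_single] at h1
  have h2 : (n + 1) • (-1 : ℤ) + 0 = -(n + 1 : ℤ) := by simp
  have h3 : -(n + 1 : ℤ) ≠ 0 := by omega
  simp only [one_pow, one_mul] at h1
  rw [h2, HahnSeries.coeff_single_same, HahnSeries.coeff_single_of_ne h3] at h1
  exact ha h1

/-- The conditions on spectral parameters hold when `u` and `v` are the variables up to a common
move. -/
lemma generic_of_transcendental {K : Type} [Field K] (emb : ℂ →+* K) (emb' : ℂ →+* R)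
    (f : R →+* K) (hf : f.comp emb' = emb) (M : Model) (e : ℤ) (U : K) (V : R)
    (hU : ∀ n a y, a ≠ 0 → U ^ (n + 1) * f a ≠ f y)
    (hV : ∀ n a y, a ≠ 0 → V ^ (n + 1) * emb' a ≠ emb' y) :
    M.Generic emb (M.move emb e U) (M.move emb e (f V)) := by
  subst hf
  have hU1 : ∀ y, U ≠ f y := fun y h => hU 0 1 y one_ne_zero (by simp [h])
  have hV1 : ∀ y, V ≠ emb' y := fun y h => hV 0 1 y one_ne_zero (by simp [h])
  have hU0 : U ≠ 0 := by simpa using hU1 0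
  have hV0 : V ≠ 0 := by simpa using hV1 0
  have hfV : f V ≠ 0 := by simpa using hV0
  cases M with
  | yangian h =>
    simp only [Model.Generic, Model.move, RingHom.comp_apply]
    generalize h / 2 * (e : ℂ) = c
    refine ⟨fun h0 => hU1 V (by linear_combination h0), fun h0 => ?_,
      fun h0 => hU1 (-V - emb' c - emb' c) (by simp only [map_sub, map_neg]; linear_combination h0),
      fun h0 => hU1 (-emb' c) (by rw [map_neg]; linear_combination h0), fun h0 => ?_⟩
    · have h1 : (U - f V - f (emb' h)) * (U - f V + f (emb' h)) = 0 := by linear_combination h0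
      rcases mul_eq_zero.mp h1 with h1 | h1
      · exact hU1 (V + emb' h) (by rw [map_add]; linear_combination h1)
      · exact hU1 (V - emb' h) (by rw [map_sub]; linear_combination h1)
    · rw [← map_add, map_eq_zero] at h0
      exact hV1 (-c) (by rw [map_neg]; linear_combination h0)
  | quantumAffine s =>
    simp only [Model.Generic, Model.move, RingHom.comp_apply]
    have hz : (s : ℂ) ^ (-e) ≠ 0 := zpow_ne_zero _ s.ne_zero
    generalize (s : ℂ) ^ (-e) = z at hz
    have hz1 : emb' z ≠ 0 := by simpa using hz
    have hz2 : f (emb' z) ≠ 0 := by simpa using hz1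
    have hs1 : emb' s ≠ 0 := by simp
    have hs2 : f (emb' s) ≠ 0 := by simp
    have e1 : U * f (emb' z) / (f V * f (emb' z)) = U / f V := mul_div_mul_right _ _ hz2
    rw [e1]
    refine ⟨mul_ne_zero hU0 hz2, mul_ne_zero hfV hz2, fun h0 => ?_, fun h0 => ?_, fun h0 => ?_,
      fun h0 => ?_, fun h0 => ?_⟩
    · refine hU 1 1 (V ^ 2) one_ne_zero ?_
      rw [map_one, map_pow]
      field_simp at h0
      linear_combination h0
    · have h1 : (U ^ 2 - f (V ^ 2 * emb' s ^ 4)) * (U ^ 2 * f (emb' s ^ 4) - f (V ^ 2)) = 0 := by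
        simp only [map_mul, map_pow]
        field_simp at h0
        linear_combination h0
      rcases mul_eq_zero.mp h1 with h1 | h1
      · exact hU 1 1 (V ^ 2 * emb' s ^ 4) one_ne_zero (by rw [map_one]; linear_combination h1)
      · exact hU 1 (emb' s ^ 4) (V ^ 2) (pow_ne_zero 4 hs1) (by linear_combination h1)
    · refine hU 1 (V ^ 2 * emb' z ^ 4) 1 (mul_ne_zero (pow_ne_zero _ hV0) (pow_ne_zero _ hz1)) ?_
      simp only [map_one, map_pow, map_mul]
      field_simp at h0
      linear_combination h0
    · refine hU 3 (emb' z ^ 4) 1 (pow_ne_zero _ hz1) ?_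
      simp only [map_one, map_pow]
      linear_combination h0
    · rw [← map_mul, ← map_pow, ← map_one f, ← map_sub, map_eq_zero] at h0
      refine hV 3 (z ^ 4) 1 (pow_ne_zero _ hz) ?_
      simp only [map_one, map_pow]
      linear_combination h0

lemma regular_of_transcendental (emb' : ℂ →+* R) (M : Model) (e : ℤ) (V : R)
    (hV : ∀ n a y, a ≠ 0 → V ^ (n + 1) * emb' a ≠ emb' y) :
    M.Regular (M.move emb' e V) := by
  have hV1 : ∀ y, V ≠ emb' y := fun y h => hV 0 1 y one_ne_zero (by simp [h])
  have hV0 : V ≠ 0 := by simpa using hV1 0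
  cases M with
  | yangian h =>
    intro h0
    simp only [Model.move] at h0
    exact hV1 (-(h / 2 * e)) (by rw [map_neg]; linear_combination h0)
  | quantumAffine s =>
    simp only [Model.Regular, Model.move]
    have hz : (s : ℂ) ^ (-e) ≠ 0 := zpow_ne_zero _ s.ne_zero
    generalize (s : ℂ) ^ (-e) = z at hz
    refine ⟨mul_ne_zero hV0 (by simpa using hz), fun h0 => ?_⟩
    refine hV 3 (z ^ 4) 1 (pow_ne_zero _ hz) ?_
    simp only [map_one, map_pow]
    linear_combination h0

lemma generic_variable (emb' : ℂ →+* R) (M : Model) (e : ℤ) (V : R)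
    (hV : ∀ n a y, a ≠ 0 → V ^ (n + 1) * emb' a ≠ emb' y) :
    M.Generic ((HahnSeries.C : R →+* LaurentSeries R).comp emb')
      (M.move ((HahnSeries.C : R →+* LaurentSeries R).comp emb') e (HahnSeries.single (-1) 1))
      (M.move ((HahnSeries.C : R →+* LaurentSeries R).comp emb') e (HahnSeries.C V)) :=
  generic_of_transcendental _ emb' _ rfl M e _ V (fun n _ y ha => single_pow_mul_C_ne n ha y) hV

end Variables

/-- The spectral parameters `u^{(t+1 … k-1)}`, where `c` is the total shift. -/
noncomputable def shiftSeq (M : Model) (m : ℕ) (c : ℤ) (t : ℕ) : LaurentSeries ℂ :=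
  M.move const (c - ∑ a ∈ Finset.range t, parity m (a + 1)) varX

lemma varX_transcendental (n : ℕ) (a y : ℂ) (ha : a ≠ 0) : varX ^ (n + 1) * const a ≠ const y :=
  single_pow_mul_C_ne n ha y

lemma regular_move (M : Model) (e : ℤ) : M.Regular (M.move const e varX) :=
  regular_of_transcendental const M e varX varX_transcendental

lemma generic_move (M : Model) (e : ℤ) :
    M.Generic const2 (embU (M.move const e varX)) (embV (M.move const e varX)) := by
  have h1 : embU (M.move const e varX) = M.move const2 e varU := by
    rw [← embU_comp_const, ← embU_varX]
    exact map_move (K' := Laurent2 ℂ) const embU M e varX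
  have h2 : embV (M.move const e varX) = M.move const2 e (embV varX) := by
    rw [← embV_comp_const]
    exact map_move (K' := Laurent2 ℂ) const embV M e varX
  rw [h1, h2]
  exact generic_variable const M e varX varX_transcendental

lemma shiftChain_shiftSeq (M : Model) (m : ℕ) (c : ℤ) : ShiftChain M m (shiftSeq M m c) where
  shift t := by
    rw [Model.shift_eq_move, shiftSeq, shiftSeq, ← Model.move_add, Finset.sum_range_succ]
    congr 1
    ring
  generic t := generic_move M _

/-! ### The closed formula for the nested generators -/

section ClosedForm

variable {A : Type} [Ring A] [Algebra ℂ A]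

lemma scal_eq_mapSeries (f : LaurentSeries ℂ) :
    (scal f : LaurentSeries A) = mapSeries (algebraMap ℂ A) f := rfl

lemma q_ne_zero (M : Model) : M.q ≠ 0 := by
  cases M <;> simp [Model.q]

/-- The coefficients of the nested generators. -/
noncomputable def nestedCoeff (M : Model) (m : ℕ) (w : LaurentSeries ℂ) (t a : ℕ) :
    LaurentSeries ℂ :=
  const (M.q ^ (2 * ((t : ℤ) - a) - 4 * ∑ l ∈ Finset.Ioo a (t + 1), (grade m l : ℤ)))
    * M.psi const m a (M.shift const m a w)

/-- Removing index t + 1 subtracts ψ times the pivot, whose own correction contains every earlier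
d_aa; each earlier coefficient is thus multiplied by 1 - ψ. By `Model.psi_recursion` this equals a
change of parameter and a factor q^(2 - 4[t+1]), the source of the exponent in d^(k). -/
lemma nestedCoeff_succ (M : Model) (m : ℕ) {w : ℕ → LaurentSeries ℂ} (hw : ShiftChain M m w)
    (hreg : ∀ t, M.Regular (w t)) {t a : ℕ} (ha : a < t + 1) :
    nestedCoeff M m (w (t + 1)) (t + 1) a = nestedCoeff M m (w t) t a * (1 - factor M m w t) := by
  have h := M.psi_recursion const m a (t + 1) (hreg (t + 1)) (by rw [← hw.shift]; exact hreg t)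
  rw [← hw.shift] at h
  rw [nestedCoeff, nestedCoeff, factor, mul_assoc, ← h, ← mul_assoc, ← map_mul,
    ← zpow_add₀ (q_ne_zero M)]
  congr 3
  have h1 : Finset.Ioo a (t + 1 + 1) = insert (t + 1) (Finset.Ioo a (t + 1)) := by
    ext x; simp only [Finset.mem_Ioo, Finset.mem_insert]; omega
  rw [h1, Finset.sum_insert (by simp)]
  push_cast
  ring

lemma nestedCoeff_self (M : Model) (m : ℕ) {w : ℕ → LaurentSeries ℂ} (hw : ShiftChain M m w)
    (t : ℕ) : nestedCoeff M m (w (t + 1)) (t + 1) (t + 1) = factor M m w t := by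
  rw [nestedCoeff, factor, ← hw.shift]
  have h : Finset.Ioo (t + 1) (t + 1 + 1) = ∅ := by
    ext x; simp
  rw [h]
  simp

lemma chainD_eq (M : Model) (m : ℕ) {w : ℕ → LaurentSeries ℂ} (hw : ShiftChain M m w)
    (hreg : ∀ t, M.Regular (w t)) (e : ℕ → ℕ → LaurentSeries A) (t i j : ℕ) :
    chainD (factor M m w) e t i j = e i j - if i = j then
      ∑ a ∈ Finset.Icc 1 t, scal (nestedCoeff M m (w t) t a) * e a a else 0 := by
  induction t generalizing i j with
  | zero => simp [chainD]
  | succ t ih =>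
    rw [chainD, ih i j, ih (t + 1) (t + 1), if_pos rfl]
    split_ifs with h
    · have h1 : Finset.Icc 1 (t + 1) = insert (t + 1) (Finset.Icc 1 t) := by
        ext x; simp only [Finset.mem_Icc, Finset.mem_insert]; omega
      rw [h1, Finset.sum_insert (by simp), nestedCoeff_self M m hw]
      have h2 : ∀ a ∈ Finset.Icc 1 t, scal (nestedCoeff M m (w (t + 1)) (t + 1) a) * e a a
          = scal (nestedCoeff M m (w t) t a) * e a a
            - scal (factor M m w t) * (scal (nestedCoeff M m (w t) t a) * e a a) := by
        intro a ha
        rw [nestedCoeff_succ M m hw hreg (by simp only [Finset.mem_Icc] at ha; omega)]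
        simp only [scal_eq_mapSeries]
        rw [mul_comm, map_mul, map_sub, map_one]
        noncomm_ring
      rw [Finset.sum_congr rfl h2, Finset.sum_sub_distrib, ← Finset.mul_sum]
      noncomm_ring
    · simp

end ClosedForm

/-! ### Substituting a series for the variable -/

section Substitution

variable {R : Type} [Field R] {g : LaurentSeries R}

/-- The order of g is at most -1, so that of its inverse is at least 1. This is why the truncated
sums in `evalSeries` lose nothing. -/
lemma order_inv_pow_ge (hg : g.coeff (-1) ≠ 0) (r : ℕ) : (r : ℤ) ≤ (g⁻¹ ^ r).order := by
  have h0 : g ≠ 0 := by rintro rfl; simp at hg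
  have h1 : g.order ≤ -1 := HahnSeries.order_le_of_coeff_ne_zero hg
  have h2 : (g * g⁻¹).order = g.order + g⁻¹.order := HahnSeries.order_mul h0 (inv_ne_zero h0)
  rw [mul_inv_cancel₀ h0, HahnSeries.order_one] at h2
  rw [HahnSeries.order_pow, nsmul_eq_mul]
  nlinarith

lemma coeff_inv_pow_eq_zero (hg : g.coeff (-1) ≠ 0) {l : ℤ} {r : ℕ} (h : l < r) :
    (g⁻¹ ^ r).coeff l = 0 :=
  HahnSeries.coeff_eq_zero_of_lt_order (h.trans_le (order_inv_pow_ge hg r))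

lemma orderTop_inv_pos (hg : g.coeff (-1) ≠ 0) : 0 < (g⁻¹).orderTop := by
  have h0 : g⁻¹ ≠ 0 := by
    rintro h; rw [inv_eq_zero] at h; subst h; simp at hg
  have h1 := order_inv_pow_ge hg 1
  rw [pow_one] at h1
  rw [← HahnSeries.order_eq_orderTop_of_ne_zero h0]
  have : (0 : ℤ) < (g⁻¹).order := by simp at h1; omega
  exact_mod_cast this

/-- The substitution of `g` for the variable in power series. -/
noncomputable def substPower (g : LaurentSeries R) : PowerSeries R →+* LaurentSeries R :=
  RingHomClass.toRingHom (PowerSeries.heval (R := R) g⁻¹)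

lemma substPower_X (hg : g.coeff (-1) ≠ 0) : substPower g PowerSeries.X = g⁻¹ :=
  PowerSeries.heval_X _ (orderTop_inv_pos hg)

lemma isUnit_substPower (hg : g.coeff (-1) ≠ 0)
    (y : Submonoid.powers (PowerSeries.X : PowerSeries R)) : IsUnit (substPower g y) := by
  obtain ⟨-, n, rfl⟩ := y
  have h0 : g⁻¹ ≠ 0 := by
    rintro h; rw [inv_eq_zero] at h; subst h; simp at hg
  change IsUnit (substPower g (PowerSeries.X ^ n))
  rw [map_pow, substPower_X hg]
  exact (pow_ne_zero n h0).isUnit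

/-- The substitution of `g` for the variable. -/
noncomputable def substSeries (g : LaurentSeries R) (hg : g.coeff (-1) ≠ 0) :
    LaurentSeries R →+* LaurentSeries R :=
  -- Laurent series are power series in X = u⁻¹ localised at X, and X goes to the invertible g⁻¹.
  IsLocalization.lift (isUnit_substPower hg)

lemma substSeries_ofPowerSeries (hg : g.coeff (-1) ≠ 0) (p : PowerSeries R) :
    substSeries g hg (HahnSeries.ofPowerSeries ℤ R p) = PowerSeries.heval g⁻¹ p := by
  have h := IsLocalization.lift_eq (S := LaurentSeries R) (isUnit_substPower hg) p
  rw [LaurentSeries.coe_algebraMap] at h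
  exact h

lemma substSeries_C (hg : g.coeff (-1) ≠ 0) (a : R) :
    substSeries g hg (HahnSeries.C a) = HahnSeries.C a := by
  rw [← HahnSeries.ofPowerSeries_C, substSeries_ofPowerSeries, PowerSeries.heval_C,
    HahnSeries.ofPowerSeries_C, ← HahnSeries.C_mul_eq_smul, mul_one]

lemma substSeries_variable (hg : g.coeff (-1) ≠ 0) :
    substSeries g hg (HahnSeries.single (-1) 1) = g := by
  have h1 : (HahnSeries.single (-1 : ℤ) (1 : R))
      = (HahnSeries.ofPowerSeries ℤ R PowerSeries.X)⁻¹ := by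
    rw [HahnSeries.ofPowerSeries_X, eq_comm, inv_eq_iff_eq_inv, HahnSeries.inv_single]
    simp
  rw [h1, map_inv₀, substSeries_ofPowerSeries, PowerSeries.heval_X _ (orderTop_inv_pos hg), inv_inv]

lemma coeff_substSeries (hg : g.coeff (-1) ≠ 0) (p : ℕ → R) (l : ℕ) :
    (substSeries g hg (HahnSeries.ofPowerSeries ℤ R (PowerSeries.mk p))).coeff l
      = ∑ r ∈ Finset.range (l + 1), (g⁻¹ ^ r).coeff (l : ℤ) * p r := by
  rw [substSeries_ofPowerSeries, PowerSeries.coeff_heval, finsum_eq_sum_of_support_subset]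
  · refine Finset.sum_congr rfl fun r _ => ?_
    simp [orderTop_inv_pos hg, mul_comm]
  · intro r hr
    by_contra h
    simp only [Finset.coe_range, Set.mem_Iio, not_lt] at h
    refine hr ?_
    have h1 := coeff_inv_pow_eq_zero hg (l := l) (r := r) (by exact_mod_cast h)
    simp [orderTop_inv_pos hg]
    right
    simpa using h1

lemma coeff_substSeries_neg (hg : g.coeff (-1) ≠ 0) (p : ℕ → R) {l : ℤ} (hl : l < 0) :
    (substSeries g hg (HahnSeries.ofPowerSeries ℤ R (PowerSeries.mk p))).coeff l = 0 := by
  rw [substSeries_ofPowerSeries, PowerSeries.coeff_heval, finsum_eq_zero_of_forall_eq_zero]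
  intro r
  have h1 := coeff_inv_pow_eq_zero hg (l := l) (r := r) (by omega)
  simp [orderTop_inv_pos hg]
  right
  simpa using h1

end Substitution

section Naturality

variable {K K' : Type} [Field K] [Field K'] (emb : ℂ →+* K) (σ : K →+* K') (M : Model) (m : ℕ)

lemma map_fb (u v : K) : σ (M.fb u v) = M.fb (σ u) (σ v) := by
  cases M <;> simp [Model.fb]

lemma map_theta (u v : K) (i p : ℕ) :
    σ (theta emb M m u v i p) = theta (σ.comp emb) M m (σ u) (σ v) i p := by
  cases M with
  | yangian h => simp [theta_yangian]
  | quantumAffine s =>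
    simp only [theta_quantumAffine, trigTheta]
    split_ifs <;> simp

lemma map_sign_mul (n : ℕ) (x : K) : σ ((-1) ^ n * x) = (-1) ^ n * σ x := by simp

lemma map_eta (i p : ℕ) : σ (eta K m i p) = eta K' m i p := by simp [eta]

/-- The structure functions are rational in u and v over ℂ, so an embedding over ℂ just moves the
spectral parameters. -/
lemma map_reflEq {emb : ℂ →+* K} {emb' : ℂ →+* K'} (hσ : σ.comp emb = emb') {S : Finset ℕ}
    {u v : K} {A B : ℕ → ℕ → ℕ → ℕ → K}
    (h : ReflEq S (eta K m) (theta emb M m u v) (theta emb M m u (M.iota v)) (M.fb u v)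
      (M.fb u (M.iota v)) A B) :
    ReflEq S (eta K' m) (theta emb' M m (σ u) (σ v)) (theta emb' M m (σ u) (M.iota (σ v)))
      (M.fb (σ u) (σ v)) (M.fb (σ u) (M.iota (σ v))) (fun i j p r => σ (A i j p r))
      (fun i j p r => σ (B i j p r)) := by
  subst hσ
  intro i hi j hj p hp r hr
  have h1 := congrArg σ (h i hi j hj p hp r hr)
  simpa only [reflL, reflR, map_add, map_mul, map_sum, apply_ite σ, map_zero, map_theta, map_fb,
    map_iota, map_eta] using h1

end Naturality

/-! ### Passing to shifted spectral parameters in both variables -/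

section DoubleSubstitution

variable {A : Type} [Ring A] [Algebra ℂ A]

lemma coeff_evalSeries (c : ℕ → A) (g : LaurentSeries ℂ) (l : ℕ) :
    (evalSeries c g).coeff (l : ℤ)
      = ∑ r ∈ Finset.range (l + 1), (g⁻¹ ^ r).coeff (l : ℤ) • c r := by
  rw [evalSeries, HahnSeries.ofPowerSeries_apply_coeff, PowerSeries.coeff_mk]

lemma coeff_ofPowerSeries_neg {S : Type} [Semiring S] (p : PowerSeries S) {l : ℤ} (hl : l < 0) :
    (HahnSeries.ofPowerSeries ℤ S p).coeff l = 0 := by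
  rw [HahnSeries.ofPowerSeries_apply]
  exact HahnSeries.embDomain_of_notMem_range fun ⟨n, hn⟩ => by
    change ((n : ℕ) : ℤ) = l at hn
    omega

lemma coeff_evalSeries_neg (c : ℕ → A) (g : LaurentSeries ℂ) {l : ℤ} (hl : l < 0) :
    (evalSeries c g).coeff l = 0 := coeff_ofPowerSeries_neg _ hl

/-- Power series in two variables given by their coefficients. -/
noncomputable def ofCoeffs (F : ℕ → ℕ → ℂ) : Laurent2 ℂ :=
  HahnSeries.ofPowerSeries ℤ _ (PowerSeries.mk fun a =>
    HahnSeries.ofPowerSeries ℤ _ (PowerSeries.mk fun b => F a b))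

lemma coeff_ofCoeffs (F : ℕ → ℕ → ℂ) (a b : ℕ) :
    ((ofCoeffs F).coeff (a : ℤ)).coeff (b : ℤ) = F a b := by
  rw [ofCoeffs, HahnSeries.ofPowerSeries_apply_coeff, PowerSeries.coeff_mk,
    HahnSeries.ofPowerSeries_apply_coeff, PowerSeries.coeff_mk]

lemma coeff_ofCoeffs_neg (F : ℕ → ℕ → ℂ) {a b : ℤ} (h : a < 0 ∨ b < 0) :
    ((ofCoeffs F).coeff a).coeff b = 0 := by
  rcases lt_or_ge a 0 with ha | ha
  · rw [ofCoeffs, coeff_ofPowerSeries_neg _ ha, HahnSeries.coeff_zero]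
  · lift a to ℕ using ha
    rw [ofCoeffs, HahnSeries.ofPowerSeries_apply_coeff, PowerSeries.coeff_mk,
      coeff_ofPowerSeries_neg _ (by omega)]

lemma eq_ofCoeffs {X : Laurent2 ℂ} {F : ℕ → ℕ → ℂ}
    (h : ∀ a b : ℕ, (X.coeff (a : ℤ)).coeff (b : ℤ) = F a b)
    (h' : ∀ a b : ℤ, a < 0 ∨ b < 0 → (X.coeff a).coeff b = 0) : X = ofCoeffs F := by
  ext a b
  by_cases hab : a < 0 ∨ b < 0
  · rw [h' a b hab, coeff_ofCoeffs_neg F hab]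
  · simp only [not_or, not_lt] at hab
    obtain ⟨ha, hb⟩ := hab
    lift a to ℕ using ha
    lift b to ℕ using hb
    rw [h, coeff_ofCoeffs]

lemma coeff_embU_ne_zero {g : LaurentSeries ℂ} (hg : g.coeff (-1) ≠ 0) :
    (embU g).coeff (-1) ≠ 0 := by
  change HahnSeries.C (g.coeff (-1)) ≠ 0
  simpa using hg

/-- The substitution of `g(u)`, `g(v)` for the variables `u`, `v`. -/
noncomputable def substSeries2 (g : LaurentSeries ℂ) (hg : g.coeff (-1) ≠ 0) :
    Laurent2 ℂ →+* Laurent2 ℂ :=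
  -- First v ↦ g(v) inside the coefficients, then u ↦ g(u), whose coefficients are constant in v.
  (substSeries (embU g) (coeff_embU_ne_zero hg)).comp (mapSeries (substSeries g hg))

lemma mapSeries_C {S T : Type} [Ring S] [Ring T] (f : S →+* T) (a : S) :
    mapSeries f (HahnSeries.C a) = HahnSeries.C (f a) := HahnSeries.map_C a f

lemma mapSeries_single {S T : Type} [Ring S] [Ring T] (f : S →+* T) (b : ℤ) (a : S) :
    mapSeries f (HahnSeries.single b a) = HahnSeries.single b (f a) := by
  ext x
  change f ((HahnSeries.single b a).coeff x) = _
  by_cases h : x = b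
  · subst h; simp
  · simp [HahnSeries.coeff_single_of_ne h]

lemma mapSeries_ofPowerSeries {S T : Type} [Ring S] [Ring T] (f : S →+* T) (p : ℕ → S) :
    mapSeries f (HahnSeries.ofPowerSeries ℤ S (PowerSeries.mk p))
      = HahnSeries.ofPowerSeries ℤ T (PowerSeries.mk fun r => f (p r)) := by
  ext x
  change f ((HahnSeries.ofPowerSeries ℤ S (PowerSeries.mk p)).coeff x) = _
  rcases lt_or_ge x 0 with hx | hx
  · rw [coeff_ofPowerSeries_neg _ hx, coeff_ofPowerSeries_neg _ hx, map_zero]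
  · lift x to ℕ using hx
    simp only [HahnSeries.ofPowerSeries_apply_coeff, PowerSeries.coeff_mk]

lemma substSeries2_varU {g : LaurentSeries ℂ} (hg : g.coeff (-1) ≠ 0) :
    substSeries2 g hg varU = embU g := by
  rw [substSeries2, RingHom.comp_apply, varU, mapSeries_single, map_one]
  exact substSeries_variable _

lemma substSeries2_varV {g : LaurentSeries ℂ} (hg : g.coeff (-1) ≠ 0) :
    substSeries2 g hg varV = embV g := by
  rw [substSeries2, RingHom.comp_apply, varV, mapSeries_C, substSeries_variable hg]
  exact substSeries_C _ _

lemma substSeries2_const2 {g : LaurentSeries ℂ} (hg : g.coeff (-1) ≠ 0) :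
    (substSeries2 g hg).comp const2 = const2 := by
  ext z : 1
  rw [RingHom.comp_apply, substSeries2, RingHom.comp_apply, const2, RingHom.comp_apply,
    mapSeries_C, substSeries_C hg]
  exact substSeries_C _ _

lemma coeff_inv_pow_embU (g : LaurentSeries ℂ) (r : ℕ) (l : ℤ) :
    ((embU g)⁻¹ ^ r).coeff l = HahnSeries.C ((g⁻¹ ^ r).coeff l) := by
  have h : (embU g)⁻¹ ^ r = embU (g⁻¹ ^ r) := by rw [map_pow, map_inv₀]
  rw [h]
  rfl

lemma coeff_constant_mul {S : Type} [Ring S] (a : S) (f : LaurentSeries S) (l : ℤ) :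
    (HahnSeries.C a * f).coeff l = a * f.coeff l := by
  rw [HahnSeries.C_apply, HahnSeries.coeff_single_zero_mul]

lemma substSeries2_ofCoeffs {g : LaurentSeries ℂ} (hg : g.coeff (-1) ≠ 0) (F : ℕ → ℕ → ℂ) :
    substSeries2 g hg (ofCoeffs F) = ofCoeffs fun a b =>
      ∑ r ∈ Finset.range (a + 1), (g⁻¹ ^ r).coeff (a : ℤ) *
        ∑ s ∈ Finset.range (b + 1), (g⁻¹ ^ s).coeff (b : ℤ) * F r s := by
  rw [substSeries2, RingHom.comp_apply, ofCoeffs, mapSeries_ofPowerSeries]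
  refine eq_ofCoeffs (fun a b => ?_) fun a b h => ?_
  · rw [coeff_substSeries, HahnSeries.coeff_sum]
    refine Finset.sum_congr rfl fun r _ => ?_
    rw [coeff_inv_pow_embU, coeff_constant_mul, coeff_substSeries]
  · rcases lt_or_ge a 0 with ha | ha
    · rw [coeff_substSeries_neg _ _ ha, HahnSeries.coeff_zero]
    · lift a to ℕ using ha
      rw [coeff_substSeries, HahnSeries.coeff_sum]
      refine Finset.sum_eq_zero fun r _ => ?_
      rw [coeff_inv_pow_embU, coeff_constant_mul, coeff_substSeries_neg _ _ (by omega), mul_zero]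

lemma pairUV_evalSeries (φ : A →ₗ[ℂ] ℂ) (c c' : ℕ → A) (g : LaurentSeries ℂ) :
    pairUV φ (evalSeries c g) (evalSeries c' g) = ofCoeffs fun a b =>
      ∑ r ∈ Finset.range (a + 1), (g⁻¹ ^ r).coeff (a : ℤ) *
        ∑ s ∈ Finset.range (b + 1), (g⁻¹ ^ s).coeff (b : ℤ) * φ (c r * c' s) := by
  refine eq_ofCoeffs (fun a b => ?_) fun a b h => ?_
  · rw [pairUV_coeff, coeff_evalSeries, coeff_evalSeries, Finset.sum_mul_sum, map_sum]
    simp only [map_sum, Finset.mul_sum, smul_mul_assoc, mul_smul_comm, map_smul, smul_eq_mul]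
    exact Finset.sum_congr rfl fun _ _ => Finset.sum_congr rfl fun _ _ => mul_left_comm _ _ _
  · rw [pairUV_coeff]
    rcases h with h | h <;> simp [coeff_evalSeries_neg _ _ h]

lemma pairVU_evalSeries (φ : A →ₗ[ℂ] ℂ) (c c' : ℕ → A) (g : LaurentSeries ℂ) :
    pairVU φ (evalSeries c g) (evalSeries c' g) = ofCoeffs fun a b =>
      ∑ r ∈ Finset.range (a + 1), (g⁻¹ ^ r).coeff (a : ℤ) *
        ∑ s ∈ Finset.range (b + 1), (g⁻¹ ^ s).coeff (b : ℤ) * φ (c s * c' r) := by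
  refine eq_ofCoeffs (fun a b => ?_) fun a b h => ?_
  · rw [pairVU_coeff, coeff_evalSeries, coeff_evalSeries, Finset.sum_mul_sum, map_sum]
    simp only [map_sum, Finset.mul_sum, smul_mul_assoc, mul_smul_comm, map_smul, smul_eq_mul]
    rw [Finset.sum_comm]
  · rw [pairVU_coeff]
    rcases h with h | h <;> simp [coeff_evalSeries_neg _ _ h]

/-- Series in `u` with nonnegative powers of `u⁻¹`. -/
noncomputable def powerSeries (c : ℕ → A) : LaurentSeries A :=
  HahnSeries.ofPowerSeries ℤ A (PowerSeries.mk c)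

lemma coeff_powerSeries (c : ℕ → A) (l : ℕ) : (powerSeries c).coeff (l : ℤ) = c l := by
  rw [powerSeries, HahnSeries.ofPowerSeries_apply_coeff, PowerSeries.coeff_mk]

lemma coeff_powerSeries_neg (c : ℕ → A) {l : ℤ} (hl : l < 0) : (powerSeries c).coeff l = 0 :=
  coeff_ofPowerSeries_neg _ hl

/-- Substitution is performed after φ has been applied, so a ring homomorphism of scalar series is
enough. -/
lemma substSeries2_pairUV {g : LaurentSeries ℂ} (hg : g.coeff (-1) ≠ 0) (φ : A →ₗ[ℂ] ℂ)
    (c c' : ℕ → A) : substSeries2 g hg (pairUV φ (powerSeries c) (powerSeries c'))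
      = pairUV φ (evalSeries c g) (evalSeries c' g) := by
  have h : pairUV φ (powerSeries c) (powerSeries c') = ofCoeffs fun a b => φ (c a * c' b) := by
    refine eq_ofCoeffs (fun a b => ?_) fun a b h => ?_
    · simp only [pairUV_coeff, coeff_powerSeries]
    · rw [pairUV_coeff]
      rcases h with h | h <;> simp [coeff_powerSeries_neg _ h]
  rw [h, substSeries2_ofCoeffs, pairUV_evalSeries]

lemma substSeries2_pairVU {g : LaurentSeries ℂ} (hg : g.coeff (-1) ≠ 0) (φ : A →ₗ[ℂ] ℂ)
    (c c' : ℕ → A) : substSeries2 g hg (pairVU φ (powerSeries c) (powerSeries c'))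
      = pairVU φ (evalSeries c g) (evalSeries c' g) := by
  have h : pairVU φ (powerSeries c) (powerSeries c') = ofCoeffs fun a b => φ (c b * c' a) := by
    refine eq_ofCoeffs (fun a b => ?_) fun a b h => ?_
    · simp only [pairVU_coeff, coeff_powerSeries]
    · rw [pairVU_coeff]
      rcases h with h | h <;> simp [coeff_powerSeries_neg _ h]
  rw [h, substSeries2_ofCoeffs, pairVU_evalSeries]

theorem valEq_evalSeries {M : Model} {m l N : ℕ} {φ : A →ₗ[ℂ] ℂ} {c : ℕ → ℕ → ℕ → A}
    (h : ValEq M m l N φ varX fun i j => powerSeries (c i j)) {g : LaurentSeries ℂ}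
    (hg : g.coeff (-1) ≠ 0) : ValEq M m l N φ g fun i j => evalSeries (c i j) g := by
  have h1 := map_reflEq (K := Laurent2 ℂ) (K' := Laurent2 ℂ) (substSeries2 g hg) M m
    (substSeries2_const2 hg) h
  rw [embU_varX, embV_varX, substSeries2_varU, substSeries2_varV] at h1
  have e1 : (fun i j p r => substSeries2 g hg (valUV m φ (fun i j => powerSeries (c i j)) i j p r))
      = valUV m φ fun i j => evalSeries (c i j) g := by
    funext i j p r
    rw [valUV_eq, valUV_eq, ← substSeries2_pairUV hg]
    exact map_sign_mul (K := Laurent2 ℂ) (K' := Laurent2 ℂ) _ _ _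
  have e2 : (fun i j p r => substSeries2 g hg (valVU m φ (fun i j => powerSeries (c i j)) i j p r))
      = valVU m φ fun i j => evalSeries (c i j) g := by
    funext i j p r
    rw [valVU_eq, valVU_eq, ← substSeries2_pairVU hg]
    exact map_sign_mul (K := Laurent2 ℂ) (K' := Laurent2 ℂ) _ _ _
  rw [e1, e2] at h1
  exact h1

end DoubleSubstitution

/-! ### The reflection equation for the generators -/

section Start

lemma sign_mul_cancel {K : Type} [Field K] (n : ℕ) {x y : K} (h : (-1) ^ n * x = (-1) ^ n * y) :
    x = y := mul_left_cancel₀ (pow_ne_zero _ (neg_ne_zero.mpr one_ne_zero)) h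

variable (M : Model) (m n : ℕ)

/-- Extension of a matrix of series by zero to all indices. -/
noncomputable def extend {B : Type} [Zero B] {k N : ℕ} (D : Idx k N → Idx k N → B) (i j : ℕ) : B :=
  if h : i ∈ Finset.Icc k N ∧ j ∈ Finset.Icc k N then D ⟨i, h.1⟩ ⟨j, h.2⟩ else 0

lemma extend_coe {B : Type} [Zero B] {k N : ℕ} (D : Idx k N → Idx k N → B) (i j : Idx k N) :
    extend D i j = D i j := dif_pos ⟨i.2, j.2⟩

section Functional

variable {A : Type} [Ring A] [Algebra ℂ A] {k N : ℕ} (φ : A →ₗ[ℂ] ℂ)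

lemma functional2_reflectionLHS (D : Idx k N → Idx k N → LaurentSeries A)
    (E : ℕ → ℕ → LaurentSeries A) (hE : ∀ i j : Idx k N, E i j = D i j) (i j p r : Idx k N) :
    (-1) ^ gaugeExp m i j p r * functional2 φ (reflectionLHS M m k N D i j p r)
      = reflL (Finset.Icc k N) (eta (Laurent2 ℂ) m) (theta const2 M m varU varV)
        (theta const2 M m varU (M.iota varV)) (M.fb varU varV) (M.fb varU (M.iota varV))
        (valUV m φ E) i j p r := by
  have h := apply_reflectionLHS (K := Laurent2 ℂ) const2 M m (functional2 φ) varU varV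
    (M.iota varV) (fun i j => atU (E i j)) (fun i j => atV (E i j)) i j p r
  simp only [hE] at h
  exact h

lemma functional2_reflectionRHS (D : Idx k N → Idx k N → LaurentSeries A)
    (E : ℕ → ℕ → LaurentSeries A) (hE : ∀ i j : Idx k N, E i j = D i j) (i j p r : Idx k N) :
    (-1) ^ gaugeExp m i j p r * functional2 φ (reflectionRHS M m k N D i j p r)
      = reflR (Finset.Icc k N) (eta (Laurent2 ℂ) m) (theta const2 M m varU varV)
        (theta const2 M m varU (M.iota varV)) (M.fb varU varV) (M.fb varU (M.iota varV))
        (valVU m φ E) i j p r := by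
  have h := apply_reflectionRHS (K := Laurent2 ℂ) const2 M m (functional2 φ) varU varV
    (M.iota varV) (fun i j => atU (E i j)) (fun i j => atV (E i j)) i j p r
  simp only [hE] at h
  exact h

lemma valEq_varX_iff (D : Idx k N → Idx k N → LaurentSeries A) (E : ℕ → ℕ → LaurentSeries A)
    (hE : ∀ i j : Idx k N, E i j = D i j) : ValEq M m k N φ varX E ↔ ∀ i j p r : Idx k N,
      functional2 φ (reflectionLHS M m k N D i j p r)
        = functional2 φ (reflectionRHS M m k N D i j p r) := by
  rw [ValEq, embU_varX, embV_varX]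
  constructor
  · intro h i j p r
    have h1 := h i i.2 j j.2 p p.2 r r.2
    rw [← functional2_reflectionLHS M m φ D E hE, ← functional2_reflectionRHS M m φ D E hE] at h1
    exact sign_mul_cancel (K := Laurent2 ℂ) _ h1
  · intro h i hi j hj p hp r hr
    have h1 := functional2_reflectionLHS M m φ D E hE ⟨i, hi⟩ ⟨j, hj⟩ ⟨p, hp⟩ ⟨r, hr⟩
    have h2 := functional2_reflectionRHS M m φ D E hE ⟨i, hi⟩ ⟨j, hj⟩ ⟨p, hp⟩ ⟨r, hr⟩
    rw [h] at h1
    exact h1.symm.trans h2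

end Functional

/-- The generators with arbitrary indices. -/
noncomputable def genN (i j r : ℕ) : ReflectionAlgebra M m n :=
  extend (fun i j => gen M m n i j r) i j

/-- The projection from the free algebra. -/
noncomputable def projection : FreeAlgebra ℂ (Gen m n) →ₐ[ℂ] ReflectionAlgebra M m n :=
  RingQuot.mkAlgHom ℂ (ReflRel M m n)

/-- The defining relations live in the free algebra, so φ is first pulled back along the projection,
which identifies their two sides. -/
lemma valEq_free (φ : ReflectionAlgebra M m n →ₗ[ℂ] ℂ) :
    ValEq M m 1 (m + n) (φ ∘ₗ (projection M m n).toLinearMap) varX (extend (freeD m n)) := by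
  rw [valEq_varX_iff M m _ _ _ (extend_coe (freeD m n))]
  intro i j p r
  ext a b
  rw [functional2_coeff, functional2_coeff]
  exact congrArg φ (RingQuot.mkAlgHom_rel ℂ (ReflRel.mk i j p r a b))

lemma projection_freeD (i j : ℕ) (a : ℤ) :
    projection M m n ((extend (freeD m n) i j).coeff a)
      = (powerSeries (genN M m n i j)).coeff a := by
  rcases lt_or_ge a 0 with ha | ha
  · rw [coeff_powerSeries_neg _ ha, extend]
    split_ifs with h
    · rw [freeD, coeff_ofPowerSeries_neg _ ha, map_zero]
    · rw [HahnSeries.coeff_zero, map_zero]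
  · lift a to ℕ using ha
    rw [coeff_powerSeries, genN, extend, extend]
    split_ifs with h
    · rw [freeD, HahnSeries.ofPowerSeries_apply_coeff, PowerSeries.coeff_mk]
      rfl
    · rw [HahnSeries.coeff_zero, map_zero]

lemma valEq_gen (φ : ReflectionAlgebra M m n →ₗ[ℂ] ℂ) :
    ValEq M m 1 (m + n) φ varX fun i j => powerSeries (genN M m n i j) := by
  have h := valEq_free M m n φ
  have e1 : valUV m (φ ∘ₗ (projection M m n).toLinearMap) (extend (freeD m n))
      = valUV m φ fun i j => powerSeries (genN M m n i j) := by
    funext i j p r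
    rw [valUV_eq, valUV_eq]
    congr 1
    ext a b
    rw [pairUV_coeff, pairUV_coeff, ← projection_freeD, ← projection_freeD, ← map_mul]
    rfl
  have e2 : valVU m (φ ∘ₗ (projection M m n).toLinearMap) (extend (freeD m n))
      = valVU m φ fun i j => powerSeries (genN M m n i j) := by
    funext i j p r
    rw [valVU_eq, valVU_eq]
    congr 1
    ext a b
    rw [pairVU_coeff, pairVU_coeff, ← projection_freeD, ← projection_freeD, ← map_mul]
    rfl
  rw [ValEq, e1, e2] at h
  exact h

lemma coeff_move_ne_zero (e : ℤ) : (M.move const e varX).coeff (-1) ≠ 0 := by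
  cases M with
  | yangian h =>
    simp [Model.move, varX, const, HahnSeries.C_apply, HahnSeries.coeff_single_of_ne]
  | quantumAffine s =>
    simp only [Model.move, varX, const, HahnSeries.C_apply, HahnSeries.coeff_mul_single_zero,
      HahnSeries.coeff_single_same, one_mul]
    exact zpow_ne_zero _ s.ne_zero

/-- The reflection equation holds for the generators at shifted spectral parameters. -/
theorem valEq_move (φ : ReflectionAlgebra M m n →ₗ[ℂ] ℂ) (e : ℤ) :
    ValEq M m 1 (m + n) φ (M.move const e varX)
      fun i j => evalSeries (genN M m n i j) (M.move const e varX) :=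
  valEq_evalSeries (valEq_gen M m n φ) (coeff_move_ne_zero M e)

end Start

/-! ### Testing membership in a left ideal by functionals -/

section Separation

variable {A : Type} [Ring A] [Algebra ℂ A] {I : Ideal A}

lemma mem_of_forall_functional {x : A}
    (h : ∀ φ : A →ₗ[ℂ] ℂ, (∀ y ∈ I, φ y = 0) → φ x = 0) : x ∈ I := by
  by_contra hx
  obtain ⟨f, hf, hle⟩ := Submodule.exists_le_ker_of_notMem (K := ℂ) (p := I.restrictScalars ℂ) hx
  exact hf (h f fun y hy => hle hy)

lemma smul_mem_ideal (z : ℂ) {x : A} (hx : x ∈ I) : z • x ∈ I :=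
  (I.restrictScalars ℂ).smul_mem z hx

lemma coeff_evalSeries_mem {c : ℕ → A} (hc : ∀ r, c r ∈ I) (g : LaurentSeries ℂ) (l : ℤ) :
    (evalSeries c g).coeff l ∈ I := by
  rcases lt_or_ge l 0 with h | h
  · rw [coeff_evalSeries_neg _ _ h]; exact zero_mem I
  · lift l to ℕ using h
    rw [coeff_evalSeries]
    exact sum_mem fun r _ => smul_mem_ideal _ (hc r)

end Separation

/-! ### The reflection equation for the nested generators -/

section Nested

variable (M : Model) (m n : ℕ)

lemma genN_coe (i j : Idx 1 (m + n)) (r : ℕ) : genN M m n i j r = gen M m n i j r :=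
  extend_coe (fun i j => gen M m n i j r) i j

lemma genN_mem_lowerIdeal {k i l : ℕ} (h : l < i) (hl : l < k) (r : ℕ) :
    genN M m n i l r ∈ lowerIdeal M m n k := by
  rw [genN, extend]
  split_ifs with h1
  · exact Ideal.subset_span ⟨⟨i, h1.1⟩, ⟨l, h1.2⟩, r, h, hl, rfl⟩
  · exact zero_mem _

/-- The generators at shifted spectral parameters. -/
noncomputable def shiftedGen (e : ℤ) (i j : ℕ) : LaurentSeries (ReflectionAlgebra M m n) :=
  evalSeries (genN M m n i j) (M.move const e varX)

variable {M m n} in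
lemma functional_shiftedGen {k : ℕ} {φ : ReflectionAlgebra M m n →ₗ[ℂ] ℂ}
    (hφ : ∀ y ∈ lowerIdeal M m n k, φ y = 0) (e : ℤ) (i l : ℕ) (h : l < i) (hl : l < k)
    (x : ReflectionAlgebra M m n) (r : ℤ) : φ (x * (shiftedGen M m n e i l).coeff r) = 0 :=
  hφ _ (Ideal.mul_mem_left _ _ (coeff_evalSeries_mem (genN_mem_lowerIdeal M m n h hl) _ _))

variable {M m n} in
lemma valEq_chainD_shiftedGen {k : ℕ} (hkN : k ≤ m + n) {φ : ReflectionAlgebra M m n →ₗ[ℂ] ℂ}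
    (hφ : ∀ y ∈ lowerIdeal M m n k, φ y = 0) (e : ℤ) (t : ℕ) (ht : t + 1 ≤ k) :
    ValEq M m (t + 1) (m + n) φ (shiftSeq M m e t)
      (chainD (factor M m (shiftSeq M m e)) (shiftedGen M m n e) t) := by
  refine valEq_chainD (shiftChain_shiftSeq M m e) hkN (functional_shiftedGen hφ e) ?_ t ht
  have h : shiftSeq M m e 0 = M.move const e varX := by simp [shiftSeq]
  rw [h]
  exact valEq_move M m n φ e

/-- Starting the chain at the total shift u^(1…t) makes the parameter after t removals equal to u.
-/
lemma chainD_eq_hatD {t : ℕ} (ht : t + 1 ≤ m + n) (i j : Idx (t + 1) (m + n)) :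
    chainD (factor M m (shiftSeq M m (∑ a ∈ Finset.range t, parity m (a + 1))))
      (shiftedGen M m n (∑ a ∈ Finset.range t, parity m (a + 1))) t i j
      = hatD M m n (Nat.le_add_left 1 t) i j := by
  have hw : shiftSeq M m (∑ a ∈ Finset.range t, parity m (a + 1)) t = varX := by
    rw [shiftSeq, sub_self, Model.move_zero]
  have hg : ∀ i j : Idx 1 (m + n), shiftedGen M m n (∑ a ∈ Finset.range t, parity m (a + 1)) i j
      = evalSeries (gen M m n i j) (M.iterShift const m t varX) := by
    intro i j
    rw [shiftedGen, Model.iterShift_eq_move]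
    congr 1
    funext r
    exact genN_coe M m n i j r
  rw [chainD_eq M m (shiftChain_shiftSeq M m _) (fun t => regular_move M _), hw, hatD, nestedD,
    Nat.add_sub_cancel]
  have e1 : (liftIdx (Nat.le_add_left 1 t) i = liftIdx (Nat.le_add_left 1 t) j) ↔ (i : ℕ) = j :=
    Subtype.ext_iff
  simp only [e1, ← hg]
  congr 2
  have e2 := Finset.sum_coe_sort (Finset.Icc 1 (m + n)) fun a => if a < t + 1 then
    scal (nestedCoeff M m varX t a)
      * shiftedGen M m n (∑ a ∈ Finset.range t, parity m (a + 1)) a a else 0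
  have e3 : (Finset.Icc 1 (m + n)).filter (· < t + 1) = Finset.Icc 1 t := by
    ext x; simp only [Finset.mem_filter, Finset.mem_Icc]; omega
  rw [← e3, Finset.sum_filter, ← e2]
  refine Finset.sum_congr rfl fun a _ => ?_
  rw [nestedCoeff]
  push_cast
  simp only [add_sub_cancel_right]

/-- The nested generators satisfy the reflection equation modulo the left ideal. -/
theorem seriesCongr_hatD {k : ℕ} (hk : 1 ≤ k) (hkN : k ≤ m + n) (i j p r : Idx k (m + n)) :
    SeriesCongr (lowerIdeal M m n k) (reflectionLHS M m k (m + n) (hatD M m n hk) i j p r)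
      (reflectionRHS M m k (m + n) (hatD M m n hk) i j p r) := by
  obtain ⟨t, rfl⟩ : ∃ t, k = t + 1 := ⟨k - 1, by omega⟩
  intro a b
  refine mem_of_forall_functional fun φ hφ => ?_
  have h := valEq_chainD_shiftedGen hkN hφ (∑ a ∈ Finset.range t, parity m (a + 1)) t le_rfl
  have hw : shiftSeq M m (∑ a ∈ Finset.range t, parity m (a + 1)) t = varX := by
    rw [shiftSeq, sub_self, Model.move_zero]
  rw [hw, valEq_varX_iff M m φ _ _ (chainD_eq_hatD M m n hkN)] at h
  rw [map_sub, ← functional2_coeff, ← functional2_coeff, h, sub_self]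

end Nested

/-! ### Commutation under a functional -/

section Commutation

variable {A : Type} [Ring A] [Algebra ℂ A] (φ : A →ₗ[ℂ] ℂ)

/-- A functional vanishes on the commutators of all coefficients of two series. -/
def Comm (f g : LaurentSeries A) : Prop := pairUV φ f g = pairVU φ g f

variable {φ}

lemma comm_iff {f g : LaurentSeries A} :
    Comm φ f g ↔ ∀ a b, φ (f.coeff a * g.coeff b) = φ (g.coeff b * f.coeff a) := by
  constructor
  · intro h a b
    rw [← pairUV_coeff, ← pairVU_coeff, h]
  · intro h
    rw [Comm]
    ext a b
    rw [pairUV_coeff, pairVU_coeff, h]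

lemma Comm.symm {f g : LaurentSeries A} (h : Comm φ f g) : Comm φ g f :=
  comm_iff.mpr fun a b => (comm_iff.mp h b a).symm

lemma Comm.add {f f' g : LaurentSeries A} (h : Comm φ f g) (h' : Comm φ f' g) :
    Comm φ (f + f') g :=
  comm_iff.mpr fun a b => by
    rw [HahnSeries.coeff_add, add_mul, mul_add, map_add, map_add, comm_iff.mp h, comm_iff.mp h']

lemma Comm.sub {f f' g : LaurentSeries A} (h : Comm φ f g) (h' : Comm φ f' g) :
    Comm φ (f - f') g :=
  comm_iff.mpr fun a b => by
    rw [HahnSeries.coeff_sub, sub_mul, mul_sub, map_sub, map_sub, comm_iff.mp h, comm_iff.mp h']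

lemma Comm.zero (g : LaurentSeries A) : Comm φ 0 g :=
  comm_iff.mpr fun a b => by simp

lemma Comm.sum {ι : Type} {s : Finset ι} {f : ι → LaurentSeries A} {g : LaurentSeries A}
    (h : ∀ i ∈ s, Comm φ (f i) g) : Comm φ (∑ i ∈ s, f i) g :=
  Finset.sum_induction f (Comm φ · g) (fun _ _ => Comm.add) (Comm.zero g) h

lemma pairUV_scal_mul (c : LaurentSeries ℂ) (f g : LaurentSeries A) :
    pairUV φ (scal c * f) g = embU c * pairUV φ f g := by
  rw [pairUV, atU_scal_mul, smul_mul_assoc, map_smul, smul_eq_mul, pairUV]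

lemma pairVU_scal_mul (c : LaurentSeries ℂ) (f g : LaurentSeries A) :
    pairVU φ g (scal c * f) = embU c * pairVU φ g f := by
  rw [pairVU, atU_scal_mul, mul_smul_comm, map_smul, smul_eq_mul, pairVU]

lemma Comm.scal_mul {f g : LaurentSeries A} (h : Comm φ f g) (c : LaurentSeries ℂ) :
    Comm φ (scal c * f) g := by
  rw [Comm, pairUV_scal_mul, pairVU_scal_mul, h]

lemma pairUV_mul_right (c : LaurentSeries ℂ) (f g : LaurentSeries A) :
    pairUV φ f (scal c * g) = embV c * pairUV φ f g := by
  rw [pairUV, atV_scal_mul, mul_smul_comm, map_smul, smul_eq_mul, pairUV]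

end Commutation

/-! ### From corrected series back to the generators -/

section Levels

variable {A : Type} [Ring A] [Algebra ℂ A] {φ : A →ₗ[ℂ] ℂ} {M : Model} {m N k : ℕ}
  {w : ℕ → LaurentSeries ℂ} {e : ℕ → ℕ → LaurentSeries A}

lemma valUV_eq_zero {D : ℕ → ℕ → LaurentSeries A} {i j p r : ℕ} (h : valUV m φ D i j p r = 0) :
    pairUV φ (D i j) (D p r) = 0 := by
  rw [valUV_eq] at h
  exact sign_mul_cancel (K := Laurent2 ℂ) _ (h.trans (mul_zero (_ : Laurent2 ℂ)).symm)

lemma comm_of_valUV_eq {D : ℕ → ℕ → LaurentSeries A} {i j p r : ℕ}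
    (h : valUV m φ D i j p r = valVU m φ D p r i j) : Comm φ (D i j) (D p r) := by
  rw [valUV_eq, valVU_eq, add_comm (genExp m p r)] at h
  exact sign_mul_cancel (K := Laurent2 ℂ) _ h

lemma comm_chainD (hw : ShiftChain M m w) (hkN : k ≤ N)
    (hφ : ∀ i l : ℕ, l < i → l < k → ∀ (x : A) (r : ℤ), φ (x * (e i l).coeff r) = 0)
    (h1 : ValEq M m 1 N φ (w 0) e) {t p r : ℕ} (ht : t + 1 < k)
    (hpr : (p = t + 1 ∧ r = t + 1) ∨ (p ∈ Finset.Icc (t + 2) N ∧ r ∈ Finset.Icc (t + 2) N)) :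
    Comm φ (chainD (factor M m w) e t p r) (chainD (factor M m w) e t (t + 1) (t + 1)) := by
  have h := valEq_chainD hw hkN hφ h1 t ht.le
  obtain ⟨α, β, αb, βb, P⟩ := hw.exists_pivotData N t
  rw [ValEq, Icc_eq_insert (by omega)] at h
  have hA : ∀ x ∈ insert (t + 1) (Finset.Icc (t + 2) N),
      ∀ y ∈ insert (t + 1) (Finset.Icc (t + 2) N), ∀ p ∈ Finset.Icc (t + 2) N,
      valUV m φ (chainD (factor M m w) e t) x y p (t + 1) = 0 :=
    fun x _ y _ p hp => valUV_lower hφ _ ht (by simp only [Finset.mem_Icc] at hp; omega) x y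
  have hB : ∀ x ∈ insert (t + 1) (Finset.Icc (t + 2) N),
      ∀ y ∈ insert (t + 1) (Finset.Icc (t + 2) N), ∀ p ∈ Finset.Icc (t + 2) N,
      valVU m φ (chainD (factor M m w) e t) x y p (t + 1) = 0 :=
    fun x _ y _ p hp => valVU_lower hφ _ ht (by simp only [Finset.mem_Icc] at hp; omega) x y
  rcases hpr with ⟨rfl, rfl⟩ | ⟨hp, hr⟩
  · exact comm_of_valUV_eq (P.pivot_pivot h hA hB)
  · exact comm_of_valUV_eq (P.pivot_comm_right h hA hB hp hr)

lemma lower_mul_chainD (hw : ShiftChain M m w) (hkN : k ≤ N)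
    (hφ : ∀ i l : ℕ, l < i → l < k → ∀ (x : A) (r : ℤ), φ (x * (e i l).coeff r) = 0)
    (h1 : ValEq M m 1 N φ (w 0) e) {t i p r : ℕ} (ht : t + 1 < k)
    (hi : i ∈ Finset.Icc (t + 2) N) (hp : p ∈ Finset.Icc (t + 2) N)
    (hr : r ∈ Finset.Icc (t + 2) N) :
    pairUV φ (chainD (factor M m w) e t i (t + 1)) (chainD (factor M m w) e t p r) = 0 := by
  have h := valEq_chainD hw hkN hφ h1 t ht.le
  obtain ⟨α, β, αb, βb, P⟩ := hw.exists_pivotData N t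
  rw [ValEq, Icc_eq_insert (by omega)] at h
  refine valUV_eq_zero (P.lower_upper_left h ?_ ?_ hi hp hr)
  · exact fun x _ y _ p hp =>
      valUV_lower hφ _ ht (by simp only [Finset.mem_Icc] at hp; omega) x y
  · exact fun x _ y _ p hp =>
      valVU_lower hφ _ ht (by simp only [Finset.mem_Icc] at hp; omega) x y

variable (hw : ShiftChain M m w) (hreg : ∀ t, M.Regular (w t)) (hkN : k ≤ N)
  (hφ : ∀ i l : ℕ, l < i → l < k → ∀ (x : A) (r : ℤ), φ (x * (e i l).coeff r) = 0)
  (h1 : ValEq M m 1 N φ (w 0) e)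

include hw hreg hkN hφ h1

/-- At level t the corrected entries commute. The correction s is a combination of d_aa with a ≤ t,
which by induction commute under φ with each other and with all entries concerned, so s can be added
back on both sides. -/
lemma comm_diagonal (t : ℕ) : ∀ p r : ℕ, t + 1 < k →
    ((p = t + 1 ∧ r = t + 1) ∨ (p ∈ Finset.Icc (t + 2) N ∧ r ∈ Finset.Icc (t + 2) N)) →
    Comm φ (e p r) (e (t + 1) (t + 1)) := by
  induction t using Nat.strong_induction_on with
  | _ t ih =>
    intro p r ht hpr
    have low : ∀ a ∈ Finset.Icc 1 t, ∀ p r : ℕ,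
        ((p = t + 1 ∧ r = t + 1) ∨ (p ∈ Finset.Icc (t + 2) N ∧ r ∈ Finset.Icc (t + 2) N)) →
        Comm φ (e a a) (e p r) := by
      intro a ha p r hpr
      simp only [Finset.mem_Icc] at ha hpr
      obtain ⟨b, rfl⟩ : ∃ b, a = b + 1 := ⟨a - 1, by omega⟩
      refine (ih b (by omega) p r (by omega) (Or.inr ?_)).symm
      simp only [Finset.mem_Icc]
      omega
    have diag : ∀ a ∈ Finset.Icc 1 t, ∀ b ∈ Finset.Icc 1 t, Comm φ (e a a) (e b b) := by
      intro a ha b hb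
      simp only [Finset.mem_Icc] at ha hb
      obtain ⟨a, rfl⟩ : ∃ c, a = c + 1 := ⟨a - 1, by omega⟩
      obtain ⟨b, rfl⟩ : ∃ c, b = c + 1 := ⟨b - 1, by omega⟩
      rcases lt_trichotomy a b with h | h | h
      · refine (ih a (by omega) _ _ (by omega) (Or.inr ?_)).symm
        simp only [Finset.mem_Icc]
        omega
      · subst h
        exact ih a (by omega) _ _ (by omega) (Or.inl ⟨rfl, rfl⟩)
      · refine ih b (by omega) _ _ (by omega) (Or.inr ?_)
        simp only [Finset.mem_Icc]
        omega
    set s := ∑ a ∈ Finset.Icc 1 t, scal (nestedCoeff M m (w t) t a) * e a a with hs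
    have hD : ∀ p r, e p r = chainD (factor M m w) e t p r + if p = r then s else 0 := by
      intro p r
      rw [chainD_eq M m hw hreg, sub_add_cancel]
    have c1 : ∀ p r : ℕ,
        ((p = t + 1 ∧ r = t + 1) ∨ (p ∈ Finset.Icc (t + 2) N ∧ r ∈ Finset.Icc (t + 2) N)) →
        Comm φ s (e p r) :=
      fun p r h => Comm.sum fun a ha => (low a ha p r h).scal_mul _
    have c2 : Comm φ s s := Comm.sum fun a ha => Comm.scal_mul
      (Comm.symm (Comm.sum fun b hb => (diag b hb a ha).scal_mul _)) _
    have c3 : Comm φ (if p = r then s else 0) (e (t + 1) (t + 1)) := by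
      split_ifs
      · exact c1 _ _ (Or.inl ⟨rfl, rfl⟩)
      · exact Comm.zero _
    have c4 : Comm φ s (chainD (factor M m w) e t p r) := by
      have h : chainD (factor M m w) e t p r = e p r - if p = r then s else 0 := by
        rw [hD p r, add_sub_cancel_right]
      rw [h]
      refine Comm.symm (Comm.sub (c1 p r hpr).symm ?_)
      split_ifs
      · exact c2
      · exact Comm.zero _
    have c5 := comm_chainD hw hkN hφ h1 ht hpr
    rw [hD p r]
    refine Comm.add ?_ c3
    rw [hD (t + 1) (t + 1), if_pos rfl]
    exact Comm.symm (c5.symm.add c4)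

/-- At the level of l the product with the corrected d_pr vanishes. The correction contributes d_il
d_aa with a < l; by `comm_diagonal` it equals d_aa d_il under φ, and the left ideal kills that. -/
lemma lower_mul_upper {l i p r : ℕ} (hl1 : 1 ≤ l) (hl : l < k) (hi : i ∈ Finset.Icc (l + 1) N)
    (hp : p ∈ Finset.Icc (l + 1) N) (hr : r ∈ Finset.Icc (l + 1) N) :
    pairUV φ (e i l) (e p r) = 0 := by
  obtain ⟨t, rfl⟩ : ∃ t, l = t + 1 := ⟨l - 1, by omega⟩
  have h := lower_mul_chainD hw hkN hφ h1 hl hi hp hr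
  have hil : i ≠ t + 1 := by simp only [Finset.mem_Icc] at hi; omega
  have hz : ∀ a ∈ Finset.Icc 1 t, pairUV φ (e i (t + 1)) (e a a) = 0 := by
    intro a ha
    simp only [Finset.mem_Icc] at ha hi
    obtain ⟨b, rfl⟩ : ∃ b, a = b + 1 := ⟨a - 1, by omega⟩
    have hc := comm_diagonal hw hreg hkN hφ h1 b i (t + 1) (by omega)
      (Or.inr (by simp only [Finset.mem_Icc]; omega))
    rw [hc]
    ext x y
    rw [pairVU_coeff, hφ i (t + 1) (by omega) hl]
    rfl
  rw [chainD_of_ne _ _ _ hil, chainD_eq M m hw hreg] at h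
  have hs : pairUV φ (e i (t + 1)) (if p = r then
      ∑ a ∈ Finset.Icc 1 t, scal (nestedCoeff M m (w t) t a) * e a a else 0) = 0 := by
    split_ifs
    · rw [pairUV, atV, map_sum, Finset.mul_sum, map_sum]
      refine Finset.sum_eq_zero fun a ha => ?_
      have h3 := pairUV_mul_right (φ := φ) (nestedCoeff M m (w t) t a) (e i (t + 1)) (e a a)
      rw [hz a ha] at h3
      exact h3.trans (mul_zero (_ : Laurent2 ℂ))
    · rw [pairUV, atV_zero, mul_zero, map_zero]
  rw [pairUV, atV_sub, mul_sub, map_sub] at h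
  exact (sub_eq_zero.mp h).trans hs

end Levels

/-! ### Products of generators and the left ideal -/

section Generators

variable (M : Model) (m n : ℕ) {k : ℕ}

lemma functional_powerSeries {φ : ReflectionAlgebra M m n →ₗ[ℂ] ℂ}
    (hφ : ∀ y ∈ lowerIdeal M m n k, φ y = 0) (i l : ℕ) (h : l < i) (hl : l < k)
    (x : ReflectionAlgebra M m n) (r : ℤ) :
    φ (x * (powerSeries (genN M m n i l)).coeff r) = 0 := by
  rcases lt_or_ge r 0 with hr | hr
  · rw [coeff_powerSeries_neg _ hr, mul_zero, map_zero]
  · lift r to ℕ using hr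
    rw [coeff_powerSeries]
    exact hφ _ (Ideal.mul_mem_left _ _ (genN_mem_lowerIdeal M m n h hl r))

lemma valEq_shiftSeq (φ : ReflectionAlgebra M m n →ₗ[ℂ] ℂ) :
    ValEq M m 1 (m + n) φ (shiftSeq M m 0 0) fun i j => powerSeries (genN M m n i j) := by
  -- With total shift 0 the chain starts at the unshifted generators, as statement (1) requires;
  -- later levels use the inverse shifts.
  have h : shiftSeq M m 0 0 = varX := by simp [shiftSeq, Model.move_zero]
  rw [h]
  exact valEq_gen M m n φ

lemma gen_mul_gen_mem (hkN : k ≤ m + n) {i l p r : Idx 1 (m + n)} (hli : l < i) (hl : (l : ℕ) < k)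
    (hp : k ≤ (p : ℕ)) (hr : k ≤ (r : ℕ)) (a b : ℕ) :
    gen M m n i l a * gen M m n p r b ∈ lowerIdeal M m n k := by
  refine mem_of_forall_functional fun φ hφ => ?_
  have bnd : ∀ x : Idx 1 (m + n), 1 ≤ (x : ℕ) ∧ (x : ℕ) ≤ m + n :=
    fun x => Finset.mem_Icc.mp x.2
  have hli' : (l : ℕ) < i := hli
  have h := lower_mul_upper (shiftChain_shiftSeq M m 0) (fun t => regular_move M _) hkN
    (functional_powerSeries M m n hφ) (valEq_shiftSeq M m n φ) (bnd l).1 hl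
    (Finset.mem_Icc.mpr ⟨hli', (bnd i).2⟩) (Finset.mem_Icc.mpr ⟨by omega, (bnd p).2⟩)
    (Finset.mem_Icc.mpr ⟨by omega, (bnd r).2⟩)
  have h2 := pairUV_coeff φ (powerSeries (genN M m n i l)) (powerSeries (genN M m n p r)) a b
  rw [h, coeff_powerSeries, coeff_powerSeries, genN_coe, genN_coe] at h2
  exact h2.symm

lemma gen_comm_gen_mem (hkN : k ≤ m + n) {l p r : Idx 1 (m + n)} (hl : (l : ℕ) < k)
    (hp : k ≤ (p : ℕ)) (hr : k ≤ (r : ℕ)) (a b : ℕ) :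
    gen M m n l l a * gen M m n p r b - gen M m n p r b * gen M m n l l a
      ∈ lowerIdeal M m n k := by
  refine mem_of_forall_functional fun φ hφ => ?_
  have bnd : ∀ x : Idx 1 (m + n), 1 ≤ (x : ℕ) ∧ (x : ℕ) ≤ m + n :=
    fun x => Finset.mem_Icc.mp x.2
  obtain ⟨t, ht⟩ : ∃ t, (l : ℕ) = t + 1 := ⟨l - 1, by have := bnd l; omega⟩
  have h := comm_diagonal (shiftChain_shiftSeq M m 0) (fun t => regular_move M _) hkN
    (functional_powerSeries M m n hφ) (valEq_shiftSeq M m n φ) t p r (by omega)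
    (Or.inr ⟨Finset.mem_Icc.mpr ⟨by omega, (bnd p).2⟩, Finset.mem_Icc.mpr ⟨by omega, (bnd r).2⟩⟩)
  have h2 := comm_iff.mp h b a
  rw [coeff_powerSeries, coeff_powerSeries, ← ht, genN_coe, genN_coe] at h2
  rw [map_sub, h2, sub_self]

/-- For a generator F it suffices to treat x = d_il, because the left coefficients of elements of
the ideal play no role. Stability of the whole ideal, not just of its generators, lets factors be
multiplied in one at a time. -/
lemma mul_mem_lowerIdeal (hkN : k ≤ m + n) {F : ReflectionAlgebra M m n}
    (hF : F ∈ upperSubalgebra M m n k) :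
    ∀ x ∈ lowerIdeal M m n k, x * F ∈ lowerIdeal M m n k := by
  induction hF using Algebra.adjoin_induction with
  | mem F hF =>
    obtain ⟨p, r, b, hp, hr, rfl⟩ := hF
    intro x hx
    induction hx using Submodule.span_induction with
    | mem x hx =>
      obtain ⟨i, l, a, hli, hl, rfl⟩ := hx
      exact gen_mul_gen_mem M m n hkN hli hl hp hr a b
    | zero => rw [zero_mul]; exact zero_mem _
    | add x y _ _ hx hy => rw [add_mul]; exact add_mem hx hy
    | smul c x _ hx => rw [smul_eq_mul, mul_assoc]; exact Ideal.mul_mem_left _ _ hx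
  | algebraMap z =>
    intro x hx
    rw [← Algebra.commutes]
    exact Ideal.mul_mem_left _ _ hx
  | add F G _ _ hF hG => exact fun x hx => by rw [mul_add]; exact add_mem (hF x hx) (hG x hx)
  | mul F G _ _ hF hG => exact fun x hx => by rw [← mul_assoc]; exact hG _ (hF x hx)

lemma comm_mem_lowerIdeal (hkN : k ≤ m + n) {F : ReflectionAlgebra M m n}
    (hF : F ∈ upperSubalgebra M m n k) {l : Idx 1 (m + n)} (hl : (l : ℕ) < k) (a : ℕ) :
    gen M m n l l a * F - F * gen M m n l l a ∈ lowerIdeal M m n k := by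
  induction hF using Algebra.adjoin_induction with
  | mem F hF =>
    obtain ⟨p, r, b, hp, hr, rfl⟩ := hF
    exact gen_comm_gen_mem M m n hkN hl hp hr a b
  | algebraMap z => rw [Algebra.commutes, sub_self]; exact zero_mem _
  | add F G _ _ hF hG =>
    rw [mul_add, add_mul, add_sub_add_comm]
    exact add_mem hF hG
  | mul F G _ hG' hF hG =>
    -- The Leibniz rule leaves [d_ll, F] G, which stays in the left ideal only because G is upper.
    have h : gen M m n l l a * (F * G) - F * G * gen M m n l l a
        = (gen M m n l l a * F - F * gen M m n l l a) * G
          + F * (gen M m n l l a * G - G * gen M m n l l a) := by noncomm_ring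
    rw [h]
    exact add_mem (mul_mem_lowerIdeal M m n hkN hG' _ hF) (Ideal.mul_mem_left _ _ hG)

end Generators
end OpenChain

theorem mainTheorem3 (M : OpenChain.Model) (m n k : ℕ) (hk : 1 ≤ k) (hkN : k + 1 ≤ m + n) :
    (∀ F ∈ OpenChain.upperSubalgebra M m n k, ∀ (i j : OpenChain.Idx 1 (m + n)) (r : ℕ),
      j < i → (j : ℕ) < k →
        OpenChain.gen M m n i j r * F ∈ OpenChain.lowerIdeal M m n k) ∧
    (∀ F ∈ OpenChain.upperSubalgebra M m n k, ∀ (i : OpenChain.Idx 1 (m + n)) (r : ℕ),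
      (i : ℕ) < k →
        OpenChain.gen M m n i i r * F - F * OpenChain.gen M m n i i r ∈
          OpenChain.lowerIdeal M m n k) ∧
    (∀ i j p r : OpenChain.Idx k (m + n),
      OpenChain.SeriesCongr (OpenChain.lowerIdeal M m n k)
        (OpenChain.reflectionLHS M m k (m + n) (OpenChain.hatD M m n hk) i j p r)
        (OpenChain.reflectionRHS M m k (m + n) (OpenChain.hatD M m n hk) i j p r)) := by
  have hkN' : k ≤ m + n := by omega
  refine ⟨fun F hF i j r hji hj => ?_, fun F hF i r hi => ?_, ?_⟩
  · exact OpenChain.mul_mem_lowerIdeal M m n hkN' hF _ (Ideal.subset_span ⟨i, j, r, hji, hj, rfl⟩)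
  · exact OpenChain.comm_mem_lowerIdeal M m n hkN' hF hi r
  · exact OpenChain.seriesCongr_hatD M m n hk hkN'
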